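/- Let $M$ be a Riemannian manifold whose curvature tensor $R(X,Y)=[\nabla_X,\nabla_Y]-\nabla_{[X,Y]}$ is parallel, $\nabla R=0$. Consider multiplets $\Phi=\{u,\psi_1,\psi_2,F'\}$ of smooth component fields on $\mathbb R^2$ (coordinates $x,y$), parametrized by a superpoint $\mathbb R^{0|L}$: $u\colon\mathbb R^2\times\mathbb R^{0|L}\to M$ is a map of supermanifolds (an even algebra morphism $f\mapsto f(u)$ from $C^\infty(M)$ to smooth functions on $\mathbb R^2$ with values in the Grassmann algebra on $L$ generators, lying over a smooth map $\mathbb R^2\to M$), $\psi_1,\psi_2$ are odd sections of $u^*TM$, and $F'$ is an even section of $u^*TM$. Derivatives of sections of $u^*TM$ are taken with the pull-back of the Levi-Civita connection; put $\triangle u=\nabla_x\frac{\partial u}{\partial x}+\nabla_y\frac{\partial u}{\partial y}$ and $$D\!\!\!\!/_u\psi=\begin{pmatrix}\nabla_y\psi_1-\nabla_x\psi_2\\ -\nabla_x\psi_1-\nabla_y\psi_2\end{pmatrix},\qquad \langle\psi D\!\!\!\!/_u\psi\rangle=\langle\psi_1,(D\!\!\!\!/_u\psi)_2\rangle-\langle\psi_2,(D\!\!\!\!/_u\psi)_1\rangle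 .$$ The metric and the curvature are extended multilinearly to sections with Grassmann coefficients, the coefficients being multiplied in the order in which the arguments are written. The action is $\mathcal A(\Phi)=\int L\,dx\,dy$ with $$L=-\tfrac12|du|^2+\tfrac12\langle\psi D\!\!\!\!/_u\psi\rangle+\tfrac1{12}\varepsilon^{ab}\varepsilon^{cd}\langle\psi_a,R(\psi_b,\psi_c)\psi_d\rangle+\tfrac12|F'|^2 ,$$ where $\varepsilon^{12}=-\varepsilon^{21}=1$, $\varepsilon^{11}=\varepsilon^{22}=0$ and repeated indices are summed. Call $\Phi$ a critical point of $\mathcal A$ if the first variation of $\mathcal A$ at $\Phi$ vanishes for all smooth one-parameter families of multiplets through $\Phi$ that are constant outside a compact subset of $\mathbb R^2$, where the families may depend on additional odd parameters (i.e. are parametrized by any $\mathbb R^{0|L'}$, $L'\ge L$). Then the Euler–Lagrange equations of $\mathcal A$ are the following: $\Phi$ is a critical point of $\mathcal A$ if and only if $$\triangle u=\tfrac12\bigl(R(\psi_1,\psi_1)-R(\psi_2,\psi_2)\bigr)\frac{\partial u}{\partial x}+R(\psi_1,\psi_2)\frac{\partial u}{\partial y},\qquad D\!\!\!\!/_u\psi=\begin{pmatrix}R(\psi_1,\psi_2)\psi_1\\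 -R(\psi_1,\psi_2)\psi_2\end{pmatrix},\qquad F'=0 .$$ -/

import Mathlib

open scoped Manifold ContDiff Topology
open MeasureTheory

noncomputable section

namespace SuperSigma

/-! ### Grassmann algebras -/

/-- The real Grassmann algebra on `L` odd generators, i.e. the functions on `ℝ^{0|L}`. -/
abbrev Grassmann (L : ℕ) : Type := ExteriorAlgebra ℝ (Fin L → ℝ)

/-- The basis of products of generators, indexed by the subsets of the generators. -/
def grassmannBasis (L : ℕ) : Module.Basis (Finset (Fin L)) ℝ (Grassmann L) :=
  (Pi.basisFun ℝ (Fin L)).ExteriorAlgebra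

instance (L : ℕ) : FiniteDimensional ℝ (Grassmann L) :=
  Module.Finite.of_basis (grassmannBasis L)

/-- A Grassmann algebra is a finite dimensional real vector space; smoothness, derivatives and
integrals of Grassmann-valued functions do not depend on the norm. Here the norm is the sup norm of
the coordinates. -/
instance (L : ℕ) : NormedAddCommGroup (Grassmann L) :=
  NormedAddCommGroup.induced (Grassmann L) (Finset (Fin L) → ℝ)
    (grassmannBasis L).equivFun (grassmannBasis L).equivFun.injective

instance (L : ℕ) : NormedSpace ℝ (Grassmann L) :=
  NormedSpace.induced ℝ (Grassmann L) (Finset (Fin L) → ℝ) (grassmannBasis L).equivFun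

/-- The even part of a Grassmann algebra. -/
def evenPart (L : ℕ) : Submodule ℝ (Grassmann L) :=
  CliffordAlgebra.evenOdd (0 : QuadraticForm ℝ (Fin L → ℝ)) 0

/-- The odd part of a Grassmann algebra. -/
def oddPart (L : ℕ) : Submodule ℝ (Grassmann L) :=
  CliffordAlgebra.evenOdd (0 : QuadraticForm ℝ (Fin L → ℝ)) 1

/-- The augmentation (body) of a Grassmann number: all odd generators are set to `0`. -/
def bodyMap (L : ℕ) : Grassmann L →ₐ[ℝ] ℝ := ExteriorAlgebra.algebraMapInv

/-- Extension of a vector by zero. -/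
def extendZero (L L' : ℕ) : (Fin L → ℝ) →ₗ[ℝ] (Fin L' → ℝ) where
  toFun v i := if h : (i : ℕ) < L then v ⟨i, h⟩ else 0
  map_add' v w := by
    funext i
    by_cases h : (i : ℕ) < L <;> simp [h]
  map_smul' a v := by
    funext i
    by_cases h : (i : ℕ) < L <;> simp [h]

/-- The inclusion of the Grassmann algebra on `L` generators into the one on `L' ≥ L` generators,
sending the `i`-th generator to the `i`-th generator. -/
def inclusion (L L' : ℕ) : Grassmann L →ₐ[ℝ] Grassmann L' :=
  ExteriorAlgebra.map (extendZero L L')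

theorem inclusion_mem_evenOdd {L L' : ℕ} (i : ZMod 2) {x : Grassmann L}
    (hx : x ∈ CliffordAlgebra.evenOdd (0 : QuadraticForm ℝ (Fin L → ℝ)) i) :
    inclusion L L' x ∈ CliffordAlgebra.evenOdd (0 : QuadraticForm ℝ (Fin L' → ℝ)) i := by
  have hι : ∀ v : Fin L → ℝ, inclusion L L' (CliffordAlgebra.ι 0 v)
      = CliffordAlgebra.ι 0 (extendZero L L' v) := fun v => ExteriorAlgebra.map_apply_ι _ v
  induction x, hx using CliffordAlgebra.evenOdd_induction with
  | range_ι_pow v hv =>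
    have hle : (LinearMap.range (CliffordAlgebra.ι (0 : QuadraticForm ℝ (Fin L → ℝ)))).map
        (inclusion L L').toLinearMap
        ≤ LinearMap.range (CliffordAlgebra.ι (0 : QuadraticForm ℝ (Fin L' → ℝ))) := by
      rintro _ ⟨_, ⟨v, rfl⟩, rfl⟩
      exact ⟨extendZero L L' v, (hι v).symm⟩
    have h1 : inclusion L L' v
        ∈ (LinearMap.range (CliffordAlgebra.ι (0 : QuadraticForm ℝ (Fin L' → ℝ)))) ^ i.val := by
      have h2 := Submodule.mem_map_of_mem (f := (inclusion L L').toLinearMap) hv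
      rw [Submodule.map_pow] at h2
      exact pow_le_pow_left' hle _ h2
    exact Submodule.mem_iSup_of_mem
      (p := fun j : { m : ℕ // (m : ZMod 2) = i } =>
        (LinearMap.range (CliffordAlgebra.ι (0 : QuadraticForm ℝ (Fin L' → ℝ)))) ^ (j : ℕ))
      ⟨i.val, ZMod.natCast_zmod_val i⟩ h1
  | add x y hx hy hx' hy' =>
    rw [map_add]
    exact add_mem hx' hy'
  | ι_mul_ι_mul v w x hx hx' =>
    rw [map_mul, map_mul, hι, hι]
    exact zero_add i ▸ SetLike.mul_mem_graded (CliffordAlgebra.ι_mul_ι_mem_evenOdd_zero _ _ _) hx'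

theorem bodyMap_inclusion {L L' : ℕ} (x : Grassmann L) :
    bodyMap L' (inclusion L L' x) = bodyMap L x := by
  have h : (bodyMap L').comp (inclusion L L') = bodyMap L := by
    apply ExteriorAlgebra.hom_ext
    ext v
    simp [bodyMap, inclusion, ExteriorAlgebra.algebraMapInv]
  exact DFunLike.congr_fun h x

theorem contDiff_inclusion (L L' : ℕ) :
    ContDiff ℝ ∞ (inclusion L L' : Grassmann L → Grassmann L') :=
  (LinearMap.toContinuousLinearMap (inclusion L L').toLinearMap).contDiff

/-! ### Component fields -/

/-- The coordinate space `ℝⁿ`. -/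
abbrev Eucl (n : ℕ) : Type := EuclideanSpace ℝ (Fin n)

/-- Smooth real functions on an `n`-dimensional manifold. -/
abbrev SmoothFun (n : ℕ) (M : Type*) [TopologicalSpace M] [ChartedSpace (Eucl n) M] : Type _ :=
  C^∞⟮𝓡 n, M; 𝓘(ℝ, ℝ), ℝ⟯

/-- A multiplet `(u, ψ₁, ψ₂, F')` of component fields on the space `P` with values in the manifold
`M` and with `ℝ^{0|L}` as space of odd parameters.

* `u` is a morphism of supermanifolds `P × ℝ^{0|L} → M`: a smooth map `body : P → M` with a family
  `pull p` of algebra morphisms `f ↦ f(u)(p)` from smooth functions to even Grassmann numbers lying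
  over `body` and depending smoothly on `p`.
* `ψ 0`, `ψ 1` (standing for `ψ₁`, `ψ₂`) are odd sections of `u^*TM` and `F` (standing for `F'`) is
  an even section of `u^*TM`; a section `X` of `u^*TM` is the derivation `f ↦ df(u).X` along `u`. -/
structure Multiplet (n : ℕ) (M : Type*) [TopologicalSpace M] [ChartedSpace (Eucl n) M]
    (L : ℕ) (P : Type*) [NormedAddCommGroup P] [NormedSpace ℝ P] where
  body : P → M
  pull : P → SmoothFun n M →ₐ[ℝ] Grassmann L
  ψ : Fin 2 → P → SmoothFun n M →ₗ[ℝ] Grassmann L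
  F : P → SmoothFun n M →ₗ[ℝ] Grassmann L
  pull_even : ∀ p f, pull p f ∈ evenPart L
  bodyMap_pull : ∀ p f, bodyMap L (pull p f) = f (body p)
  ψ_odd : ∀ a p f, ψ a p f ∈ oddPart L
  ψ_leibniz : ∀ a p f h, ψ a p (f * h) = pull p f * ψ a p h + pull p h * ψ a p f
  F_even : ∀ p f, F p f ∈ evenPart L
  F_leibniz : ∀ p f h, F p (f * h) = pull p f * F p h + pull p h * F p f
  contMDiff_body : ContMDiff 𝓘(ℝ, P) (𝓡 n) ∞ body
  contDiff_pull : ∀ f, ContDiff ℝ ∞ fun p => pull p f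
  contDiff_ψ : ∀ a f, ContDiff ℝ ∞ fun p => ψ a p f
  contDiff_F : ∀ f, ContDiff ℝ ∞ fun p => F p f

namespace Multiplet

variable {n : ℕ} {M : Type*} [TopologicalSpace M] [ChartedSpace (Eucl n) M] {L : ℕ}
  {P : Type*} [NormedAddCommGroup P] [NormedSpace ℝ P]

/-- The same fields, regarded as depending on a larger set of odd parameters. -/
def baseChange (Φ : Multiplet n M L P) (L' : ℕ) : Multiplet n M L' P where
  body := Φ.body
  pull p := (inclusion L L').comp (Φ.pull p)
  ψ a p := (inclusion L L').toLinearMap ∘ₗ Φ.ψ a p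
  F p := (inclusion L L').toLinearMap ∘ₗ Φ.F p
  pull_even p f := inclusion_mem_evenOdd 0 (Φ.pull_even p f)
  bodyMap_pull p f := (bodyMap_inclusion _).trans (Φ.bodyMap_pull p f)
  ψ_odd a p f := inclusion_mem_evenOdd 1 (Φ.ψ_odd a p f)
  ψ_leibniz a p f h := by simp [Φ.ψ_leibniz]
  F_even p f := inclusion_mem_evenOdd 0 (Φ.F_even p f)
  F_leibniz p f h := by simp [Φ.F_leibniz]
  contMDiff_body := Φ.contMDiff_body
  contDiff_pull f := (contDiff_inclusion L L').comp (Φ.contDiff_pull f)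
  contDiff_ψ a f := (contDiff_inclusion L L').comp (Φ.contDiff_ψ a f)
  contDiff_F f := (contDiff_inclusion L L').comp (Φ.contDiff_F f)

/-- The member at time `t` of a smooth one-parameter family of multiplets. -/
def slice (V : Multiplet n M L (ℝ × P)) (t : ℝ) : Multiplet n M L P where
  body p := V.body (t, p)
  pull p := V.pull (t, p)
  ψ a p := V.ψ a (t, p)
  F p := V.F (t, p)
  pull_even p := V.pull_even (t, p)
  bodyMap_pull p := V.bodyMap_pull (t, p)
  ψ_odd a p := V.ψ_odd a (t, p)
  ψ_leibniz a p := V.ψ_leibniz a (t, p)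
  F_even p := V.F_even (t, p)
  F_leibniz p := V.F_leibniz (t, p)
  contMDiff_body := V.contMDiff_body.comp
    (contDiff_const.prodMk contDiff_id : ContDiff ℝ ∞ fun p : P => (t, p)).contMDiff
  contDiff_pull f :=
    (V.contDiff_pull f).comp (contDiff_const.prodMk contDiff_id : ContDiff ℝ ∞ fun p : P => (t, p))
  contDiff_ψ a f :=
    (V.contDiff_ψ a f).comp (contDiff_const.prodMk contDiff_id : ContDiff ℝ ∞ fun p : P => (t, p))
  contDiff_F f :=
    (V.contDiff_F f).comp (contDiff_const.prodMk contDiff_id : ContDiff ℝ ∞ fun p : P => (t, p))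

/-- Two multiplets have the same values at the point `p`. -/
def AgreeAt (Φ Ψ : Multiplet n M L P) (p : P) : Prop :=
  Φ.body p = Ψ.body p ∧ Φ.pull p = Ψ.pull p ∧ (∀ a, Φ.ψ a p = Ψ.ψ a p) ∧ Φ.F p = Ψ.F p

end Multiplet

/-! ### Riemannian geometry in a chart

The charts are `extChartAt (𝓡 n) c`, for `c : M`, and `x` is a point in the image of the chart. -/

section Riemannian

variable {n : ℕ} {M : Type*} [TopologicalSpace M] [ChartedSpace (Eucl n) M]
  [IsManifold (𝓡 n) ∞ M]

/-- A smooth Riemannian metric on `M`. -/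
abbrev Metric (n : ℕ) (M : Type*) [TopologicalSpace M] [ChartedSpace (Eucl n) M]
    [IsManifold (𝓡 n) ∞ M] : Type _ :=
  Bundle.ContMDiffRiemannianMetric (𝓡 n) ∞ (Eucl n) fun m : M => TangentSpace (𝓡 n) m

/-- The partial derivative `∂_i h` of a function on `ℝⁿ`. -/
def partialDeriv (i : Fin n) (h : Eucl n → ℝ) (x : Eucl n) : ℝ :=
  fderiv ℝ h x (EuclideanSpace.single i 1)

/-- The coordinate vector field `∂_i` of the chart at `c`, at the point with coordinates `x`. -/
def coordVector (c : M) (i : Fin n) (x : Eucl n) :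
    TangentSpace (𝓡 n) ((extChartAt (𝓡 n) c).symm x) :=
  mfderivWithin 𝓘(ℝ, Eucl n) (𝓡 n) (extChartAt (𝓡 n) c).symm (Set.range (𝓡 n)) x
    (EuclideanSpace.single i (1 : ℝ) : Eucl n)

/-- The matrix `g_{ij} = g(∂_i, ∂_j)`. -/
def gram (g : Metric n M) (c : M) (x : Eucl n) : Matrix (Fin n) (Fin n) ℝ :=
  Matrix.of fun i j =>
    g.inner ((extChartAt (𝓡 n) c).symm x) (coordVector c i x) (coordVector c j x)

/-- The Christoffel symbol `Γ^k_{ij}` of the Levi-Civita connection. -/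
def christoffel (g : Metric n M) (c : M) (k i j : Fin n) (x : Eucl n) : ℝ :=
  (1 / 2) * ∑ l, (gram g c x)⁻¹ k l *
    (partialDeriv i (fun y => gram g c y j l) x + partialDeriv j (fun y => gram g c y i l) x
      - partialDeriv l (fun y => gram g c y i j) x)

/-- The component `R^l_{ijk}` of the curvature: `R(∂_i, ∂_j) ∂_k = ∑ l, R^l_{ijk} ∂_l`, where
`R(X, Y) = ∇_X ∇_Y - ∇_Y ∇_X - ∇_{[X, Y]}`. -/
def riemann (g : Metric n M) (c : M) (l i j k : Fin n) (x : Eucl n) : ℝ :=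
  partialDeriv i (christoffel g c l j k) x - partialDeriv j (christoffel g c l i k) x
    + ∑ m, (christoffel g c l i m x * christoffel g c m j k x
      - christoffel g c l j m x * christoffel g c m i k x)

/-- The component `(∇_m R)^l_{ijk}` of the covariant derivative of the curvature. -/
def covDerivRiemann (g : Metric n M) (c : M) (m l i j k : Fin n) (x : Eucl n) : ℝ :=
  partialDeriv m (riemann g c l i j k) x
    + ∑ a, (christoffel g c l m a x * riemann g c a i j k x
      - christoffel g c a m i x * riemann g c l a j k x
      - christoffel g c a m j x * riemann g c l i a k x
      - christoffel g c a m k x * riemann g c l i j a x)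

/-- The curvature is parallel: `∇R = 0`. -/
def ParallelCurvature (g : Metric n M) : Prop :=
  ∀ c : M, ∀ x ∈ (extChartAt (𝓡 n) c).target, ∀ m l i j k, covDerivRiemann g c m l i j k x = 0

end Riemannian

/-! ### The action

Points of `ℝ²` are pairs `(x, y)`. A section of `u^*TM` near a point is given by its components in
a chart of `M`, which are Grassmann-valued functions. Products of odd components are always taken in
the order in which the sections are written. -/

section Action

variable {n : ℕ} {M : Type*} [TopologicalSpace M] [ChartedSpace (Eucl n) M] {L : ℕ}

/-- The partial derivative of a Grassmann-valued function on `ℝ²`: with respect to `x` for `k = 0`,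
with respect to `y` for `k = 1`. -/
def pd (k : Fin 2) (h : ℝ × ℝ → Grassmann L) (p : ℝ × ℝ) : Grassmann L :=
  fderiv ℝ h p (![(1, 0), (0, 1)] k)

open Classical in
/-- The value of a morphism `pull p`, or of a derivation along it, on a function that is only
defined and smooth near the point `m = body p`: its value on any globally smooth function with the
same germ at `m`. -/
def germEval (D : SmoothFun n M →ₗ[ℝ] Grassmann L) (m : M) (h : M → ℝ) : Grassmann L :=
  if H : ∃ f : SmoothFun n M, (f : M → ℝ) =ᶠ[𝓝 m] h then D H.choose else 0

/-- The sections of `u^*TM` written in a chart: Grassmann-valued component functions on `ℝ²`. -/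
abbrev Comp (n L : ℕ) : Type := ℝ × ℝ → Fin n → Grassmann L

/-- The coordinate `x^i` of the chart at `c`, as a function on `M`. -/
def coordFun (c : M) (i : Fin n) (m : M) : ℝ := extChartAt (𝓡 n) c m i

namespace Multiplet

variable (Φ : Multiplet n M L (ℝ × ℝ)) (c : M)

/-- The coordinates `u^i` of `u`. -/
def uCoord (i : Fin n) (p : ℝ × ℝ) : Grassmann L :=
  germEval (Φ.pull p).toLinearMap (Φ.body p) (coordFun c i)

/-- The section `∂u/∂x` (`k = 0`) or `∂u/∂y` (`k = 1`) of `u^*TM`. -/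
def du (k : Fin 2) : Comp n L := fun p i => pd k (Φ.uCoord c i) p

/-- The components of `ψ_{a+1}`. -/
def ψComp (a : Fin 2) : Comp n L := fun p i => germEval (Φ.ψ a p) (Φ.body p) (coordFun c i)

/-- The components of `F'`. -/
def FComp : Comp n L := fun p i => germEval (Φ.F p) (Φ.body p) (coordFun c i)

/-- The value `T(u)` at `p` of a function `T` of the coordinates of the chart. -/
def coeff (T : Eucl n → ℝ) (p : ℝ × ℝ) : Grassmann L :=
  germEval (Φ.pull p).toLinearMap (Φ.body p) fun m => T (extChartAt (𝓡 n) c m)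

variable [IsManifold (𝓡 n) ∞ M] (g : Metric n M)

/-- The covariant derivative of a section of `u^*TM` in the direction `x` (`k = 0`) or `y`
(`k = 1`), for the pull-back of the Levi-Civita connection. -/
def nabla (k : Fin 2) (Y : Comp n L) : Comp n L := fun p l =>
  pd k (fun q => Y q l) p
    + ∑ i, ∑ j, Φ.coeff c (christoffel g c l i j) p * Φ.du c k p i * Y p j

/-- The metric `⟨X, Y⟩` on sections of `u^*TM`. -/
def inner (X Y : Comp n L) (p : ℝ × ℝ) : Grassmann L :=
  ∑ i, ∑ j, Φ.coeff c (fun x => gram g c x i j) p * X p i * Y p j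

/-- The curvature `R(X, Y)Z` on sections of `u^*TM`. -/
def curv (X Y Z : Comp n L) : Comp n L := fun p l =>
  ∑ i, ∑ j, ∑ k, Φ.coeff c (riemann g c l i j k) p * X p i * Y p j * Z p k

/-- The tension field `Δu = ∇_x ∂_x u + ∇_y ∂_y u`. -/
def laplacian : Comp n L := fun p l =>
  Φ.nabla c g 0 (Φ.du c 0) p l + Φ.nabla c g 1 (Φ.du c 1) p l

/-- The first component `∇_y ψ₁ - ∇_x ψ₂` of the twisted Dirac operator. -/
def dirac₁ : Comp n L := fun p l =>
  Φ.nabla c g 1 (Φ.ψComp c 0) p l - Φ.nabla c g 0 (Φ.ψComp c 1) p l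

/-- The second component `- ∇_x ψ₁ - ∇_y ψ₂` of the twisted Dirac operator. -/
def dirac₂ : Comp n L := fun p l =>
  - Φ.nabla c g 0 (Φ.ψComp c 0) p l - Φ.nabla c g 1 (Φ.ψComp c 1) p l

/-- The antisymmetric symbol `ε^{ab}` with `ε^{12} = 1`. -/
def eps : Matrix (Fin 2) (Fin 2) ℝ := !![0, 1; -1, 0]

/-- The Lagrangian written in the chart at `c`. -/
def lagrangianInChart (p : ℝ × ℝ) : Grassmann L :=
  - (1 / 2 : ℝ) • ∑ k, Φ.inner c g (Φ.du c k) (Φ.du c k) p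
  + (1 / 2 : ℝ) • (Φ.inner c g (Φ.ψComp c 0) (Φ.dirac₂ c g) p
      - Φ.inner c g (Φ.ψComp c 1) (Φ.dirac₁ c g) p)
  + (1 / 12 : ℝ) • ∑ a, ∑ b, ∑ d, ∑ e, (eps a b * eps d e) •
      Φ.inner c g (Φ.ψComp c a) (Φ.curv c g (Φ.ψComp c b) (Φ.ψComp c d) (Φ.ψComp c e)) p
  + (1 / 2 : ℝ) • Φ.inner c g (Φ.FComp c) (Φ.FComp c) p

/-- The Lagrangian `L = -½|du|² + ½⟨ψ D̸_u ψ⟩ + (1/12) ε^{ab} ε^{cd} ⟨ψ_a, R(ψ_b, ψ_c) ψ_d⟩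
+ ½|F'|²`, computed at each point `p` in the preferred chart at `body p`. -/
def lagrangian (p : ℝ × ℝ) : Grassmann L := Φ.lagrangianInChart (Φ.body p) g p

/-- The action over a region of `ℝ²`. -/
def action (K : Set (ℝ × ℝ)) : Grassmann L := ∫ p in K, Φ.lagrangian g p

/-- `Φ` is a critical point of the action: the first variation of the action vanishes for every
smooth one-parameter family of multiplets through `Φ` that is constant outside a compact set `K`.
The family may depend on additional odd parameters. As nothing changes outside `K`, the variation
of the action is that of the action over `K` (the integral over `ℝ²` itself need not converge). -/
def IsCritical : Prop :=
  ∀ L' : ℕ, L ≤ L' → ∀ K : Set (ℝ × ℝ), IsCompact K →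
    ∀ V : Multiplet n M L' (ℝ × (ℝ × ℝ)),
      (∀ p, (V.slice 0).AgreeAt (Φ.baseChange L') p) →
      (∀ t, ∀ p ∉ K, (V.slice t).AgreeAt (Φ.baseChange L') p) →
      HasDerivAt (fun t : ℝ => (V.slice t).action g K) 0 0

end Multiplet

end Action

end SuperSigma

end

noncomputable section

namespace SuperSigma

set_option linter.unusedSectionVars false

/-! ### Algebra and calculus of Grassmann numbers -/

section GrassmannAlgebra

variable {L : ℕ}

/-! The theorem is a first variation formula combined with the fundamental lemma of the calculus of
variations; the work lies in making both valid for Grassmann-valued fields.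

A morphism `u` is known only through its values on global functions. A Grassmann number with body
one is not a zero divisor, because elements of positive degree are nilpotent; multiplying with bump
functions therefore shows that `u` and all derivations along it depend only on germs
(`IsPointOver.isLocalAt`, `IsDerivAlong.isLocalAt`). So functions living in a chart, such as
coordinates and Christoffel symbols, can be evaluated along `u`. Hadamard's lemma and the same
nilpotency give the chain rule `chartEval_deriv`: a derivation along `u` is determined by its
coordinate components. Applied to the derivatives of `u`, it transports classical identities in a
chart to identities along `u`: the pulled-back connection is metric, torsion-free and has curvature
`R`, the curvature tensor along `u` is parallel, and the Lagrangian does not depend on the chart.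

A family of multiplets is regarded as one multiplet over the enlarged parameter space `ℝ × ℝ²`, so
that time is just another direction τ. In a chart, `fderiv_lagIn` gives ∂_τ L = ⟨∂_τ u, E_u⟩ + ⟨∇_τ
ψ₁, E₁⟩ - ⟨∇_τ ψ₂, E₂⟩ + ⟨∇_τ F', F'⟩ + divergence. The kinetic term contributes the tension field
by torsion-freeness. In the Dirac term ∇_τ is commuted past ∇_x and ∇_y; the resulting terms ⟨ψ,
R(∂_τ u, ∂u) ψ⟩ become coefficients of ∂_τ u by pair symmetry. The quartic term equals ½⟨ψ₁, R(ψ₁,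
ψ₂) ψ₂⟩ by the Bianchi identity, and since `R` is parallel only its four spinor arguments are
differentiated. The fluxes vanish outside the compact set `K`, so the divergence integrates to zero
(`hasDerivAt_action`). Hence solutions are critical.

Conversely, one tests with families that are linear in time: cut-off coordinate derivatives with a
Grassmann coefficient. Varying `ψ₁`, `ψ₂` with a new odd generator as coefficient, and `F'` with
coefficient 1, gives E₁ = E₂ = F' = 0. Then `u` is varied with the product of two new odd generators
as coefficient. This product is even, has body zero and square zero, so the linear family is an
exact family of algebra morphisms. Multiplication by new generators is injective on the old
Grassmann algebra, hence E_u = 0 as well (`solvesAt_of_isCritical`). -/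

theorem ι_mul_mul_ι_comm (v w : Fin L → ℝ) (x : Grassmann L) :
    Commute (ExteriorAlgebra.ι ℝ v * ExteriorAlgebra.ι ℝ w) x := by
  have sw : ∀ a b : Fin L → ℝ, ExteriorAlgebra.ι ℝ a * ExteriorAlgebra.ι ℝ b
      = -(ExteriorAlgebra.ι ℝ b * ExteriorAlgebra.ι ℝ a) := fun a b =>
    eq_neg_of_add_eq_zero_left (ExteriorAlgebra.ι_add_mul_swap a b)
  refine CliffordAlgebra.left_induction (P := fun x => Commute _ x) 0 ?_ ?_ ?_ x
  · intro r
    exact (Algebra.commutes r _).symm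
  · intro x y hx hy
    exact hx.add_right hy
  · intro x m hx
    refine Commute.mul_right ?_ hx
    change _ * ExteriorAlgebra.ι ℝ m = ExteriorAlgebra.ι ℝ m * _
    rw [mul_assoc, sw w m, mul_neg, ← mul_assoc, sw v m, neg_mul, neg_neg, mul_assoc]

/-- Even elements are spanned by products of pairs of generators and scalars; a pair is central
because the two signs picked up in passing a generator cancel. -/
theorem even_comm {x : Grassmann L} (hx : x ∈ evenPart L) (y : Grassmann L) : x * y = y * x := by
  induction x, hx using CliffordAlgebra.even_induction with
  | algebraMap r => exact Algebra.commutes r y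
  | add x x' hx hx' h h' => rw [add_mul, mul_add, h, h']
  | ι_mul_ι_mul v w x hx h => exact Commute.mul_left (ι_mul_mul_ι_comm v w y) h

theorem odd_anticomm {x y : Grassmann L} (hx : x ∈ oddPart L) (hy : y ∈ oddPart L) :
    x * y = -(y * x) := by
  have sw : ∀ a b : Fin L → ℝ, ExteriorAlgebra.ι ℝ a * ExteriorAlgebra.ι ℝ b
      = -(ExteriorAlgebra.ι ℝ b * ExteriorAlgebra.ι ℝ a) := fun a b =>
    eq_neg_of_add_eq_zero_left (ExteriorAlgebra.ι_add_mul_swap a b)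
  have hι : ∀ (v : Fin L → ℝ) (y : Grassmann L), y ∈ oddPart L →
      ExteriorAlgebra.ι ℝ v * y = -(y * ExteriorAlgebra.ι ℝ v) := by
    intro v y hy
    induction y, hy using CliffordAlgebra.odd_induction with
    | ι w => exact sw v w
    | add x x' hx hx' h h' => rw [add_mul, mul_add, h, h', neg_add]
    | ι_mul_ι_mul w w' x hx h =>
      have := (ι_mul_mul_ι_comm w w' (ExteriorAlgebra.ι ℝ v)).eq
      change _ * (ExteriorAlgebra.ι ℝ w * ExteriorAlgebra.ι ℝ w' * x)
        = -(ExteriorAlgebra.ι ℝ w * ExteriorAlgebra.ι ℝ w' * x * _)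
      rw [← mul_assoc, ← this, mul_assoc, h, mul_neg, mul_assoc, mul_assoc, mul_assoc]
  induction x, hx using CliffordAlgebra.odd_induction with
  | ι w => exact hι w y hy
  | add x x' hx hx' h h' => rw [add_mul, mul_add, h, h', neg_add]
  | ι_mul_ι_mul w w' x hx h =>
    have := (ι_mul_mul_ι_comm w w' y).eq
    change ExteriorAlgebra.ι ℝ w * ExteriorAlgebra.ι ℝ w' * x * y
        = -(y * (ExteriorAlgebra.ι ℝ w * ExteriorAlgebra.ι ℝ w' * x))
    rw [mul_assoc, h, mul_neg, ← mul_assoc, this, mul_assoc]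

theorem algebraMap_mem_even (r : ℝ) : algebraMap ℝ (Grassmann L) r ∈ evenPart L := by
  have h : (1 : Grassmann L) ∈ evenPart L :=
    Submodule.one_le.mp (CliffordAlgebra.one_le_evenOdd_zero _)
  rw [Algebra.algebraMap_eq_smul_one]
  exact Submodule.smul_mem _ _ h

theorem even_mul_even {x y : Grassmann L} (hx : x ∈ evenPart L) (hy : y ∈ evenPart L) :
    x * y ∈ evenPart L := by
  have := SetLike.mul_mem_graded (A := CliffordAlgebra.evenOdd (0 : QuadraticForm ℝ (Fin L → ℝ)))
    hx hy
  rwa [add_zero] at this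

theorem even_mul_odd {x y : Grassmann L} (hx : x ∈ evenPart L) (hy : y ∈ oddPart L) :
    x * y ∈ oddPart L := by
  have := SetLike.mul_mem_graded (A := CliffordAlgebra.evenOdd (0 : QuadraticForm ℝ (Fin L → ℝ)))
    hx hy
  rwa [zero_add] at this

theorem odd_mul_even {x y : Grassmann L} (hx : x ∈ oddPart L) (hy : y ∈ evenPart L) :
    x * y ∈ oddPart L := by
  rw [← even_comm hy]
  exact even_mul_odd hy hx

theorem odd_mul_odd {x y : Grassmann L} (hx : x ∈ oddPart L) (hy : y ∈ oddPart L) :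
    x * y ∈ evenPart L := by
  have := SetLike.mul_mem_graded (A := CliffordAlgebra.evenOdd (0 : QuadraticForm ℝ (Fin L → ℝ)))
    hx hy
  have h2 : (1 : ZMod 2) + 1 = 0 := by decide
  rwa [h2] at this

theorem ι_mem_odd (v : Fin L → ℝ) : ExteriorAlgebra.ι ℝ v ∈ oddPart L :=
  CliffordAlgebra.ι_mem_evenOdd_one _ v

/-- The Grassmann numbers of degree at least `k`. -/
def degreeGE (L k : ℕ) : Submodule ℝ (Grassmann L) :=
  ⨆ m : { m : ℕ // k ≤ m }, ⋀[ℝ]^(m : ℕ) (Fin L → ℝ)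

theorem degreeGE_mul {j k : ℕ} {x y : Grassmann L} (hx : x ∈ degreeGE L j)
    (hy : y ∈ degreeGE L k) : x * y ∈ degreeGE L (j + k) := by
  have hle : degreeGE L j * degreeGE L k ≤ degreeGE L (j + k) := by
    unfold degreeGE
    rw [Submodule.iSup_mul]
    refine iSup_le fun a => ?_
    rw [Submodule.mul_iSup]
    refine iSup_le fun b => ?_
    have : ⋀[ℝ]^(a : ℕ) (Fin L → ℝ) * ⋀[ℝ]^(b : ℕ) (Fin L → ℝ)
        = ⋀[ℝ]^((a : ℕ) + b) (Fin L → ℝ) := (pow_add _ _ _).symm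
    rw [this]
    exact le_iSup (fun m : { m : ℕ // j + k ≤ m } => ⋀[ℝ]^(m : ℕ) (Fin L → ℝ))
      ⟨(a : ℕ) + b, add_le_add a.2 b.2⟩
  exact hle (Submodule.mul_mem_mul hx hy)

/-- The dimension of an exterior power is a binomial coefficient, which is zero beyond degree `L`.
Hence an element of every filtration step vanishes, which is the end of both nilpotency arguments
below. -/
theorem degreeGE_eq_bot : degreeGE L (L + 1) = ⊥ := by
  refine iSup_eq_bot.mpr fun m => ?_
  have h : Module.finrank ℝ (⋀[ℝ]^(m : ℕ) (Fin L → ℝ)) = 0 := by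
    rw [exteriorPower.finrank_eq]
    exact Nat.choose_eq_zero_of_lt (by simpa using m.2)
  have hf : Module.Finite ℝ (⋀[ℝ]^(m : ℕ) (Fin L → ℝ)) := inferInstance
  exact Submodule.finrank_eq_zero.mp h

theorem sub_bodyMap_mem (x : Grassmann L) :
    x - algebraMap ℝ _ (bodyMap L x) ∈ degreeGE L 1 := by
  refine CliffordAlgebra.left_induction
    (P := fun x => x - algebraMap ℝ (Grassmann L) (bodyMap L x) ∈ degreeGE L 1) 0 ?_ ?_ ?_ x
  · intro r
    have : bodyMap L (algebraMap ℝ _ r) = r := AlgHom.commutes _ _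
    change algebraMap ℝ _ r - algebraMap ℝ (Grassmann L) (bodyMap L (algebraMap ℝ _ r)) ∈ _
    rw [this, sub_self]
    exact zero_mem _
  · intro x y hx hy
    rw [map_add, map_add, add_sub_add_comm]
    exact add_mem hx hy
  · intro x m hx
    change ExteriorAlgebra.ι ℝ m * x
      - algebraMap ℝ (Grassmann L) (bodyMap L (ExteriorAlgebra.ι ℝ m * x)) ∈ _
    have h0 : bodyMap L (ExteriorAlgebra.ι ℝ m) = 0 := by
      simp [bodyMap, ExteriorAlgebra.algebraMapInv]
    rw [map_mul, h0, zero_mul, map_zero, sub_zero]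
    have h1 : ∀ k, degreeGE L (k + 1) ≤ degreeGE L k := fun k =>
      iSup_le fun j => le_iSup (fun m : { m : ℕ // k ≤ m } => ⋀[ℝ]^(m : ℕ) (Fin L → ℝ))
        ⟨j, (Nat.le_succ k).trans j.2⟩
    have hm : ExteriorAlgebra.ι ℝ m ∈ degreeGE L 1 := by
      refine Submodule.mem_iSup_of_mem ⟨1, le_rfl⟩ ?_
      change _ ∈ (LinearMap.range (ExteriorAlgebra.ι ℝ (M := Fin L → ℝ))) ^ 1
      rw [pow_one]
      exact ⟨m, rfl⟩
    have hx' : x = (x - algebraMap ℝ _ (bodyMap L x)) + (bodyMap L x) • 1 := by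
      rw [Algebra.algebraMap_eq_smul_one, sub_add_cancel]
    rw [hx', mul_add, mul_smul_comm, mul_one]
    exact add_mem (h1 1 (degreeGE_mul hm hx)) (Submodule.smul_mem _ _ hm)

theorem mem_degreeGE_one {x : Grassmann L} (hx : bodyMap L x = 0) : x ∈ degreeGE L 1 := by
  have := sub_bodyMap_mem x
  rwa [hx, map_zero, sub_zero] at this

theorem mem_degreeGE_zero (x : Grassmann L) : x ∈ degreeGE L 0 := by
  have h : (⊤ : Submodule ℝ (Grassmann L)) ≤ degreeGE L 0 := by
    have := (DirectSum.Decomposition.isInternal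
      (fun n => ⋀[ℝ]^n (Fin L → ℝ))).submodule_iSup_eq_top
    rw [← this]
    exact iSup_le fun j => le_iSup (fun m : { m : ℕ // 0 ≤ m } => ⋀[ℝ]^(m : ℕ) (Fin L → ℝ))
      ⟨j, Nat.zero_le j⟩
  exact h trivial

theorem eq_zero_of_forall_mem_degreeGE {x : Grassmann L} (hx : ∀ k, x ∈ degreeGE L k) :
    x = 0 := by
  have := hx (L + 1)
  rwa [degreeGE_eq_bot, Submodule.mem_bot] at this

/-- Write x = 1 - ν with ν of positive degree. The equation becomes y = ν y, so the degree of y can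
be raised without end. This is the algebraic source of the locality of morphisms and derivations. -/
theorem eq_zero_of_mul_eq_zero {x y : Grassmann L} (hx : bodyMap L x = 1) (h : x * y = 0) :
    y = 0 := by
  refine eq_zero_of_forall_mem_degreeGE fun k => ?_
  induction k with
  | zero => exact mem_degreeGE_zero y
  | succ k ih =>
    have h1 : (1 - x) ∈ degreeGE L 1 := mem_degreeGE_one (by rw [map_sub, map_one, hx, sub_self])
    have h2 := degreeGE_mul h1 ih
    rwa [sub_mul, h, one_mul, sub_zero, add_comm] at h2

/-- The product of a new generator with a Grassmann number in the old ones vanishes only if the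
latter does. -/
theorem eq_zero_of_ι_mul {x : Grassmann L} {v : Fin L → ℝ} {d : Module.Dual ℝ (Fin L → ℝ)}
    (hv : d v = 1) (hx : CliffordAlgebra.contractLeft (Q := 0) d x = 0)
    (h : ExteriorAlgebra.ι ℝ v * x = 0) : x = 0 := by
  have h1 : CliffordAlgebra.contractLeft (Q := 0) d (CliffordAlgebra.ι 0 v * x) = 0 := by
    have h' : CliffordAlgebra.ι 0 v * x = 0 := h
    rw [h', map_zero]
  -- Contraction is an antiderivation, so contracting the product gives d(v) x minus v times the
  -- contraction of x, which is just x.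
  rw [CliffordAlgebra.contractLeft_ι_mul, hx, mul_zero, sub_zero, hv, one_smul] at h1
  exact h1

/-- The antiderivation given by `d` kills all old generators, hence everything they generate.
Contraction with the dual of a new generator thus sees only that generator. -/
theorem contractLeft_inclusion {L' : ℕ} {d : Module.Dual ℝ (Fin L' → ℝ)}
    (hd : ∀ v, d (extendZero L L' v) = 0) (x : Grassmann L) :
    CliffordAlgebra.contractLeft (Q := 0) d (inclusion L L' x) = 0 := by
  refine CliffordAlgebra.left_induction
    (P := fun x => CliffordAlgebra.contractLeft (Q := 0) d (inclusion L L' x) = 0) 0 ?_ ?_ ?_ x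
  · intro r
    have : inclusion L L' (algebraMap ℝ (Grassmann L) r) = algebraMap ℝ _ r := AlgHom.commutes _ _
    rw [this]
    exact CliffordAlgebra.contractLeft_algebraMap 0 d r
  · intro x y hx hy
    rw [map_add, map_add, hx, hy, add_zero]
  · intro x m hx
    have hι : inclusion L L' (CliffordAlgebra.ι 0 m) = CliffordAlgebra.ι 0 (extendZero L L' m) :=
      ExteriorAlgebra.map_apply_ι _ m
    rw [map_mul, hι, CliffordAlgebra.contractLeft_ι_mul, hx, hd, zero_smul, mul_zero, sub_zero]

end GrassmannAlgebra

/-! ### Differential calculus of Grassmann-valued functions -/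

section GrassmannCalculus

variable {L : ℕ} {P : Type*} [NormedAddCommGroup P] [NormedSpace ℝ P]

/-- Multiplication of Grassmann numbers as a continuous bilinear map. -/
def mulL (L : ℕ) : Grassmann L →L[ℝ] Grassmann L →L[ℝ] Grassmann L :=
  LinearMap.toContinuousBilinearMap (LinearMap.mul ℝ (Grassmann L))

theorem mulL_apply (x y : Grassmann L) : mulL L x y = x * y := rfl

theorem contDiffAt_gmul {k : ℕ∞ω} {f h : P → Grassmann L} {p : P} (hf : ContDiffAt ℝ k f p)
    (hh : ContDiffAt ℝ k h p) : ContDiffAt ℝ k (fun q => f q * h q) p :=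
  ((mulL L).contDiff.contDiffAt.comp p hf).clm_apply hh

theorem fderiv_gmul {f h : P → Grassmann L} {p : P} (hf : DifferentiableAt ℝ f p)
    (hh : DifferentiableAt ℝ h p) (v : P) :
    fderiv ℝ (fun q => f q * h q) p v = fderiv ℝ f p v * h p + f p * fderiv ℝ h p v := by
  have := congrArg (fun T => T v) ((mulL L).fderiv_of_bilinear hf hh)
  simp only [mulL_apply] at this
  rw [this, add_comm]
  rfl

/-- A linear subspace is preserved by taking derivatives. -/
theorem fderiv_mem {f : P → Grassmann L} (S : Submodule ℝ (Grassmann L)) {p : P}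
    (hf : ∀ᶠ q in 𝓝 p, f q ∈ S) (hd : DifferentiableAt ℝ f p) (v : P) : fderiv ℝ f p v ∈ S := by
  obtain ⟨T, hT⟩ := S.exists_isCompl
  -- The projection onto a complement along S has kernel S. Membership in S becomes the vanishing of
  -- a continuous linear map, and such a map commutes with differentiation.
  set π : Grassmann L →L[ℝ] Grassmann L :=
    LinearMap.toContinuousLinearMap (T.subtype ∘ₗ T.projectionOnto S hT.symm)
  have h0 : ∀ x, π x = 0 ↔ x ∈ S := by
    intro x
    change ((T.projectionOnto S hT.symm x : T) : Grassmann L) = 0 ↔ _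
    rw [ZeroMemClass.coe_eq_zero, Submodule.projectionOnto_apply_eq_zero_iff]
  have h1 : (fun q => π (f q)) =ᶠ[𝓝 p] fun _ => 0 := hf.mono fun q hq => (h0 _).mpr hq
  have h2 : fderiv ℝ (fun q => π (f q)) p = 0 := by rw [h1.fderiv_eq]; simp
  have h3 : fderiv ℝ (fun q => π (f q)) p = π.comp (fderiv ℝ f p) :=
    π.hasFDerivAt.comp p hd.hasFDerivAt |>.fderiv
  rw [h3] at h2
  exact (h0 _).mp (congrArg (fun T => T v) h2)

end GrassmannCalculus

/-! ### Functions that are smooth near a point -/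

section SmoothNear

variable {E F : Type*} [NormedAddCommGroup E] [NormedSpace ℝ E] [NormedAddCommGroup F]
  [NormedSpace ℝ F]

/-- The function `f` is smooth in a neighbourhood of `x`. -/
def SmoothNear (f : E → F) (x : E) : Prop := ∀ᶠ y in 𝓝 x, ContDiffAt ℝ ∞ f y

namespace SmoothNear

variable {f h : E → F} {x : E}

theorem contDiffAt (hf : SmoothNear f x) : ContDiffAt ℝ ∞ f x := hf.self_of_nhds

theorem differentiableAt (hf : SmoothNear f x) : DifferentiableAt ℝ f x :=
  hf.contDiffAt.differentiableAt (by simp)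

/-- Plain `ContDiffAt ℝ ∞` only provides a neighbourhood for each finite order and need not persist
at nearby points. Demanding it at all nearby points makes smoothness an open condition, so it
survives repeated differentiation. -/
theorem eventually (hf : SmoothNear f x) : ∀ᶠ y in 𝓝 x, SmoothNear f y :=
  eventually_eventually_nhds.mpr hf

theorem congr (hf : SmoothNear f x) (hfh : f =ᶠ[𝓝 x] h) : SmoothNear h x := by
  filter_upwards [hf, hfh.eventuallyEq_nhds] with y hy hy'
  exact hy.congr_of_eventuallyEq hy'.symm

theorem of_contDiff (hf : ContDiff ℝ ∞ f) : SmoothNear f x :=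
  Filter.Eventually.of_forall fun _ => hf.contDiffAt

theorem of_contDiffOn {s : Set E} (hf : ContDiffOn ℝ ∞ f s) (hs : IsOpen s) (hx : x ∈ s) :
    SmoothNear f x := by
  filter_upwards [hs.mem_nhds hx] with y hy
  exact hf.contDiffAt (hs.mem_nhds hy)

theorem const (b : F) : SmoothNear (fun _ : E => b) x := of_contDiff contDiff_const

theorem add (hf : SmoothNear f x) (hh : SmoothNear h x) : SmoothNear (fun y => f y + h y) x := by
  filter_upwards [hf, hh] with y h1 h2 using h1.add h2

theorem sub (hf : SmoothNear f x) (hh : SmoothNear h x) : SmoothNear (fun y => f y - h y) x := by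
  filter_upwards [hf, hh] with y h1 h2 using h1.sub h2

theorem neg (hf : SmoothNear f x) : SmoothNear (fun y => - f y) x := by
  filter_upwards [hf] with y h1 using h1.neg

theorem const_smul (r : ℝ) (hf : SmoothNear f x) : SmoothNear (fun y => r • f y) x := by
  filter_upwards [hf] with y h1 using h1.const_smul r

theorem sum {ι : Type*} {s : Finset ι} {f : ι → E → F} (hf : ∀ i ∈ s, SmoothNear (f i) x) :
    SmoothNear (fun y => ∑ i ∈ s, f i y) x := by
  have h := (Filter.eventually_all_finset s).mpr hf
  filter_upwards [h] with y hy using ContDiffAt.sum hy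

theorem fderiv_apply (hf : SmoothNear f x) (v : E) : SmoothNear (fun y => fderiv ℝ f y v) x := by
  filter_upwards [hf] with y h1
  exact (h1.fderiv_right (m := ∞) (by simp)).clm_apply contDiffAt_const

theorem mul {f h : E → ℝ} (hf : SmoothNear f x) (hh : SmoothNear h x) :
    SmoothNear (fun y => f y * h y) x := by
  filter_upwards [hf, hh] with y h1 h2 using h1.mul h2

theorem gmul {L : ℕ} {f h : E → Grassmann L} (hf : SmoothNear f x) (hh : SmoothNear h x) :
    SmoothNear (fun y => f y * h y) x := by
  filter_upwards [hf, hh] with y h1 h2 using contDiffAt_gmul h1 h2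

theorem comp {G : Type*} [NormedAddCommGroup G] [NormedSpace ℝ G] {k : G → E} {z : G}
    (hf : SmoothNear f (k z)) (hk : SmoothNear k z) : SmoothNear (fun y => f (k y)) z := by
  filter_upwards [hk.contDiffAt.continuousAt.eventually hf, hk] with y h1 h2 using h1.comp y h2

theorem fderiv_comm (hf : SmoothNear f x) (v w : E) :
    fderiv ℝ (fun y => fderiv ℝ f y v) x w = fderiv ℝ (fun y => fderiv ℝ f y w) x v := by
  have hd : DifferentiableAt ℝ (fderiv ℝ f) x :=
    (hf.contDiffAt.fderiv_right (m := 1) (by norm_cast)).differentiableAt (by simp)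
  have hs : IsSymmSndFDerivAt ℝ f x := hf.contDiffAt.isSymmSndFDerivAt (by
    rw [minSmoothness_of_isRCLikeNormedField]; norm_cast)
  have key : ∀ v w, fderiv ℝ (fun y => fderiv ℝ f y v) x w = fderiv ℝ (fderiv ℝ f) x w v := by
    intro v w
    rw [fderiv_clm_apply hd (differentiableAt_const v)]
    simp
  rw [key, key, hs.eq]

end SmoothNear

end SmoothNear

/-! ### Hadamard's lemma -/

section Hadamard

/-- Differentiating under the integral sign yields an integral of the same kind, now with values in
continuous linear maps. The induction on the order therefore quantifies over the target, and `E` and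
`F` share a universe so that the new target is again admissible. -/
theorem contDiff_integral_param {E : Type} [NormedAddCommGroup E] [NormedSpace ℝ E]
    [FiniteDimensional ℝ E] (k : ℕ) : ∀ {F : Type} [NormedAddCommGroup F] [NormedSpace ℝ F]
    [CompleteSpace F] {f : ℝ × E → F}, ContDiff ℝ ∞ f →
    ContDiff ℝ k fun x => ∫ s in (0 : ℝ)..1, f (s, x) := by
  have key : ∀ {F : Type} [NormedAddCommGroup F] [NormedSpace ℝ F]
    [CompleteSpace F] {f : ℝ × E → F}, ContDiff ℝ ∞ f → ∀ x, HasFDerivAt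
      (fun x => ∫ s in (0 : ℝ)..1, f (s, x))
      (∫ s in (0 : ℝ)..1, (fderiv ℝ f (s, x)).comp (ContinuousLinearMap.inr ℝ ℝ E)) x := by
    intro F _ _ _ f hf x
    have hc : Continuous fun q : ℝ × E => (fderiv ℝ f q).comp (ContinuousLinearMap.inr ℝ ℝ E) :=
      (hf.continuous_fderiv (by simp)).clm_comp continuous_const
    have hcomp : IsCompact (Set.Icc (0 : ℝ) 1 ×ˢ Metric.closedBall x 1) :=
      isCompact_Icc.prod (isCompact_closedBall x 1)
    obtain ⟨C, hC⟩ := hcomp.exists_bound_of_continuousOn hc.continuousOn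
    refine intervalIntegral.hasFDerivAt_integral_of_dominated_of_fderiv_le
      (F := fun x s => f (s, x)) (bound := fun _ => C) (s := Metric.ball x 1)
      (F' := fun x s => (fderiv ℝ f (s, x)).comp (ContinuousLinearMap.inr ℝ ℝ E))
      (Metric.ball_mem_nhds x one_pos) ?_ ?_ ?_ ?_ ?_ ?_
    · refine Filter.Eventually.of_forall fun y => ?_
      exact (hf.continuous.comp (by fun_prop : Continuous fun s : ℝ => (s, y))).aestronglyMeasurable
    · exact (hf.continuous.comp (by fun_prop : Continuous fun s : ℝ => (s, x))).intervalIntegrable _ _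
    · exact (hc.comp (by fun_prop : Continuous fun s : ℝ => (s, x))).aestronglyMeasurable
    · refine Filter.Eventually.of_forall fun s hs y hy => hC (s, y) ⟨?_, ?_⟩
      · rw [Set.uIoc_of_le zero_le_one] at hs
        exact ⟨hs.1.le, hs.2⟩
      · exact Metric.ball_subset_closedBall hy
    · exact intervalIntegrable_const
    · refine Filter.Eventually.of_forall fun s hs y hy => ?_
      have h1 : HasFDerivAt f (fderiv ℝ f (s, y)) (s, y) :=
        (hf.differentiable (by simp) _).hasFDerivAt
      have h2 : HasFDerivAt (fun y : E => (s, y)) (ContinuousLinearMap.inr ℝ ℝ E) y :=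
        hasFDerivAt_prodMk_right s y
      exact h1.comp y h2
  induction k with
  | zero =>
    intro F _ _ _ f hf
    rw [Nat.cast_zero, contDiff_zero]
    exact continuous_iff_continuousAt.mpr fun x => (key hf x).continuousAt
  | succ k ih =>
    intro F _ _ _ f hf
    push_cast
    rw [contDiff_succ_iff_fderiv]
    refine ⟨fun x => (key hf x).differentiableAt, by simp, ?_⟩
    have : (fderiv ℝ fun x => ∫ s in (0 : ℝ)..1, f (s, x)) = fun x => ∫ s in (0 : ℝ)..1,
        (fderiv ℝ f (s, x)).comp (ContinuousLinearMap.inr ℝ ℝ E) := by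
      funext x
      exact (key hf x).fderiv
    rw [this]
    exact ih (f := fun q => (fderiv ℝ f q).comp (ContinuousLinearMap.inr ℝ ℝ E))
      ((hf.fderiv_right (m := ∞) (by simp)).clm_comp contDiff_const)

theorem exists_contDiff_eventuallyEq {E : Type*} [NormedAddCommGroup E] [NormedSpace ℝ E]
    [FiniteDimensional ℝ E] {T : E → ℝ} {a : E} (hT : SmoothNear T a) :
    ∃ S : E → ℝ, ContDiff ℝ ∞ S ∧ S =ᶠ[𝓝 a] T := by
  obtain ⟨r, hr, hball⟩ := Metric.eventually_nhds_iff_ball.mp hT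
  let χ : ContDiffBump a := ⟨r / 4, r / 2, by positivity, by linarith⟩
  refine ⟨fun x => χ x * T x, ?_, ?_⟩
  · rw [contDiff_iff_contDiffAt]
    intro x
    by_cases hx : x ∈ Metric.ball a r
    · exact χ.contDiff.contDiffAt.mul (hball x hx)
    · have h0 : (fun x => χ x * T x) =ᶠ[𝓝 x] fun _ => 0 := by
        have : {y | y ∉ Metric.closedBall a (r / 2)} ∈ 𝓝 x := by
          refine Metric.isClosed_closedBall.isOpen_compl.mem_nhds ?_
          intro h
          refine hx (Metric.closedBall_subset_ball ?_ h)
          linarith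
        filter_upwards [this] with y hy
        have : χ y = 0 := by
          refine χ.zero_of_le_dist ?_
          rw [Metric.mem_closedBall, not_le] at hy
          exact hy.le
        rw [this, zero_mul]
      exact contDiffAt_const.congr_of_eventuallyEq h0
  · filter_upwards [χ.eventuallyEq_one] with x hx
    rw [hx, Pi.one_apply, one_mul]

/-- The fundamental theorem of calculus along the segment from `a` to `x`; the functions `h i` are
averages over it of partial derivatives. -/
theorem hadamard {n : ℕ} {T : Eucl n → ℝ} {a : Eucl n} (hT : SmoothNear T a) :
    ∃ h : Fin n → Eucl n → ℝ, (∀ i, SmoothNear (h i) a) ∧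
      T =ᶠ[𝓝 a] fun x => T a + ∑ i, (x i - a i) * h i x := by
  -- Passing to a globally smooth function with the same germ keeps the whole segment in the domain.
  obtain ⟨S, hS, hST⟩ := exists_contDiff_eventuallyEq hT
  let H : Eucl n → Eucl n →L[ℝ] ℝ := fun x => ∫ s in (0 : ℝ)..1, fderiv ℝ S (a + s • (x - a))
  have hf : ContDiff ℝ ∞ fun q : ℝ × Eucl n => fderiv ℝ S (a + q.1 • (q.2 - a)) := by
    refine (hS.fderiv_right (m := ∞) (by simp)).comp ?_
    fun_prop
  have hH : ContDiff ℝ ∞ H := by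
    rw [contDiff_infty]
    exact fun k => contDiff_integral_param k hf
  refine ⟨fun i x => H x (EuclideanSpace.single i 1), fun i => SmoothNear.of_contDiff
    (hH.clm_apply contDiff_const), ?_⟩
  filter_upwards [hST] with x hx
  have hc : Continuous fun s : ℝ => fderiv ℝ S (a + s • (x - a)) :=
    hf.continuous.comp (by fun_prop : Continuous fun s : ℝ => (s, x))
  have h1 : S x - S a = H x (x - a) := by
    have h2 : ∫ s in (0 : ℝ)..1, fderiv ℝ S (a + s • (x - a)) (x - a)
        = S (a + (1 : ℝ) • (x - a)) - S (a + (0 : ℝ) • (x - a)) := by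
      refine intervalIntegral.integral_eq_sub_of_hasDerivAt
        (f := fun s : ℝ => S (a + s • (x - a))) (fun s _ => ?_)
        ((hc.clm_apply continuous_const).intervalIntegrable 0 1)
      have h3 : HasDerivAt (fun s : ℝ => a + s • (x - a)) (x - a) s := by
        simpa using ((hasDerivAt_id s).smul_const (x - a)).const_add a
      exact (hS.differentiable (by simp) _).hasFDerivAt.comp_hasDerivAt s h3
    rw [one_smul, zero_smul, add_zero, add_sub_cancel] at h2
    rw [← h2]
    exact (ContinuousLinearMap.intervalIntegral_apply (μ := volume)
      (hc.intervalIntegrable 0 1) (x - a)).symm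
  have h3 : x - a = ∑ i, (x i - a i) • EuclideanSpace.single i (1 : ℝ) := by
    ext j
    simp [Finset.sum_apply, Pi.single_apply]
  have h4 : H x (x - a) = ∑ i, (x i - a i) * H x (EuclideanSpace.single i 1) := by
    conv_lhs => rw [h3]
    simp
  rw [← hx, ← hST.self_of_nhds, ← h4, ← h1]
  ring

end Hadamard

/-! ### Evaluation of germs of functions along a morphism -/

section Germs

theorem smoothNear_coord {n : ℕ} (i : Fin n) (x : Eucl n) : SmoothNear (fun y : Eucl n => y i) x :=
  SmoothNear.of_contDiff (EuclideanSpace.proj (𝕜 := ℝ) i).contDiff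

theorem partialDeriv_coord {n : ℕ} (i j : Fin n) (x : Eucl n) :
    partialDeriv i (fun y : Eucl n => y j) x = if j = i then 1 else 0 := by
  have h : fderiv ℝ (fun y : Eucl n => y j) x = EuclideanSpace.proj (𝕜 := ℝ) j :=
    (EuclideanSpace.proj (𝕜 := ℝ) j).fderiv
  rw [partialDeriv, h]
  simp

theorem smoothNear_partialDeriv {n : ℕ} {T : Eucl n → ℝ} {x : Eucl n} (i : Fin n) (hT : SmoothNear T x) :
    SmoothNear (partialDeriv i T) x := hT.fderiv_apply _

variable {n : ℕ} {M : Type*} [TopologicalSpace M] [ChartedSpace (Eucl n) M] {L : ℕ}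

/-- The functional `D` only depends on the germ of its argument at `m`. -/
def IsLocalAt (D : SmoothFun n M →ₗ[ℝ] Grassmann L) (m : M) : Prop :=
  ∀ f h : SmoothFun n M, (f : M → ℝ) =ᶠ[𝓝 m] h → D f = D h

/-- The algebra morphism `A` is even and lies over the point `m`. -/
structure IsPointOver (A : SmoothFun n M →ₐ[ℝ] Grassmann L) (m : M) : Prop where
  even : ∀ f, A f ∈ evenPart L
  body : ∀ f, bodyMap L (A f) = f m

/-- The functional `D` is a derivation along `A`. -/
def IsDerivAlong (A : SmoothFun n M →ₐ[ℝ] Grassmann L) (D : SmoothFun n M →ₗ[ℝ] Grassmann L) :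
    Prop :=
  ∀ f h, D (f * h) = A f * D h + A h * D f

/-- The value of `D` on a function written in the chart at `c`. -/
def chartEval (D : SmoothFun n M →ₗ[ℝ] Grassmann L) (m c : M) (T : Eucl n → ℝ) : Grassmann L :=
  germEval D m fun m' => T (extChartAt (𝓡 n) c m')

/-- Functions with equal germs define literally the same predicate on representatives, so
`Exists.choose` picks the same one. No locality of `D` is needed. -/
theorem germEval_congr (D : SmoothFun n M →ₗ[ℝ] Grassmann L) {m : M} {h h' : M → ℝ}
    (hh : h =ᶠ[𝓝 m] h') : germEval D m h = germEval D m h' := by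
  have : (fun f : SmoothFun n M => (f : M → ℝ) =ᶠ[𝓝 m] h)
      = fun f : SmoothFun n M => (f : M → ℝ) =ᶠ[𝓝 m] h' := by
    funext f
    exact propext ⟨fun h1 => h1.trans hh, fun h1 => h1.trans hh.symm⟩
  exact congrArg (fun Q : SmoothFun n M → Prop => @dite _ (∃ f, Q f) (Classical.propDecidable _)
    (fun H => D H.choose) fun _ => 0) this

/-- Any two representatives share a germ, so for a local functional the arbitrary choice in
`germEval` does not matter. -/
theorem germEval_eq {D : SmoothFun n M →ₗ[ℝ] Grassmann L} {m : M} (hD : IsLocalAt D m)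
    {h : M → ℝ} {f : SmoothFun n M} (hf : (f : M → ℝ) =ᶠ[𝓝 m] h) : germEval D m h = D f := by
  have H : ∃ f : SmoothFun n M, (f : M → ℝ) =ᶠ[𝓝 m] h := ⟨f, hf⟩
  rw [germEval, dif_pos H]
  exact hD _ _ (H.choose_spec.trans hf.symm)

variable [IsManifold (𝓡 n) ∞ M]

theorem extChartAt_mem_nhds_preimage {c m : M} (hm : m ∈ (extChartAt (𝓡 n) c).source)
    {p : Eucl n → Prop} (hp : ∀ᶠ x in 𝓝 (extChartAt (𝓡 n) c m), p x) :
    ∀ᶠ m' in 𝓝 m, p (extChartAt (𝓡 n) c m') :=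
  (continuousAt_extChartAt' hm).eventually hp

theorem exists_lift [T2Space M] {c m : M} (hm : m ∈ (extChartAt (𝓡 n) c).source)
    {T : Eucl n → ℝ} (hT : SmoothNear T (extChartAt (𝓡 n) c m)) :
    ∃ f : SmoothFun n M, ∀ᶠ m' in 𝓝 m, f m' = T (extChartAt (𝓡 n) c m') := by
  have hU : {m' | m' ∈ (extChartAt (𝓡 n) c).source ∧
      ContDiffAt ℝ ∞ T (extChartAt (𝓡 n) c m')} ∈ 𝓝 m :=
    Filter.inter_mem (extChartAt_source_mem_nhds' hm) (extChartAt_mem_nhds_preimage hm hT)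
  obtain ⟨χ, -, hχ⟩ := (SmoothBumpFunction.nhds_basis_tsupport (I := 𝓡 n) m).mem_iff.mp hU
  refine ⟨⟨fun m' => χ m' * T (extChartAt (𝓡 n) c m'), ?_⟩, ?_⟩
  · refine contMDiff_of_tsupport fun m' hm' => ?_
    obtain ⟨h1, h2⟩ := hχ (tsupport_mul_subset_left hm')
    refine χ.contMDiffAt.mul ?_
    rw [extChartAt_source] at h1
    exact h2.contMDiffAt.comp m' (contMDiffAt_extChartAt' h1)
  · filter_upwards [χ.eventuallyEq_one] with m' h
    change χ m' * _ = _
    rw [h, Pi.one_apply, one_mul]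

theorem exists_bump [T2Space M] {m : M} {U : Set M} (hU : U ∈ 𝓝 m) :
    ∃ χ : SmoothFun n M, χ m = 1 ∧ ∀ m' ∉ U, χ m' = 0 := by
  obtain ⟨χ, -, hχ⟩ := (SmoothBumpFunction.nhds_basis_tsupport (I := 𝓡 n) m).mem_iff.mp hU
  exact ⟨⟨χ, χ.contMDiff⟩, χ.eq_one, fun m' hm' =>
    image_eq_zero_of_notMem_tsupport fun h => hm' (hχ h)⟩

/-- Choose a bump function χ with χ(m) = 1 that vanishes wherever f and h differ. Then χ (f - h) =
0, while the value of A on χ has body one and so cannot annihilate a nonzero element. -/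
theorem IsPointOver.isLocalAt [T2Space M] {A : SmoothFun n M →ₐ[ℝ] Grassmann L} {m : M}
    (hA : IsPointOver A m) : IsLocalAt A.toLinearMap m := by
  intro f h hfh
  obtain ⟨χ, h1, h2⟩ := exists_bump (n := n) hfh
  have h0 : χ * (f - h) = 0 := by
    ext m'
    change χ m' * (f m' - h m') = 0
    by_cases hm' : f m' = h m'
    · rw [hm', sub_self, mul_zero]
    · rw [h2 m' hm', zero_mul]
  have h3 : A χ * A (f - h) = 0 := by rw [← map_mul, h0, map_zero]
  have h4 := eq_zero_of_mul_eq_zero ((hA.body χ).trans h1) h3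
  rw [map_sub] at h4
  exact sub_eq_zero.mp h4

/-- The same bump function argument: in the product rule for χ (f - h) the term containing A(f - h)
drops out because A itself is local. -/
theorem IsDerivAlong.isLocalAt [T2Space M] {A : SmoothFun n M →ₐ[ℝ] Grassmann L} {m : M}
    (hA : IsPointOver A m) {D : SmoothFun n M →ₗ[ℝ] Grassmann L} (hD : IsDerivAlong A D) :
    IsLocalAt D m := by
  intro f h hfh
  obtain ⟨χ, h1, h2⟩ := exists_bump (n := n) hfh
  have h0 : χ * (f - h) = 0 := by
    ext m'
    change χ m' * (f m' - h m') = 0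
    by_cases hm' : f m' = h m'
    · rw [hm', sub_self, mul_zero]
    · rw [h2 m' hm', zero_mul]
  have h3 := hD χ (f - h)
  have h5 : A (f - h) = 0 := by
    rw [map_sub]
    exact sub_eq_zero.mpr (hA.isLocalAt f h hfh)
  rw [h0, map_zero, h5, zero_mul, add_zero] at h3
  have h4 := eq_zero_of_mul_eq_zero ((hA.body χ).trans h1) h3.symm
  rw [map_sub] at h4
  exact sub_eq_zero.mp h4

/-! ### Evaluation of functions written in a chart -/

section ChartEval

variable [T2Space M] {m c : M} (hm : m ∈ (extChartAt (𝓡 n) c).source)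
  {S T : Eucl n → ℝ}

theorem chartEval_congr (D : SmoothFun n M →ₗ[ℝ] Grassmann L)
    (hm : m ∈ (extChartAt (𝓡 n) c).source) (h : S =ᶠ[𝓝 (extChartAt (𝓡 n) c m)] T) :
    chartEval D m c S = chartEval D m c T :=
  germEval_congr D (extChartAt_mem_nhds_preimage hm h)

theorem chartEval_eq {D : SmoothFun n M →ₗ[ℝ] Grassmann L} (hD : IsLocalAt D m)
    {f : SmoothFun n M} (hf : ∀ᶠ m' in 𝓝 m, f m' = T (extChartAt (𝓡 n) c m')) :
    chartEval D m c T = D f :=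
  germEval_eq hD hf

include hm

theorem chartEval_add {D : SmoothFun n M →ₗ[ℝ] Grassmann L} (hD : IsLocalAt D m)
    (hS : SmoothNear S (extChartAt (𝓡 n) c m)) (hT : SmoothNear T (extChartAt (𝓡 n) c m)) :
    chartEval D m c (fun x => S x + T x) = chartEval D m c S + chartEval D m c T := by
  obtain ⟨f, hf⟩ := exists_lift hm hS
  obtain ⟨h, hh⟩ := exists_lift hm hT
  rw [chartEval_eq hD hf, chartEval_eq hD hh, ← map_add]
  refine chartEval_eq hD ?_
  filter_upwards [hf, hh] with m' h1 h2
  rw [← h1, ← h2]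
  rfl

theorem chartEval_smul {D : SmoothFun n M →ₗ[ℝ] Grassmann L} (hD : IsLocalAt D m) (r : ℝ)
    (hT : SmoothNear T (extChartAt (𝓡 n) c m)) :
    chartEval D m c (fun x => r * T x) = r • chartEval D m c T := by
  obtain ⟨h, hh⟩ := exists_lift hm hT
  rw [chartEval_eq hD hh, ← map_smul]
  refine chartEval_eq hD ?_
  filter_upwards [hh] with m' h2
  rw [← h2]
  rfl

theorem chartEval_sum {D : SmoothFun n M →ₗ[ℝ] Grassmann L} (hD : IsLocalAt D m)
    {ι : Type*} (s : Finset ι) {T : ι → Eucl n → ℝ}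
    (hT : ∀ i, SmoothNear (T i) (extChartAt (𝓡 n) c m)) :
    chartEval D m c (fun x => ∑ i ∈ s, T i x) = ∑ i ∈ s, chartEval D m c (T i) := by
  classical
  induction s using Finset.induction_on with
  | empty =>
    simp only [Finset.sum_empty]
    exact (chartEval_eq hD (f := 0) (Filter.Eventually.of_forall fun _ => rfl)).trans (map_zero D)
  | insert i s hi ih =>
    simp only [Finset.sum_insert hi]
    rw [chartEval_add hm hD (hT i) (SmoothNear.sum fun j _ => hT j), ih]

theorem chartEval_mul {A : SmoothFun n M →ₐ[ℝ] Grassmann L} (hA : IsPointOver A m)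
    (hS : SmoothNear S (extChartAt (𝓡 n) c m)) (hT : SmoothNear T (extChartAt (𝓡 n) c m)) :
    chartEval A.toLinearMap m c (fun x => S x * T x)
      = chartEval A.toLinearMap m c S * chartEval A.toLinearMap m c T := by
  obtain ⟨f, hf⟩ := exists_lift hm hS
  obtain ⟨h, hh⟩ := exists_lift hm hT
  rw [chartEval_eq hA.isLocalAt hf, chartEval_eq hA.isLocalAt hh]
  refine (chartEval_eq hA.isLocalAt (f := f * h) ?_).trans (map_mul A f h)
  filter_upwards [hf, hh] with m' h1 h2
  rw [← h1, ← h2]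
  rfl

omit hm in
theorem chartEval_const {A : SmoothFun n M →ₐ[ℝ] Grassmann L} (hA : IsPointOver A m) (r : ℝ) :
    chartEval A.toLinearMap m c (fun _ => r) = algebraMap ℝ _ r :=
  (chartEval_eq hA.isLocalAt (f := algebraMap ℝ _ r)
    (Filter.Eventually.of_forall fun _ => rfl)).trans (A.commutes r)

theorem chartEval_even {A : SmoothFun n M →ₐ[ℝ] Grassmann L} (hA : IsPointOver A m)
    (hT : SmoothNear T (extChartAt (𝓡 n) c m)) : chartEval A.toLinearMap m c T ∈ evenPart L := by
  obtain ⟨h, hh⟩ := exists_lift hm hT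
  rw [chartEval_eq hA.isLocalAt hh]
  exact hA.even h

theorem bodyMap_chartEval {A : SmoothFun n M →ₐ[ℝ] Grassmann L} (hA : IsPointOver A m)
    (hT : SmoothNear T (extChartAt (𝓡 n) c m)) :
    bodyMap L (chartEval A.toLinearMap m c T) = T (extChartAt (𝓡 n) c m) := by
  obtain ⟨h, hh⟩ := exists_lift hm hT
  rw [chartEval_eq hA.isLocalAt hh]
  exact (hA.body h).trans hh.self_of_nhds

theorem chartEval_deriv_mul {A : SmoothFun n M →ₐ[ℝ] Grassmann L} (hA : IsPointOver A m)
    {D : SmoothFun n M →ₗ[ℝ] Grassmann L} (hD : IsDerivAlong A D)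
    (hS : SmoothNear S (extChartAt (𝓡 n) c m)) (hT : SmoothNear T (extChartAt (𝓡 n) c m)) :
    chartEval D m c (fun x => S x * T x)
      = chartEval A.toLinearMap m c S * chartEval D m c T
        + chartEval A.toLinearMap m c T * chartEval D m c S := by
  obtain ⟨f, hf⟩ := exists_lift hm hS
  obtain ⟨h, hh⟩ := exists_lift hm hT
  have hl := hD.isLocalAt hA
  rw [chartEval_eq hA.isLocalAt hf, chartEval_eq hA.isLocalAt hh, chartEval_eq hl hf,
    chartEval_eq hl hh]
  refine (chartEval_eq hl (f := f * h) ?_).trans (hD f h)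
  filter_upwards [hf, hh] with m' h1 h2
  rw [← h1, ← h2]
  rfl

omit hm in
theorem chartEval_deriv_const {A : SmoothFun n M →ₐ[ℝ] Grassmann L} (hA : IsPointOver A m)
    {D : SmoothFun n M →ₗ[ℝ] Grassmann L} (hD : IsDerivAlong A D) (r : ℝ) :
    chartEval D m c (fun _ => r) = 0 := by
  have h1 : D 1 = 0 := by
    have := hD 1 1
    rw [mul_one, map_one A, one_mul] at this
    exact left_eq_add.mp this
  refine (chartEval_eq (hD.isLocalAt hA) (f := r • (1 : SmoothFun n M))
    (Filter.Eventually.of_forall fun m' => ?_)).trans ?_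
  · change r * (1 : ℝ) = r
    exact mul_one r
  rw [map_smul, h1, smul_zero]

/-- The chain rule: a derivation along `A` is determined by its values on the coordinates. -/
theorem chartEval_deriv {A : SmoothFun n M →ₐ[ℝ] Grassmann L} (hA : IsPointOver A m)
    {D : SmoothFun n M →ₗ[ℝ] Grassmann L} (hD : IsDerivAlong A D)
    (hT : SmoothNear T (extChartAt (𝓡 n) c m)) :
    chartEval D m c T = ∑ i, chartEval A.toLinearMap m c (partialDeriv i T)
      * chartEval D m c (fun x => x i) := by
  set a := extChartAt (𝓡 n) c m
  -- The defect of the chain rule. It is again a derivation along A, depends only on the germ, and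
  -- kills constants and coordinates.
  set E : (Eucl n → ℝ) → Grassmann L := fun T => chartEval D m c T
    - ∑ i, chartEval A.toLinearMap m c (partialDeriv i T) * chartEval D m c (fun x => x i) with hE
  have hl := hD.isLocalAt hA
  have hpd : ∀ (T : Eucl n → ℝ) i, SmoothNear T a → SmoothNear (partialDeriv i T) a :=
    fun T i h => smoothNear_partialDeriv i h
  have hE_mul : ∀ S T : Eucl n → ℝ, SmoothNear S a → SmoothNear T a →
      E (fun x => S x * T x) = chartEval A.toLinearMap m c S * E T
        + chartEval A.toLinearMap m c T * E S := by
    intro S T hS hT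
    have h1 : ∀ i, chartEval A.toLinearMap m c (partialDeriv i fun x => S x * T x)
        = chartEval A.toLinearMap m c S * chartEval A.toLinearMap m c (partialDeriv i T)
          + chartEval A.toLinearMap m c T * chartEval A.toLinearMap m c (partialDeriv i S) := by
      intro i
      rw [← chartEval_mul hm hA hS (hpd T i hT), ← chartEval_mul hm hA hT (hpd S i hS),
        ← chartEval_add hm hA.isLocalAt (hS.mul (hpd T i hT)) (hT.mul (hpd S i hS))]
      refine chartEval_congr _ hm ?_
      filter_upwards [hS.eventually, hT.eventually] with x h1 h2
      simp only [partialDeriv]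
      rw [fderiv_fun_mul h1.differentiableAt h2.differentiableAt]
      simp
    simp only [hE, h1, chartEval_deriv_mul hm hA hD hS hT, add_mul, Finset.sum_add_distrib,
      mul_assoc, ← Finset.mul_sum]
    rw [mul_sub, mul_sub]
    abel
  have hE_add : ∀ S T : Eucl n → ℝ, SmoothNear S a → SmoothNear T a →
      E (fun x => S x + T x) = E S + E T := by
    intro S T hS hT
    have h1 : ∀ i, chartEval A.toLinearMap m c (partialDeriv i fun x => S x + T x)
        = chartEval A.toLinearMap m c (partialDeriv i S)
          + chartEval A.toLinearMap m c (partialDeriv i T) := by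
      intro i
      rw [← chartEval_add hm hA.isLocalAt (hpd S i hS) (hpd T i hT)]
      refine chartEval_congr _ hm ?_
      filter_upwards [hS.eventually, hT.eventually] with x h1 h2
      simp only [partialDeriv]
      rw [fderiv_fun_add h1.differentiableAt h2.differentiableAt]
      rfl
    simp only [hE, h1, chartEval_add hm hl hS hT, add_mul, Finset.sum_add_distrib]
    abel
  have hE_const : ∀ r : ℝ, E (fun _ => r) = 0 := by
    intro r
    have h1 : ∀ i, partialDeriv i (fun _ : Eucl n => r) = fun _ => 0 := by
      intro i
      funext x
      simp [partialDeriv]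
    simp [hE, h1, chartEval_deriv_const hA hD, chartEval_const hA]
  have hE_coord : ∀ i, E (fun x => x i) = 0 := by
    intro i
    have h1 : ∀ j, partialDeriv j (fun x : Eucl n => x i) = fun _ => if i = j then 1 else 0 := by
      intro j
      funext x
      exact partialDeriv_coord j i x
    simp only [hE, h1, chartEval_const hA]
    simp
  have hE_shift : ∀ i, E (fun x => x i - a i) = 0 := by
    intro i
    have := hE_add (fun x => x i) (fun _ => - a i) (smoothNear_coord i a) (SmoothNear.const _)
    rw [hE_coord, hE_const, add_zero] at this
    simpa only [sub_eq_add_neg] using this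
  have hsm : ∀ i, SmoothNear (fun x : Eucl n => x i - a i) a := fun i =>
    (smoothNear_coord i a).sub (SmoothNear.const _)
  have hE_sum : ∀ (s : Finset (Fin n)) (T : Fin n → Eucl n → ℝ), (∀ i, SmoothNear (T i) a) →
      E (fun x => ∑ i ∈ s, T i x) = ∑ i ∈ s, E (T i) := by
    intro s T hT
    classical
    induction s using Finset.induction_on with
    | empty => simpa using hE_const 0
    | insert i s hi ih =>
      simp only [Finset.sum_insert hi]
      rw [hE_add _ _ (hT i) (SmoothNear.sum fun j _ => hT j), ih]
  have hE_congr : ∀ S T : Eucl n → ℝ, S =ᶠ[𝓝 a] T → E S = E T := by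
    intro S T h
    have h1 : ∀ i, partialDeriv i S =ᶠ[𝓝 a] partialDeriv i T := fun i => by
      filter_upwards [h.eventuallyEq_nhds] with x hx
      simp only [partialDeriv]
      rw [hx.fderiv_eq]
    simp only [hE, chartEval_congr D hm h, fun i => chartEval_congr A.toLinearMap hm (h1 i)]
  -- By Hadamard the defect of T is the sum of A(xⁱ - aⁱ) times the defects of the quotients hᵢ. The
  -- first factor has body zero, so each application raises the degree of the defect by one.
  have key : ∀ k : ℕ, ∀ T : Eucl n → ℝ, SmoothNear T a → E T ∈ degreeGE L k := by
    intro k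
    induction k with
    | zero => exact fun T _ => mem_degreeGE_zero _
    | succ k ih =>
      intro T hT
      obtain ⟨h, hh, hTh⟩ := hadamard hT
      rw [hE_congr _ _ hTh, hE_add _ _ (SmoothNear.const _)
        (SmoothNear.sum fun i _ => (hsm i).mul (hh i)), hE_const, zero_add,
        hE_sum _ _ fun i => (hsm i).mul (hh i)]
      refine Submodule.sum_mem _ fun i _ => ?_
      rw [hE_mul _ _ (hsm i) (hh i), hE_shift, mul_zero, add_zero, add_comm k 1]
      refine degreeGE_mul (mem_degreeGE_one ?_) (ih _ (hh i))
      rw [bodyMap_chartEval hm hA (hsm i)]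
      exact sub_self _
  exact sub_eq_zero.mp (eq_zero_of_forall_mem_degreeGE fun k => key k T hT)

end ChartEval

end Germs

/-! ### The metric in a chart -/

section Gram

variable {n : ℕ} {M : Type*} [TopologicalSpace M] [ChartedSpace (Eucl n) M]
  [IsManifold (𝓡 n) ∞ M] (g : Metric n M) {c c' : M} {x : Eucl n}

theorem coordVector_eq (i : Fin n) :
    coordVector c i x = mfderiv 𝓘(ℝ, Eucl n) (𝓡 n) (extChartAt (𝓡 n) c).symm x
      (EuclideanSpace.single i (1 : ℝ) : Eucl n) := by
  unfold coordVector
  rw [ModelWithCorners.range_eq_univ, mfderivWithin_univ]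

theorem mdifferentiableAt_symm (hx : x ∈ (extChartAt (𝓡 n) c).target) :
    MDifferentiableAt 𝓘(ℝ, Eucl n) (𝓡 n) (extChartAt (𝓡 n) c).symm x :=
  ((contMDiffOn_extChartAt_symm (n := ∞) c).contMDiffAt
    ((isOpen_extChartAt_target c).mem_nhds hx)).mdifferentiableAt (by simp)

theorem mdifferentiableAt_chart {m : M} (hm : m ∈ (extChartAt (𝓡 n) c).source) :
    MDifferentiableAt (𝓡 n) 𝓘(ℝ, Eucl n) (extChartAt (𝓡 n) c) m := by
  rw [extChartAt_source] at hm
  exact (contMDiffAt_extChartAt' (n := ∞) hm).mdifferentiableAt (by simp)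

theorem gram_symm (i j : Fin n) : gram g c x i j = gram g c x j i := g.symm _ _ _

/-- A coordinate vector field is the tangent map of the inverse chart applied to a constant field of
the model space. -/
theorem contMDiffOn_coordVector (c : M) (i : Fin n) :
    ContMDiffOn 𝓘(ℝ, Eucl n) (𝓡 n).tangent ∞
      (fun x => (⟨(extChartAt (𝓡 n) c).symm x, coordVector c i x⟩ : TangentBundle (𝓡 n) M))
      (extChartAt (𝓡 n) c).target := by
  have h1 := (contMDiffOn_extChartAt_symm (I := 𝓡 n) (n := ∞) c).contMDiffOn_tangentMapWithin
    (m := ∞) (by simp) (isOpen_extChartAt_target c).uniqueMDiffOn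
  have h2 : ContMDiff 𝓘(ℝ, Eucl n) 𝓘(ℝ, Eucl n).tangent ∞
      (fun x : Eucl n => (⟨x, EuclideanSpace.single i (1 : ℝ)⟩ :
        TangentBundle 𝓘(ℝ, Eucl n) (Eucl n))) :=
    contMDiff_vectorSpace_iff_contDiff.mpr contDiff_const
  have h3 := h1.comp (h2.contMDiffOn (s := (extChartAt (𝓡 n) c).target)) fun x hx => hx
  refine h3.congr fun x hx => ?_
  change _ = tangentMapWithin _ _ _ _ _
  unfold tangentMapWithin
  rw [coordVector_eq, mfderivWithin_of_isOpen (isOpen_extChartAt_target c) hx]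

theorem contDiffOn_gram (c : M) (i j : Fin n) :
    ContDiffOn ℝ ∞ (fun x => gram g c x i j) (extChartAt (𝓡 n) c).target := by
  rw [← contMDiffOn_iff_contDiffOn]
  intro x hx
  have h1 := contMDiffOn_coordVector c i x hx
  have h2 := contMDiffOn_coordVector c j x hx
  have hb := contMDiffOn_extChartAt_symm (I := 𝓡 n) (n := ∞) c x hx
  have : ContMDiffWithinAt 𝓘(ℝ, Eucl n) ((𝓡 n).prod 𝓘(ℝ)) ∞
      (fun x ↦ Bundle.TotalSpace.mk' ℝ (E := Bundle.Trivial M ℝ) ((extChartAt (𝓡 n) c).symm x) (gram g c x i j)) (extChartAt (𝓡 n) c).target x := by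
    apply ContMDiffWithinAt.clm_bundle_apply₂ (F₁ := Eucl n) (F₂ := Eucl n)
    · exact ContMDiffAt.comp_contMDiffWithinAt x g.contMDiff.contMDiffAt hb
    · exact h1
    · exact h2
  simp only [Bundle.contMDiffWithinAt_totalSpace] at this
  exact this.2

/-- The metric at a point, as a bilinear form on the model space. -/
def metricAt (m : M) : Eucl n →L[ℝ] Eucl n →L[ℝ] ℝ := g.inner m

/-- The derivative of the inverse of a chart. -/
def dsymm (c : M) (x : Eucl n) : Eucl n →L[ℝ] Eucl n :=
  mfderiv 𝓘(ℝ, Eucl n) (𝓡 n) (extChartAt (𝓡 n) c).symm x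

theorem gram_eq (c : M) (x : Eucl n) (i j : Fin n) :
    gram g c x i j = metricAt g ((extChartAt (𝓡 n) c).symm x)
      (dsymm c x (EuclideanSpace.single i 1)) (dsymm c x (EuclideanSpace.single j 1)) := by
  change g.inner _ (coordVector c i x) (coordVector c j x) = _
  rw [coordVector_eq, coordVector_eq]
  rfl

/-- The change of coordinates from the chart at `c` to the chart at `c'`. -/
def transition (c c' : M) (x : Eucl n) : Eucl n :=
  extChartAt (𝓡 n) c' ((extChartAt (𝓡 n) c).symm x)

/-- The Jacobian matrix of the change of coordinates. -/
def jac (c c' : M) (x : Eucl n) : Matrix (Fin n) (Fin n) ℝ :=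
  Matrix.of fun a i => partialDeriv i (fun y => transition c c' y a) x

/-- The point with coordinates `x` in the chart at `c` also lies in the chart at `c'`. -/
def InOverlap (c c' : M) (x : Eucl n) : Prop :=
  x ∈ (extChartAt (𝓡 n) c).target ∧ (extChartAt (𝓡 n) c).symm x ∈ (extChartAt (𝓡 n) c').source

theorem InOverlap.eventually (h : InOverlap c c' x) : ∀ᶠ y in 𝓝 x, InOverlap c c' y :=
  Filter.Eventually.and ((isOpen_extChartAt_target c).mem_nhds h.1)
    ((continuousAt_extChartAt_symm'' h.1).eventually
      ((isOpen_extChartAt_source c').mem_nhds h.2))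

theorem smoothNear_transition (h : InOverlap c c' x) : SmoothNear (transition c c') x := by
  filter_upwards [h.eventually] with y hy
  have h2 := hy.2
  rw [extChartAt_source] at h2
  have := (contMDiffAt_extChartAt' (n := ∞) (I := 𝓡 n) h2).comp y
    ((contMDiffOn_extChartAt_symm (I := 𝓡 n) (n := ∞) c).contMDiffAt
      ((isOpen_extChartAt_target c).mem_nhds hy.1))
  exact contMDiffAt_iff_contDiffAt.mp this

theorem smoothNear_transition_apply (h : InOverlap c c' x) (a : Fin n) :
    SmoothNear (fun y => transition c c' y a) x :=
  SmoothNear.comp (smoothNear_coord a _) (smoothNear_transition h)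

theorem smoothNear_jac (h : InOverlap c c' x) (a i : Fin n) :
    SmoothNear (fun y => jac c c' y a i) x :=
  (smoothNear_transition_apply h a).fderiv_apply _

theorem symm_transition (h : InOverlap c c' x) :
    (extChartAt (𝓡 n) c').symm (transition c c' x) = (extChartAt (𝓡 n) c).symm x :=
  (extChartAt (𝓡 n) c').left_inv h.2

theorem transition_mem (h : InOverlap c c' x) :
    transition c c' x ∈ (extChartAt (𝓡 n) c').target :=
  (extChartAt (𝓡 n) c').map_source h.2

theorem fderiv_transition_single (h : InOverlap c c' x) (i : Fin n) :
    fderiv ℝ (transition c c') x (EuclideanSpace.single i 1)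
      = ∑ a, jac c c' x a i • EuclideanSpace.single a (1 : ℝ) := by
  ext b
  have h1 : jac c c' x b i
      = fderiv ℝ (transition c c') x (EuclideanSpace.single i 1) b := by
    have := ((EuclideanSpace.proj (𝕜 := ℝ) b).hasFDerivAt.comp x
      (smoothNear_transition h).differentiableAt.hasFDerivAt).fderiv
    exact congrArg (fun T => T (EuclideanSpace.single i 1)) this
  simp [← h1, Pi.single_apply]

theorem dsymm_transition (h : InOverlap c c' x) (v : Eucl n) :
    dsymm c x v = dsymm c' (transition c c' x) (fderiv ℝ (transition c c') x v) := by
  have h1 : (extChartAt (𝓡 n) c).symm =ᶠ[𝓝 x]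
      (extChartAt (𝓡 n) c').symm ∘ transition c c' :=
    h.eventually.mono fun y hy => (symm_transition hy).symm
  have h2 := mfderiv_comp x (mdifferentiableAt_symm (transition_mem h))
    (smoothNear_transition h).differentiableAt.mdifferentiableAt
  have h3 : dsymm c x = (dsymm c' (transition c c' x)).comp (fderiv ℝ (transition c c') x) := by
    rw [← mfderiv_eq_fderiv]
    exact (Filter.EventuallyEq.mfderiv_eq h1).trans h2
  rw [h3]
  rfl

/-- Both Gram matrices express one bilinear form at one point; only the bases differ, and they are
related by the Jacobian through the chain rule for the inverse charts. -/
theorem gram_transition (h : InOverlap c c' x) (i j : Fin n) :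
    gram g c x i j = ∑ a, ∑ b, jac c c' x a i * gram g c' (transition c c' x) a b
      * jac c c' x b j := by
  rw [gram_eq, dsymm_transition h, dsymm_transition h, fderiv_transition_single h,
    fderiv_transition_single h]
  simp only [gram_eq, symm_transition h, map_sum, map_smul, FunLike.coe_sum,
    FunLike.coe_smul, Pi.smul_apply, Finset.sum_apply, smul_eq_mul, Finset.mul_sum]
  rw [Finset.sum_comm]
  refine Finset.sum_congr rfl fun a _ => Finset.sum_congr rfl fun b _ => by ring

theorem dsymm_injective (hx : x ∈ (extChartAt (𝓡 n) c).target) {v : Eucl n}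
    (hv : dsymm c x v = 0) : v = 0 := by
  have h0 : InOverlap c c x := ⟨hx, (extChartAt (𝓡 n) c).map_target hx⟩
  have h1 : (extChartAt (𝓡 n) c ∘ (extChartAt (𝓡 n) c).symm) =ᶠ[𝓝 x] id :=
    h0.eventually.mono fun y hy => (extChartAt (𝓡 n) c).right_inv hy.1
  have h2 := mfderiv_comp x (mdifferentiableAt_chart ((extChartAt (𝓡 n) c).map_target hx))
    (mdifferentiableAt_symm hx)
  have h3 := (Filter.EventuallyEq.mfderiv_eq h1).symm.trans h2
  rw [mfderiv_id] at h3
  have h4 := congrArg (fun T : Eucl n →L[ℝ] Eucl n => T v) h3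
  refine h4.trans ?_
  change mfderiv (𝓡 n) 𝓘(ℝ, Eucl n) (extChartAt (𝓡 n) c) _ (dsymm c x v) = 0
  rw [hv]
  exact map_zero _

/-- A kernel vector of the Gram matrix would be the coordinate vector of a tangent vector of length
zero, and this tangent vector is nonzero since the derivative of the inverse chart is injective. -/
theorem det_gram_ne_zero (hx : x ∈ (extChartAt (𝓡 n) c).target) : (gram g c x).det ≠ 0 := by
  intro hdet
  obtain ⟨w, hw, hGw⟩ := Matrix.exists_mulVec_eq_zero_iff.mpr hdet
  set W : Eucl n := ∑ i, w i • EuclideanSpace.single i (1 : ℝ) with hW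
  have hWi : ∀ i, W i = w i := fun i => by simp [hW, Pi.single_apply]
  have hne : dsymm c x W ≠ 0 := fun h0 => hw (by
    funext i
    rw [← hWi, dsymm_injective hx h0]
    rfl)
  have hpos : 0 < metricAt g ((extChartAt (𝓡 n) c).symm x) (dsymm c x W) (dsymm c x W) :=
    g.pos _ _ hne
  have h0 : metricAt g ((extChartAt (𝓡 n) c).symm x) (dsymm c x W) (dsymm c x W)
      = ∑ i, w i * ((gram g c x).mulVec w) i := by
    simp only [hW, Matrix.mulVec, dotProduct, gram_eq, map_sum, map_smul, FunLike.coe_sum,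
      FunLike.coe_smul, Pi.smul_apply, Finset.sum_apply, smul_eq_mul, Finset.mul_sum]
    rw [Finset.sum_comm]
    refine Finset.sum_congr rfl fun a _ => Finset.sum_congr rfl fun b _ => by ring
  rw [h0, hGw] at hpos
  simp at hpos

end Gram

/-! ### Calculus of matrix-valued functions -/

section MatrixCalculus

variable {n : ℕ} {A B : Eucl n → Matrix (Fin n) (Fin n) ℝ} {x : Eucl n}

/-- The entrywise partial derivative of a matrix-valued function. -/
def mpd (i : Fin n) (A : Eucl n → Matrix (Fin n) (Fin n) ℝ) (x : Eucl n) :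
    Matrix (Fin n) (Fin n) ℝ :=
  Matrix.of fun a b => partialDeriv i (fun y => A y a b) x

/-- All entries are smooth near `x`. -/
def MSmooth (A : Eucl n → Matrix (Fin n) (Fin n) ℝ) (x : Eucl n) : Prop :=
  ∀ a b, SmoothNear (fun y => A y a b) x

theorem MSmooth.mul (hA : MSmooth A x) (hB : MSmooth B x) : MSmooth (fun y => A y * B y) x :=
  fun a b => by
    simp only [Matrix.mul_apply]
    exact SmoothNear.sum fun k _ => (hA a k).mul (hB k b)

theorem MSmooth.transpose (hA : MSmooth A x) : MSmooth (fun y => (A y).transpose) x :=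
  fun a b => hA b a

theorem MSmooth.mpd (hA : MSmooth A x) (i : Fin n) : MSmooth (mpd i A) x :=
  fun a b => (hA a b).fderiv_apply _

theorem MSmooth.smul_sum {f : Fin n → Eucl n → ℝ} {A : Fin n → Eucl n → Matrix (Fin n) (Fin n) ℝ}
    (hf : ∀ b, SmoothNear (f b) x) (hA : ∀ b, MSmooth (A b) x) :
    MSmooth (fun y => ∑ b, f b y • A b y) x := fun k l => by
  simp only [Matrix.sum_apply, Matrix.smul_apply, smul_eq_mul]
  exact SmoothNear.sum fun b _ => (hf b).mul (hA b k l)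

theorem mpd_congr (i : Fin n) (h : A =ᶠ[𝓝 x] B) : mpd i A x = mpd i B x := by
  ext a b
  have : (fun y => A y a b) =ᶠ[𝓝 x] fun y => B y a b := h.mono fun y hy => by simp only [hy]
  simp only [mpd, Matrix.of_apply, partialDeriv, this.fderiv_eq]

theorem mpd_add (i : Fin n) (hA : MSmooth A x) (hB : MSmooth B x) :
    mpd i (fun y => A y + B y) x = mpd i A x + mpd i B x := by
  ext a b
  simp only [mpd, Matrix.of_apply, partialDeriv, Matrix.add_apply]
  rw [fderiv_fun_add (hA a b).differentiableAt (hB a b).differentiableAt]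
  rfl

theorem partialDeriv_mul (i : Fin n) {f h : Eucl n → ℝ} (hf : SmoothNear f x)
    (hh : SmoothNear h x) : partialDeriv i (fun y => f y * h y) x
      = partialDeriv i f x * h x + f x * partialDeriv i h x := by
  simp only [partialDeriv]
  rw [fderiv_fun_mul hf.differentiableAt hh.differentiableAt]
  simp
  ring

theorem partialDeriv_sum {ι : Type*} (s : Finset ι) (i : Fin n) {f : ι → Eucl n → ℝ}
    (hf : ∀ k ∈ s, SmoothNear (f k) x) : partialDeriv i (fun y => ∑ k ∈ s, f k y) x
      = ∑ k ∈ s, partialDeriv i (f k) x := by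
  simp only [partialDeriv]
  rw [fderiv_fun_sum fun k hk => (hf k hk).differentiableAt]
  simp

theorem mpd_mul (i : Fin n) (hA : MSmooth A x) (hB : MSmooth B x) :
    mpd i (fun y => A y * B y) x = mpd i A x * B x + A x * mpd i B x := by
  ext a b
  simp only [mpd, Matrix.of_apply, Matrix.add_apply, Matrix.mul_apply]
  rw [partialDeriv_sum _ _ fun k _ => (hA a k).mul (hB k b), ← Finset.sum_add_distrib]
  exact Finset.sum_congr rfl fun k _ => partialDeriv_mul i (hA a k) (hB k b)

theorem mpd_transpose (i : Fin n) :
    mpd i (fun y => (A y).transpose) x = (mpd i A x).transpose := rfl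

theorem mpd_smul_sum (i : Fin n) {f : Fin n → Eucl n → ℝ}
    {A : Fin n → Eucl n → Matrix (Fin n) (Fin n) ℝ}
    (hf : ∀ b, SmoothNear (f b) x) (hA : ∀ b, MSmooth (A b) x) :
    mpd i (fun y => ∑ b, f b y • A b y) x
      = ∑ b, (partialDeriv i (f b) x • A b x + f b x • mpd i (A b) x) := by
  ext k l
  simp only [mpd, Matrix.of_apply, Matrix.add_apply, Matrix.sum_apply, Matrix.smul_apply,
    smul_eq_mul]
  rw [partialDeriv_sum _ _ fun b _ => (hf b).mul (hA b k l)]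
  exact Finset.sum_congr rfl fun b _ => partialDeriv_mul i (hf b) (hA b k l)

theorem mpd_comm (i j : Fin n) (hA : MSmooth A x) :
    mpd i (mpd j A) x = mpd j (mpd i A) x := by
  ext a b
  exact (hA a b).fderiv_comm _ _

theorem smoothNear_prod {ι : Type*} (s : Finset ι) {f : ι → Eucl n → ℝ}
    (hf : ∀ k, SmoothNear (f k) x) : SmoothNear (fun y => ∏ k ∈ s, f k y) x := by
  classical
  induction s using Finset.induction_on with
  | empty => simpa using SmoothNear.const (1 : ℝ)
  | insert i s hi ih =>
    simp only [Finset.prod_insert hi]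
    exact (hf i).mul ih

theorem MSmooth.det (hA : MSmooth A x) : SmoothNear (fun y => (A y).det) x := by
  simp only [Matrix.det_apply]
  refine SmoothNear.sum fun σ _ => ?_
  have := (smoothNear_prod Finset.univ fun k => hA (σ k) k).const_smul
    (((Equiv.Perm.sign σ : ℤˣ) : ℤ) : ℝ)
  refine this.congr (Filter.Eventually.of_forall fun y => ?_)
  simp [Units.smul_def]

/-- Cramer's rule: the inverse is the adjugate over the determinant, both polynomial in the entries.
-/
theorem MSmooth.inv (hA : MSmooth A x) (hdet : (A x).det ≠ 0) : MSmooth (fun y => (A y)⁻¹) x := by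
  intro a b
  simp only [Matrix.inv_def, Matrix.smul_apply, Matrix.adjugate_apply, smul_eq_mul,
    Ring.inverse_eq_inv']
  refine SmoothNear.mul ?_ ?_
  · have h0 : ∀ᶠ y in 𝓝 x, (A y).det ≠ 0 :=
      hA.det.contDiffAt.continuousAt.eventually (isOpen_ne.mem_nhds hdet)
    filter_upwards [hA.det, h0] with y h1 h2 using h1.inv h2
  · refine MSmooth.det (A := fun y => (A y).updateRow b (Pi.single a 1)) fun k l => ?_
    by_cases hk : k = b
    · subst hk
      simpa using SmoothNear.const _
    · simpa [Matrix.updateRow_ne hk] using hA k l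

end MatrixCalculus

/-! ### The Levi-Civita connection and its curvature in a chart -/

section Connection

variable {n : ℕ} {M : Type*} [TopologicalSpace M] [ChartedSpace (Eucl n) M]
  [IsManifold (𝓡 n) ∞ M] (g : Metric n M) {c c' : M} {x : Eucl n}

/-- The matrix of the Christoffel symbols for the direction `∂_i`. -/
def cmat (c : M) (i : Fin n) (x : Eucl n) : Matrix (Fin n) (Fin n) ℝ :=
  Matrix.of fun l j => christoffel g c l i j x

/-- The matrix of the curvature endomorphism `R(∂_i, ∂_j)`. -/
def rmat (c : M) (i j : Fin n) (x : Eucl n) : Matrix (Fin n) (Fin n) ℝ :=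
  Matrix.of fun l k => riemann g c l i j k x

theorem rmat_eq (c : M) (i j : Fin n) (x : Eucl n) :
    rmat g c i j x = mpd i (cmat g c j) x - mpd j (cmat g c i) x
      + (cmat g c i x * cmat g c j x - cmat g c j x * cmat g c i x) := by
  ext l k
  simp only [rmat, riemann, mpd, cmat, Matrix.of_apply, Matrix.add_apply, Matrix.sub_apply,
    Matrix.mul_apply, Finset.sum_sub_distrib]

theorem rmat_antisymm (c : M) (i j : Fin n) (x : Eucl n) :
    rmat g c i j x = - rmat g c j i x := by
  rw [rmat_eq, rmat_eq]
  abel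

theorem gram_transpose (c : M) (x : Eucl n) : (gram g c x).transpose = gram g c x := by
  ext i j
  exact gram_symm g j i

theorem christoffel_symm (c : M) (k i j : Fin n) :
    christoffel g c k i j = christoffel g c k j i := by
  funext x
  have h : (fun y => gram g c y i j) = fun y => gram g c y j i := by
    funext y
    exact gram_symm g i j
  unfold christoffel
  congr 1
  refine Finset.sum_congr rfl fun l _ => ?_
  rw [h]
  ring

theorem mSmooth_gram (hx : x ∈ (extChartAt (𝓡 n) c).target) : MSmooth (gram g c) x :=
  fun i j => SmoothNear.of_contDiffOn (contDiffOn_gram g c i j) (isOpen_extChartAt_target c) hx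

theorem smoothNear_christoffel (hx : x ∈ (extChartAt (𝓡 n) c).target) (k i j : Fin n) :
    SmoothNear (christoffel g c k i j) x := by
  have hG := mSmooth_gram g hx
  have h := (SmoothNear.sum fun l (_ : l ∈ Finset.univ) =>
    (hG.inv (det_gram_ne_zero g hx) k l).mul
      (((hG.mpd i j l).add (hG.mpd j i l)).sub (hG.mpd l i j))).const_smul (1 / 2 : ℝ)
  exact h

theorem mSmooth_cmat (hx : x ∈ (extChartAt (𝓡 n) c).target) (i : Fin n) :
    MSmooth (cmat g c i) x := fun l j => smoothNear_christoffel g hx l i j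

theorem smoothNear_riemann (hx : x ∈ (extChartAt (𝓡 n) c).target) (l i j k : Fin n) :
    SmoothNear (riemann g c l i j k) x := by
  have hC := smoothNear_christoffel g hx
  exact (((hC l j k).fderiv_apply _).sub ((hC l i k).fderiv_apply _)).add
    (SmoothNear.sum fun m _ => ((hC l i m).mul (hC m j k)).sub ((hC l j m).mul (hC m i k)))

theorem mSmooth_rmat (hx : x ∈ (extChartAt (𝓡 n) c).target) (i j : Fin n) :
    MSmooth (rmat g c i j) x := fun l k => smoothNear_riemann g hx l i j k

/-- Multiplication by the Gram matrix cancels the inverse in the definition and leaves the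
Christoffel symbols of the first kind. -/
theorem gram_mul_cmat (hx : x ∈ (extChartAt (𝓡 n) c).target) (i l j : Fin n) :
    (gram g c x * cmat g c i x) l j = (1 / 2) * (mpd i (gram g c) x j l
      + mpd j (gram g c) x i l - mpd l (gram g c) x i j) := by
  set b : Fin n → ℝ := fun l => (1 / 2) * (mpd i (gram g c) x j l
      + mpd j (gram g c) x i l - mpd l (gram g c) x i j) with hb
  have h1 : (fun k => cmat g c i x k j) = (gram g c x)⁻¹.mulVec b := by
    funext k
    simp only [cmat, Matrix.of_apply, christoffel, Matrix.mulVec, dotProduct, hb, Finset.mul_sum]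
    refine Finset.sum_congr rfl fun l _ => ?_
    simp only [mpd, Matrix.of_apply]
    ring
  have h2 : (gram g c x).mulVec (fun k => cmat g c i x k j) = b := by
    rw [h1, Matrix.mulVec_mulVec, Matrix.mul_nonsing_inv _
      (isUnit_iff_ne_zero.mpr (det_gram_ne_zero g hx)), Matrix.one_mulVec]
  exact congrFun h2 l

/-- The Levi-Civita connection is determined by being torsion-free and metric. -/
theorem eq_gram_mul_cmat (hx : x ∈ (extChartAt (𝓡 n) c).target)
    {K : Fin n → Matrix (Fin n) (Fin n) ℝ} (hs : ∀ i j l, K i l j = K j l i)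
    (hK : ∀ i, mpd i (gram g c) x = (K i).transpose + K i) (i : Fin n) :
    K i = gram g c x * cmat g c i x := by
  ext l j
  -- The Koszul combination: of the six terms, four cancel by the symmetry of K in the lower
  -- indices, and the other two each give K.
  rw [gram_mul_cmat g hx, hK, hK, hK]
  simp only [Matrix.add_apply, Matrix.transpose_apply]
  rw [hs l i j, hs l j i, hs j i l]
  ring

/-- Metric compatibility: in the sum of the two first-kind symbols the derivatives in the directions
j and k cancel. -/
theorem mpd_gram (hx : x ∈ (extChartAt (𝓡 n) c).target) (i : Fin n) :
    mpd i (gram g c) x = (cmat g c i x).transpose * gram g c x + gram g c x * cmat g c i x := by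
  have h : (cmat g c i x).transpose * gram g c x = (gram g c x * cmat g c i x).transpose := by
    rw [Matrix.transpose_mul, gram_transpose]
  rw [h]
  ext k j
  have hs : ∀ l i j, mpd l (gram g c) x i j = mpd l (gram g c) x j i := fun l i j =>
    congrFun (congrFun ((mpd_transpose (A := gram g c) (x := x) l).symm.trans
      (congrArg (fun A => mpd l A x) (funext fun y => gram_transpose g c y))) j) i
  simp only [Matrix.add_apply, Matrix.transpose_apply, gram_mul_cmat g hx]
  rw [hs i j k, hs j i k, hs k i j]
  ring

/-- The curvature with lowered first index: `⟨∂_l, R(∂_i, ∂_j) ∂_k⟩`. -/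
def rlow (c : M) (l i j k : Fin n) (x : Eucl n) : ℝ := ∑ m, gram g c x l m * riemann g c m i j k x

theorem rlow_eq (l i j k : Fin n) : rlow g c l i j k x = (gram g c x * rmat g c i j x) l k := rfl

theorem rlow_antisymm₁ (l i j k : Fin n) : rlow g c l i j k x = - rlow g c l j i k x := by
  rw [rlow_eq, rlow_eq, rmat_antisymm, Matrix.mul_neg, Matrix.neg_apply]

/-- Second partial derivatives of the Gram matrix commute. Expanding both orders by metric
compatibility, the difference is exactly the lowered curvature plus its transpose. -/
theorem rlow_antisymm₂ (hx : x ∈ (extChartAt (𝓡 n) c).target) (l i j k : Fin n) :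
    rlow g c l i j k x = - rlow g c k i j l x := by
  have hG := mSmooth_gram g hx
  have hC := mSmooth_cmat g hx
  have hd : ∀ i j, mpd i (mpd j (gram g c)) x
      = (mpd i (cmat g c j) x).transpose * gram g c x
        + (cmat g c j x).transpose * mpd i (gram g c) x
        + (mpd i (gram g c) x * cmat g c j x + gram g c x * mpd i (cmat g c j) x) := by
    intro i j
    have h1 : mpd j (gram g c) =ᶠ[𝓝 x] fun y => (cmat g c j y).transpose * gram g c y
        + gram g c y * cmat g c j y := by
      filter_upwards [(isOpen_extChartAt_target c).mem_nhds hx] with y hy using mpd_gram g hy j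
    rw [mpd_congr i h1, mpd_add i ((hC j).transpose.mul hG) (hG.mul (hC j)),
      mpd_mul i (hC j).transpose hG, mpd_mul i hG (hC j), mpd_transpose]
  have h2 := mpd_comm i j hG
  rw [hd, hd, mpd_gram g hx, mpd_gram g hx] at h2
  have h3 : gram g c x * rmat g c i j x = - (gram g c x * rmat g c i j x).transpose := by
    rw [Matrix.transpose_mul, gram_transpose, rmat_eq]
    simp only [Matrix.transpose_add, Matrix.transpose_sub, Matrix.transpose_mul]
    rw [← sub_eq_zero] at h2 ⊢
    rw [← h2]
    noncomm_ring
  exact congrFun (congrFun h3 l) k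

/-- The first Bianchi identity: in the cyclic sum both the derivative terms and the quadratic terms
cancel by the symmetry of the Christoffel symbols. -/
theorem rmat_bianchi (l i j k : Fin n) :
    riemann g c l i j k x + riemann g c l j k i x + riemann g c l k i j x = 0 := by
  simp only [riemann, Finset.sum_sub_distrib]
  rw [christoffel_symm g c l i j, christoffel_symm g c l k i, christoffel_symm g c l j k]
  have h : ∀ a b d, ∑ m, christoffel g c l a m x * christoffel g c m b d x
      = ∑ m, christoffel g c l a m x * christoffel g c m d b x := fun a b d =>
    Finset.sum_congr rfl fun m _ => by rw [christoffel_symm g c m b d]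
  rw [h i j k, h j k i, h k i j]
  ring

theorem rlow_bianchi (l i j k : Fin n) :
    rlow g c l i j k x + rlow g c l j k i x + rlow g c l k i j x = 0 := by
  simp only [rlow, ← Finset.sum_add_distrib, ← mul_add, rmat_bianchi, mul_zero,
    Finset.sum_const_zero]

/-- The usual octahedron argument: pair symmetry is a linear consequence of four Bianchi identities
and the two antisymmetries. -/
theorem rlow_pair (hx : x ∈ (extChartAt (𝓡 n) c).target) (l i j k : Fin n) :
    rlow g c l i j k x = rlow g c j k l i x := by
  have a1 := fun l i j k => rlow_antisymm₁ g (c := c) (x := x) l i j k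
  have a2 := fun l i j k => rlow_antisymm₂ g hx l i j k
  have b := fun l i j k => rlow_bianchi g (c := c) (x := x) l i j k
  linarith [b l i j k, b i j k l, b j k l i, b k l i j, a1 l i j k, a1 l j k i, a1 l k i j,
    a1 i j k l, a1 i k l j, a1 i l j k, a1 j k l i, a1 j l i k, a1 j i k l, a1 k l i j, a1 k i j l,
    a1 k j l i, a2 l i j k, a2 l j k i, a2 l k i j, a2 i j k l, a2 i k l j, a2 i l j k,
    a2 j k l i, a2 j l i k, a2 j i k l, a2 k l i j, a2 k i j l, a2 k j l i]

/-- The equation ∇R = 0 solved for the ordinary derivative. The endomorphism indices give the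
commutator with the connection matrix, the two form indices the remaining sums. -/
theorem mpd_rmat (hR : ParallelCurvature g) (hx : x ∈ (extChartAt (𝓡 n) c).target)
    (m i j : Fin n) : mpd m (rmat g c i j) x = rmat g c i j x * cmat g c m x
      - cmat g c m x * rmat g c i j x + ∑ a, christoffel g c a m i x • rmat g c a j x
      + ∑ a, christoffel g c a m j x • rmat g c i a x := by
  ext l k
  have h := hR c x hx m l i j k
  simp only [covDerivRiemann, Finset.sum_sub_distrib] at h
  simp only [mpd, rmat, cmat, Matrix.of_apply, Matrix.add_apply, Matrix.sub_apply,
    Matrix.mul_apply, Matrix.sum_apply, Matrix.smul_apply, smul_eq_mul]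
  simp only [mul_comm (riemann g c l i j _ x)]
  linarith

/-! ### Change of charts -/

theorem partialDeriv_comp_transition (h : InOverlap c c' x) {T : Eucl n → ℝ}
    (hT : SmoothNear T (transition c c' x)) (i : Fin n) :
    partialDeriv i (fun y => T (transition c c' y)) x
      = ∑ a, jac c c' x a i * partialDeriv a T (transition c c' x) := by
  have h1 := (hT.differentiableAt.hasFDerivAt.comp x
    (smoothNear_transition h).differentiableAt.hasFDerivAt).fderiv
  have h2 := congrArg (fun S => S (EuclideanSpace.single i 1)) h1
  refine h2.trans ?_
  change fderiv ℝ T (transition c c' x)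
    (fderiv ℝ (transition c c') x (EuclideanSpace.single i 1)) = _
  rw [fderiv_transition_single h]
  simp [partialDeriv]

theorem mpd_comp_transition (h : InOverlap c c' x) {A : Eucl n → Matrix (Fin n) (Fin n) ℝ}
    (hA : MSmooth A (transition c c' x)) (i : Fin n) :
    mpd i (fun y => A (transition c c' y)) x
      = ∑ a, jac c c' x a i • mpd a A (transition c c' x) := by
  ext k l
  simp only [mpd, Matrix.of_apply, Matrix.sum_apply, Matrix.smul_apply, smul_eq_mul]
  exact partialDeriv_comp_transition h (hA k l) i

theorem MSmooth.comp_transition (h : InOverlap c c' x) {A : Eucl n → Matrix (Fin n) (Fin n) ℝ}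
    (hA : MSmooth A (transition c c' x)) : MSmooth (fun y => A (transition c c' y)) x :=
  fun k l => SmoothNear.comp (hA k l) (smoothNear_transition h)

/-- The Christoffel symbols of the second chart, pulled back as a matrix-valued form. -/
def cmatPull (c c' : M) (i : Fin n) (x : Eucl n) : Matrix (Fin n) (Fin n) ℝ :=
  ∑ b, jac c c' x b i • cmat g c' b (transition c c' x)

/-- The curvature of the second chart, pulled back as a matrix-valued form. -/
def rmatPull (c c' : M) (i j : Fin n) (x : Eucl n) : Matrix (Fin n) (Fin n) ℝ :=
  ∑ b, ∑ d, (jac c c' x b i * jac c c' x d j) • rmat g c' b d (transition c c' x)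

theorem mSmooth_jac (h : InOverlap c c' x) : MSmooth (jac c c') x := smoothNear_jac h

theorem mpd_jac_symm (h : InOverlap c c' x) (i j a : Fin n) :
    mpd i (jac c c') x a j = mpd j (jac c c') x a i :=
  (smoothNear_transition_apply h a).fderiv_comm _ _

theorem mSmooth_cmatPull (h : InOverlap c c' x) (i : Fin n) : MSmooth (cmatPull g c c' i) x :=
  MSmooth.smul_sum (fun b => smoothNear_jac h b i)
    fun b => (mSmooth_cmat g (transition_mem h) b).comp_transition h

theorem gram_transition_matrix (h : InOverlap c c' x) :
    gram g c x = (jac c c' x).transpose * gram g c' (transition c c' x) * jac c c' x := by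
  ext i j
  rw [gram_transition g h]
  simp only [Matrix.mul_apply, Matrix.transpose_apply, Finset.sum_mul]
  exact Finset.sum_comm

/-- The transformation law of the connection follows from uniqueness rather than from transforming
the formula. The matrices on the right, multiplied by Jᵀ G', are symmetric in the lower indices
because second derivatives commute, and they are metric because G = Jᵀ G' J. Hence they are the
first-kind symbols of the first chart, and the invertible factor Jᵀ G' is cancelled. -/
theorem cmat_transition (h : InOverlap c c' x) (i : Fin n) :
    jac c c' x * cmat g c i x = mpd i (jac c c') x + cmatPull g c c' i x * jac c c' x := by
  set J := jac c c' x
  set G' := gram g c' (transition c c' x) with hG'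
  have hJ := mSmooth_jac h
  have hsG := (mSmooth_gram g (transition_mem h)).comp_transition h
  have hG't : G'.transpose = G' := gram_transpose g c' _
  have hdG : ∀ i, mpd i (fun y => gram g c' (transition c c' y)) x
      = (cmatPull g c c' i x).transpose * G' + G' * cmatPull g c c' i x := by
    intro i
    rw [mpd_comp_transition h (mSmooth_gram g (transition_mem h))]
    simp only [mpd_gram g (transition_mem h), cmatPull, Matrix.transpose_sum, Matrix.sum_mul,
      Matrix.mul_sum, smul_add, Finset.sum_add_distrib, Matrix.transpose_smul, Matrix.smul_mul,
      Matrix.mul_smul, hG']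
  have hK := eq_gram_mul_cmat g h.1
    (K := fun i => J.transpose * G' * (mpd i (jac c c') x + cmatPull g c c' i x * J)) ?_ ?_ i
  · have hdet : IsUnit (J.transpose * G').det := by
      have h1 := det_gram_ne_zero g h.1
      rw [gram_transition_matrix g h, Matrix.det_mul] at h1
      exact isUnit_iff_ne_zero.mpr (left_ne_zero_of_mul h1)
    have h2 := congrArg (fun A => (J.transpose * G')⁻¹ * A) hK
    rw [gram_transition_matrix g h, Matrix.mul_assoc (J.transpose * G'),
      Matrix.nonsing_inv_mul_cancel_left _ _ hdet, Matrix.nonsing_inv_mul_cancel_left _ _ hdet] at h2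
    exact h2.symm
  · intro i j l
    have hs : ∀ a, (mpd i (jac c c') x + cmatPull g c c' i x * J) a j
        = (mpd j (jac c c') x + cmatPull g c c' j x * J) a i := by
      intro a
      simp only [Matrix.add_apply, mpd_jac_symm h i j a]
      congr 1
      simp only [cmatPull, Matrix.mul_apply, Matrix.sum_apply, Matrix.smul_apply, cmat,
        Matrix.of_apply, smul_eq_mul, Finset.sum_mul]
      rw [Finset.sum_comm]
      refine Finset.sum_congr rfl fun b _ => Finset.sum_congr rfl fun d _ => ?_
      rw [christoffel_symm]
      ring
    change (J.transpose * G' * (mpd i (jac c c') x + cmatPull g c c' i x * J)) l j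
      = (J.transpose * G' * (mpd j (jac c c') x + cmatPull g c c' j x * J)) l i
    rw [Matrix.mul_apply, Matrix.mul_apply]
    exact Finset.sum_congr rfl fun a _ => by rw [hs a]
  · intro i
    have h1 : gram g c =ᶠ[𝓝 x] fun y => (jac c c' y).transpose * gram g c' (transition c c' y)
        * jac c c' y := h.eventually.mono fun y hy => gram_transition_matrix g hy
    rw [mpd_congr i h1, mpd_mul i (hJ.transpose.mul hsG) hJ, mpd_mul i hJ.transpose hsG,
      mpd_transpose, hdG]
    simp only [Matrix.transpose_mul, Matrix.transpose_add, Matrix.transpose_transpose, hG't]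
    change (_ * G' + J.transpose * _) * J + J.transpose * G' * _ = _
    noncomm_ring

/-- Pull-back is compatible with the structure equation dΓ + Γ ∧ Γ: the derivatives of the Jacobian
are symmetric second derivatives of the transition map and cancel after antisymmetrisation. -/
theorem rmatPull_eq (h : InOverlap c c' x) (i j : Fin n) :
    rmatPull g c c' i j x = mpd i (cmatPull g c c' j) x - mpd j (cmatPull g c c' i) x
      + (cmatPull g c c' i x * cmatPull g c c' j x
        - cmatPull g c c' j x * cmatPull g c c' i x) := by
  have hd : ∀ i j, mpd i (cmatPull g c c' j) x
      = ∑ b, mpd i (jac c c') x b j • cmat g c' b (transition c c' x)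
        + ∑ b, ∑ d, (jac c c' x b j * jac c c' x d i)
          • mpd d (cmat g c' b) (transition c c' x) := by
    intro i j
    unfold cmatPull
    rw [mpd_smul_sum i (fun b => smoothNear_jac h b j)
      fun b => (mSmooth_cmat g (transition_mem h) b).comp_transition h, Finset.sum_add_distrib]
    congr 1
    refine Finset.sum_congr rfl fun b _ => ?_
    rw [mpd_comp_transition h (mSmooth_cmat g (transition_mem h) b), Finset.smul_sum]
    simp only [smul_smul]
  have hp : ∀ i j, cmatPull g c c' i x * cmatPull g c c' j x
      = ∑ b, ∑ d, (jac c c' x b i * jac c c' x d j) •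
        (cmat g c' b (transition c c' x) * cmat g c' d (transition c c' x)) := by
    intro i j
    simp only [cmatPull, Matrix.sum_mul, Matrix.mul_sum, Matrix.smul_mul, Matrix.mul_smul,
      Finset.smul_sum, smul_smul]
    rw [Finset.sum_comm]
    simp only [mul_comm]
  have hsw : ∀ (i j : Fin n) (X : Fin n → Fin n → Matrix (Fin n) (Fin n) ℝ),
      ∑ b, ∑ d, (jac c c' x b j * jac c c' x d i) • X b d
        = ∑ b, ∑ d, (jac c c' x b i * jac c c' x d j) • X d b := by
    intro i j X
    rw [Finset.sum_comm]
    simp only [mul_comm]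
  rw [hd, hd, hp, hp, hsw i j, hsw i j]
  simp only [mpd_jac_symm h j i]
  simp only [rmatPull, rmat_eq, smul_add, smul_sub, Finset.sum_add_distrib,
    Finset.sum_sub_distrib]
  abel

/-- Differentiate J Γ = dJ + Γ' J and antisymmetrise. The second derivatives of J cancel, and
substituting the equation for the remaining dJ leaves the two structure equations. -/
theorem rmat_transition (h : InOverlap c c' x) (i j : Fin n) :
    jac c c' x * rmat g c i j x = rmatPull g c c' i j x * jac c c' x := by
  have hJ := mSmooth_jac h
  have hC := mSmooth_cmat g h.1
  have hP := mSmooth_cmatPull g h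
  have hd : ∀ i j, mpd i (jac c c') x * cmat g c j x + jac c c' x * mpd i (cmat g c j) x
      = mpd i (mpd j (jac c c')) x + (mpd i (cmatPull g c c' j) x * jac c c' x
        + cmatPull g c c' j x * mpd i (jac c c') x) := by
    intro i j
    have h1 : (fun y => jac c c' y * cmat g c j y) =ᶠ[𝓝 x]
        fun y => mpd j (jac c c') y + cmatPull g c c' j y * jac c c' y :=
      h.eventually.mono fun y hy => cmat_transition g hy j
    have h2 := mpd_congr i h1
    rwa [mpd_mul i hJ (hC j), mpd_add i (hJ.mpd j) ((hP j).mul hJ), mpd_mul i (hP j) hJ] at h2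
  have h1 := hd i j
  have h2 := hd j i
  have e : ∀ i, mpd i (jac c c') x
      = jac c c' x * cmat g c i x - cmatPull g c c' i x * jac c c' x := fun i =>
    eq_sub_of_add_eq (cmat_transition g h i).symm
  rw [mpd_comm j i hJ] at h2
  rw [rmat_eq, rmatPull_eq g h]
  rw [← sub_eq_zero] at h1 h2 ⊢
  have h3 := congrArg₂ (fun a b => a - b) h1 h2
  simp only [e, sub_zero] at h3
  rw [← h3]
  noncomm_ring

end Connection

/-! ### Multilinear algebra with anticommuting components -/

section MultilinearAlgebra

/-! ### Reindexing of multiple sums -/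

section Sums

variable {ι R : Type*} [Fintype ι] [AddCommMonoid R]

theorem sum4_swap₁₂ (f : ι → ι → ι → ι → R) :
    ∑ l, ∑ i, ∑ j, ∑ k, f l i j k = ∑ l, ∑ i, ∑ j, ∑ k, f i l j k := Finset.sum_comm

theorem sum4_swap₂₃ (f : ι → ι → ι → ι → R) :
    ∑ l, ∑ i, ∑ j, ∑ k, f l i j k = ∑ l, ∑ i, ∑ j, ∑ k, f l j i k :=
  Finset.sum_congr rfl fun _ _ => Finset.sum_comm

theorem sum4_swap₃₄ (f : ι → ι → ι → ι → R) :
    ∑ l, ∑ i, ∑ j, ∑ k, f l i j k = ∑ l, ∑ i, ∑ j, ∑ k, f l i k j :=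
  Finset.sum_congr rfl fun _ _ => Finset.sum_congr rfl fun _ _ => Finset.sum_comm

theorem sum5_eq (f : ι → ι → ι → ι → ι → R) : ∑ l, ∑ i, ∑ j, ∑ k, ∑ a, f l i j k a
    = ∑ q : ι × ι × ι × ι × ι, f q.1 q.2.1 q.2.2.1 q.2.2.2.1 q.2.2.2.2 := by
  simp only [Fintype.sum_prod_type]

theorem sum5_swap₁₅ (f : ι → ι → ι → ι → ι → R) :
    ∑ l, ∑ i, ∑ j, ∑ k, ∑ a, f l i j k a = ∑ l, ∑ i, ∑ j, ∑ k, ∑ a, f a i j k l := by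
  rw [sum5_eq, sum5_eq]
  exact Fintype.sum_equiv (Function.Involutive.toPerm
    (fun q : ι × ι × ι × ι × ι => (q.2.2.2.2, q.2.1, q.2.2.1, q.2.2.2.1, q.1))
    fun _ => rfl) _ _ fun _ => rfl

theorem sum5_swap₂₅ (f : ι → ι → ι → ι → ι → R) :
    ∑ l, ∑ i, ∑ j, ∑ k, ∑ a, f l i j k a = ∑ l, ∑ i, ∑ j, ∑ k, ∑ a, f l a j k i := by
  rw [sum5_eq, sum5_eq]
  exact Fintype.sum_equiv (Function.Involutive.toPerm
    (fun q : ι × ι × ι × ι × ι => (q.1, q.2.2.2.2, q.2.2.1, q.2.2.2.1, q.2.1))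
    fun _ => rfl) _ _ fun _ => rfl

theorem sum5_swap₃₅ (f : ι → ι → ι → ι → ι → R) :
    ∑ l, ∑ i, ∑ j, ∑ k, ∑ a, f l i j k a = ∑ l, ∑ i, ∑ j, ∑ k, ∑ a, f l i a k j := by
  rw [sum5_eq, sum5_eq]
  exact Fintype.sum_equiv (Function.Involutive.toPerm
    (fun q : ι × ι × ι × ι × ι => (q.1, q.2.1, q.2.2.2.2, q.2.2.2.1, q.2.2.1))
    fun _ => rfl) _ _ fun _ => rfl

theorem sum5_swap₄₅ (f : ι → ι → ι → ι → ι → R) :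
    ∑ l, ∑ i, ∑ j, ∑ k, ∑ a, f l i j k a = ∑ l, ∑ i, ∑ j, ∑ k, ∑ a, f l i j a k := by
  rw [sum5_eq, sum5_eq]
  exact Fintype.sum_equiv (Function.Involutive.toPerm
    (fun q : ι × ι × ι × ι × ι => (q.1, q.2.1, q.2.2.1, q.2.2.2.2, q.2.2.2.1))
    fun _ => rfl) _ _ fun _ => rfl

end Sums

variable {ι R : Type*} [Fintype ι] [Ring R]

/-- The element `a` commutes with everything. -/
def IsCentral (a : R) : Prop := ∀ x, a * x = x * a

/-- A bilinear form with coefficients `G`, the factors being multiplied in the order written. -/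
def bilin (G : ι → ι → R) (X Y : ι → R) : R := ∑ i, ∑ j, G i j * X i * Y j

/-- A quadrilinear form with coefficients `ρ`, the factors being multiplied in the order
written. -/
def quad (ρ : ι → ι → ι → ι → R) (X Y Z W : ι → R) : R :=
  ∑ l, ∑ i, ∑ j, ∑ k, ρ l i j k * X l * Y i * Z j * W k

/-- The vectors `X` and `Y` have anticommuting components. -/
def AntiComm (X Y : ι → R) : Prop := ∀ i j, X i * Y j = -(Y j * X i)

/-- The assumption on `dG` says that the coefficients are parallel for the connection γ. The
derivative of the coefficients then completes the derivatives of the arguments to covariant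
derivatives; centrality of γ allows it to be moved to its argument. -/
theorem bilin_leibniz {G dG γ : ι → ι → R} {X Y dX dY : ι → R}
    (hγ : ∀ i j, IsCentral (γ i j))
    (hdG : ∀ i j, dG i j = ∑ l, (γ l i * G l j + G i l * γ l j)) :
    ∑ i, ∑ j, ((dG i j * X i + G i j * dX i) * Y j + G i j * X i * dY j)
      = bilin G (fun i => dX i + ∑ k, γ i k * X k) Y
        + bilin G X (fun j => dY j + ∑ k, γ j k * Y k) := by
  have h1 : ∑ i, ∑ j, dG i j * X i * Y j = ∑ i, ∑ j, G i j * (∑ k, γ i k * X k) * Y j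
      + ∑ i, ∑ j, G i j * X i * (∑ k, γ j k * Y k) := by
    simp only [hdG, Finset.sum_mul, Finset.mul_sum, add_mul, Finset.sum_add_distrib]
    congr 1
    · have : ∀ j, ∑ i, ∑ l, γ l i * G l j * X i * Y j
          = ∑ i, ∑ k, G i j * (γ i k * X k) * Y j := fun j => by
        rw [Finset.sum_comm]
        refine Finset.sum_congr rfl fun l _ => Finset.sum_congr rfl fun i _ => ?_
        rw [hγ l i (G l j), ← mul_assoc (G l j)]
      rw [Finset.sum_comm, Finset.sum_congr rfl fun j _ => this j]
      exact Finset.sum_comm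
    · refine Finset.sum_congr rfl fun i _ => ?_
      rw [Finset.sum_comm]
      refine Finset.sum_congr rfl fun l _ => Finset.sum_congr rfl fun j _ => ?_
      rw [mul_assoc (G i l), hγ l j (X i), mul_assoc (G i l), mul_assoc (X i), ← mul_assoc]
  simp only [bilin, mul_add, add_mul, Finset.sum_add_distrib]
  rw [h1]
  abel

/-- A matrix acting on one index of the coefficient tensor is transferred to the corresponding
argument. The four versions serve both for connection matrices in `quad_leibniz` and for Jacobians
in `quad_chart`. -/
theorem quad_slot₁ {ρ : ι → ι → ι → ι → R} {γ : ι → ι → R} (X Y Z W : ι → R)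
    (hγ : ∀ i j, IsCentral (γ i j)) :
    quad (fun l i j k => ∑ a, γ a l * ρ a i j k) X Y Z W
      = quad ρ (fun i => ∑ k, γ i k * X k) Y Z W := by
  simp only [quad, Finset.sum_mul]
  refine (sum5_swap₁₅ fun l i j k a => γ a l * ρ a i j k * X l * Y i * Z j * W k).trans ?_
  simp only [Finset.sum_mul, Finset.mul_sum]
  refine Finset.sum_congr rfl fun l _ => Finset.sum_congr rfl fun i _ =>
    Finset.sum_congr rfl fun j _ => Finset.sum_congr rfl fun k _ =>
    Finset.sum_congr rfl fun a _ => ?_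
  rw [hγ l a (ρ l i j k), mul_assoc (ρ l i j k)]

theorem quad_slot₂ {ρ : ι → ι → ι → ι → R} {γ : ι → ι → R} (X Y Z W : ι → R)
    (hγ : ∀ i j, IsCentral (γ i j)) :
    quad (fun l i j k => ∑ a, γ a i * ρ l a j k) X Y Z W
      = quad ρ X (fun i => ∑ k, γ i k * Y k) Z W := by
  simp only [quad, Finset.sum_mul]
  refine (sum5_swap₂₅ fun l i j k a => γ a i * ρ l a j k * X l * Y i * Z j * W k).trans ?_
  simp only [Finset.sum_mul, Finset.mul_sum]
  refine Finset.sum_congr rfl fun l _ => Finset.sum_congr rfl fun i _ =>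
    Finset.sum_congr rfl fun j _ => Finset.sum_congr rfl fun k _ =>
    Finset.sum_congr rfl fun a _ => ?_
  rw [mul_assoc (γ i a), hγ i a (ρ l i j k * X l), mul_assoc _ (γ i a)]

theorem quad_slot₃ {ρ : ι → ι → ι → ι → R} {γ : ι → ι → R} (X Y Z W : ι → R)
    (hγ : ∀ i j, IsCentral (γ i j)) :
    quad (fun l i j k => ∑ a, γ a j * ρ l i a k) X Y Z W
      = quad ρ X Y (fun i => ∑ k, γ i k * Z k) W := by
  simp only [quad, Finset.sum_mul]
  refine (sum5_swap₃₅ fun l i j k a => γ a j * ρ l i a k * X l * Y i * Z j * W k).trans ?_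
  simp only [Finset.sum_mul, Finset.mul_sum]
  refine Finset.sum_congr rfl fun l _ => Finset.sum_congr rfl fun i _ =>
    Finset.sum_congr rfl fun j _ => Finset.sum_congr rfl fun k _ =>
    Finset.sum_congr rfl fun a _ => ?_
  rw [mul_assoc (γ j a), mul_assoc (γ j a), hγ j a (ρ l i j k * X l * Y i),
    mul_assoc _ (γ j a)]

theorem quad_slot₄ {ρ : ι → ι → ι → ι → R} {γ : ι → ι → R} (X Y Z W : ι → R)
    (hγ : ∀ i j, IsCentral (γ i j)) :
    quad (fun l i j k => ∑ a, γ a k * ρ l i j a) X Y Z W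
      = quad ρ X Y Z (fun i => ∑ k, γ i k * W k) := by
  simp only [quad, Finset.sum_mul]
  refine (sum5_swap₄₅ fun l i j k a => γ a k * ρ l i j a * X l * Y i * Z j * W k).trans ?_
  simp only [Finset.mul_sum]
  refine Finset.sum_congr rfl fun l _ => Finset.sum_congr rfl fun i _ =>
    Finset.sum_congr rfl fun j _ => Finset.sum_congr rfl fun k _ =>
    Finset.sum_congr rfl fun a _ => ?_
  rw [mul_assoc (γ k a), mul_assoc (γ k a), mul_assoc (γ k a),
    hγ k a (ρ l i j k * X l * Y i * Z j), mul_assoc _ (γ k a)]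

/-- The invariance of a bilinear form under a change of basis. -/
theorem bilin_change {G : ι → ι → R} {J : ι → ι → R} (hJ : ∀ i j, IsCentral (J i j))
    (X Y : ι → R) : bilin (fun i j => ∑ a, ∑ b, J a i * G a b * J b j) X Y
      = bilin G (fun a => ∑ i, J a i * X i) (fun b => ∑ j, J b j * Y j) := by
  have e : ∀ f : ι → ι → ι → ι → R, ∑ i, ∑ j, ∑ a, ∑ b, f i j a b
      = ∑ a, ∑ b, ∑ j, ∑ i, f i j a b := fun f => by
    rw [sum4_swap₂₃, sum4_swap₁₂, sum4_swap₃₄, sum4_swap₂₃, sum4_swap₃₄]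
  simp only [bilin, Finset.sum_mul, Finset.mul_sum]
  rw [e]
  refine Finset.sum_congr rfl fun a _ => Finset.sum_congr rfl fun b _ =>
    Finset.sum_congr rfl fun j _ => Finset.sum_congr rfl fun i _ => ?_
  rw [hJ a i (G a b), mul_assoc (G a b * J a i), hJ b j (X i)]
  simp only [mul_assoc]

/-- As for bilinear forms: with parallel coefficients, the four terms in the derivative of the
coefficients turn the derivatives of the four arguments into covariant ones. -/
theorem quad_leibniz {ρ dρ : ι → ι → ι → ι → R} {γ : ι → ι → R} {X Y Z W dX dY dZ dW : ι → R}
    (hγ : ∀ i j, IsCentral (γ i j))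
    (hdρ : ∀ l i j k, dρ l i j k = ∑ a, (γ a l * ρ a i j k + γ a i * ρ l a j k
      + γ a j * ρ l i a k + γ a k * ρ l i j a)) :
    ∑ l, ∑ i, ∑ j, ∑ k, ((((dρ l i j k * X l + ρ l i j k * dX l) * Y i
        + ρ l i j k * X l * dY i) * Z j + ρ l i j k * X l * Y i * dZ j) * W k
        + ρ l i j k * X l * Y i * Z j * dW k)
      = quad ρ (fun i => dX i + ∑ k, γ i k * X k) Y Z W
        + quad ρ X (fun i => dY i + ∑ k, γ i k * Y k) Z W
        + quad ρ X Y (fun i => dZ i + ∑ k, γ i k * Z k) W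
        + quad ρ X Y Z (fun i => dW i + ∑ k, γ i k * W k) := by
  have h1 : ∑ l, ∑ i, ∑ j, ∑ k, dρ l i j k * X l * Y i * Z j * W k
      = quad ρ (fun i => ∑ k, γ i k * X k) Y Z W + quad ρ X (fun i => ∑ k, γ i k * Y k) Z W
        + quad ρ X Y (fun i => ∑ k, γ i k * Z k) W + quad ρ X Y Z fun i => ∑ k, γ i k * W k := by
    rw [← quad_slot₁ X Y Z W hγ, ← quad_slot₂ X Y Z W hγ, ← quad_slot₃ X Y Z W hγ,
      ← quad_slot₄ X Y Z W hγ]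
    simp only [quad, ← Finset.sum_add_distrib, ← add_mul, hdρ]
  simp only [quad] at h1 ⊢
  simp only [mul_add, add_mul, Finset.sum_add_distrib]
  rw [h1]
  abel

theorem bilin_comm {G : ι → ι → R} {X Y : ι → R} (hG : ∀ i j, G i j = G j i)
    (hXY : ∀ i j, X i * Y j = Y j * X i) : bilin G X Y = bilin G Y X := by
  unfold bilin
  rw [Finset.sum_comm]
  refine Finset.sum_congr rfl fun i _ => Finset.sum_congr rfl fun j _ => ?_
  rw [hG, mul_assoc, hXY, ← mul_assoc]

theorem bilin_anticomm {G : ι → ι → R} {X Y : ι → R} (hG : ∀ i j, G i j = G j i)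
    (hXY : AntiComm X Y) : bilin G X Y = - bilin G Y X := by
  unfold bilin
  rw [Finset.sum_comm]
  simp only [← Finset.sum_neg_distrib]
  refine Finset.sum_congr rfl fun i _ => Finset.sum_congr rfl fun j _ => ?_
  rw [hG, mul_assoc, hXY, mul_neg, ← mul_assoc]

theorem bilin_add_right (G : ι → ι → R) (X Y Z : ι → R) :
    bilin G X (fun i => Y i + Z i) = bilin G X Y + bilin G X Z := by
  simp only [bilin, mul_add, Finset.sum_add_distrib]

theorem bilin_sub_right (G : ι → ι → R) (X Y Z : ι → R) :
    bilin G X (fun i => Y i - Z i) = bilin G X Y - bilin G X Z := by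
  simp only [bilin, mul_sub, Finset.sum_sub_distrib]

theorem bilin_neg_right (G : ι → ι → R) (X Y : ι → R) :
    bilin G X (fun i => - Y i) = - bilin G X Y := by
  simp only [bilin, mul_neg, Finset.sum_neg_distrib]

/-! ### Curvature symmetries on anticommuting and on commuting arguments -/

section Symmetries

variable {ρ : ι → ι → ι → ι → R} (h1 : ∀ l i j k, ρ l i j k = - ρ l j i k)
  (h2 : ∀ l i j k, ρ l i j k = - ρ k i j l)
  (hp : ∀ l i j k, ρ l i j k = ρ j k l i)
  (hb : ∀ l i j k, ρ l i j k + ρ l j k i + ρ l k i j = 0) {X Y Z W : ι → R}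

include h1 in
-- The sign from the antisymmetry of the curvature cancels the sign from anticommuting factors. This
-- is why R(ψ, ψ) need not vanish for an odd ψ.
theorem quad_swap_inner (hYZ : AntiComm Y Z) : quad ρ X Y Z W = quad ρ X Z Y W := by
  unfold quad
  rw [sum4_swap₂₃]
  refine Finset.sum_congr rfl fun l _ => Finset.sum_congr rfl fun i _ =>
    Finset.sum_congr rfl fun j _ => Finset.sum_congr rfl fun k _ => ?_
  rw [h1 l j i k, mul_assoc _ (Y j), hYZ j i]
  noncomm_ring

include h2 in
-- Exchanging the outer factors takes five transpositions of odd factors, hence a sign, which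
-- cancels the sign of the coefficients.
theorem quad_swap_outer (hXY : AntiComm X Y) (hXZ : AntiComm X Z) (hXW : AntiComm X W)
    (hYW : AntiComm Y W) (hZW : AntiComm Z W) : quad ρ X Y Z W = quad ρ W Y Z X := by
  have hs : ∀ f : ι → ι → ι → ι → R, ∑ l, ∑ i, ∑ j, ∑ k, f l i j k
      = ∑ l, ∑ i, ∑ j, ∑ k, f k i j l := fun f => by
    rw [sum4_swap₃₄, sum4_swap₂₃, sum4_swap₁₂, sum4_swap₂₃, sum4_swap₃₄]
  unfold quad
  rw [hs]
  refine Finset.sum_congr rfl fun l _ => Finset.sum_congr rfl fun i _ =>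
    Finset.sum_congr rfl fun j _ => Finset.sum_congr rfl fun k _ => ?_
  have e : X k * Y i * Z j * W l = -(W l * Y i * Z j * X k) := by
    calc X k * Y i * Z j * W l = X k * Y i * (Z j * W l) := mul_assoc _ _ _
      _ = - (X k * (Y i * W l) * Z j) := by rw [hZW]; noncomm_ring
      _ = X k * W l * Y i * Z j := by rw [hYW]; noncomm_ring
      _ = - (W l * (X k * Y i) * Z j) := by rw [hXW]; noncomm_ring
      _ = W l * Y i * (X k * Z j) := by rw [hXY]; noncomm_ring
      _ = -(W l * Y i * Z j * X k) := by rw [hXZ]; noncomm_ring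
  rw [h2 k i j l]
  simp only [mul_assoc] at e ⊢
  rw [e]
  noncomm_ring

include hp in
-- Moving one pair of factors past the other takes four transpositions, hence no sign, and the
-- coefficients have pair symmetry.
theorem quad_swap_pair (hXZ : AntiComm X Z) (hXW : AntiComm X W) (hYZ : AntiComm Y Z)
    (hYW : AntiComm Y W) : quad ρ X Y Z W = quad ρ Z W X Y := by
  have hs : ∀ f : ι → ι → ι → ι → R, ∑ l, ∑ i, ∑ j, ∑ k, f l i j k
      = ∑ l, ∑ i, ∑ j, ∑ k, f j k l i := fun f => by
    rw [sum4_swap₂₃, sum4_swap₁₂, sum4_swap₃₄, sum4_swap₂₃]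
  unfold quad
  rw [hs]
  refine Finset.sum_congr rfl fun l _ => Finset.sum_congr rfl fun i _ =>
    Finset.sum_congr rfl fun j _ => Finset.sum_congr rfl fun k _ => ?_
  have e : X j * Y k * Z l * W i = Z l * W i * X j * Y k := by
    calc X j * Y k * Z l * W i = X j * (Y k * Z l) * W i := by rw [mul_assoc (X j)]
      _ = - (X j * Z l * (Y k * W i)) := by rw [hYZ]; noncomm_ring
      _ = X j * Z l * W i * Y k := by rw [hYW]; noncomm_ring
      _ = - (Z l * (X j * W i) * Y k) := by rw [hXZ]; noncomm_ring
      _ = Z l * W i * X j * Y k := by rw [hXW]; noncomm_ring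
  rw [hp j k l i]
  simp only [mul_assoc] at e ⊢
  rw [e]

include hb in
-- Cyclic permutations of three odd factors are even, so the Bianchi identity carries over without
-- signs.
theorem quad_bianchi (hYZ : AntiComm Y Z) (hYW : AntiComm Y W) (hZW : AntiComm Z W) :
    quad ρ X Y Z W + quad ρ X Z W Y + quad ρ X W Y Z = 0 := by
  have e2 : quad ρ X Z W Y = ∑ l, ∑ i, ∑ j, ∑ k, ρ l j k i * X l * Y i * Z j * W k := by
    unfold quad
    rw [sum4_swap₃₄, sum4_swap₂₃]
    refine Finset.sum_congr rfl fun l _ => Finset.sum_congr rfl fun i _ =>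
      Finset.sum_congr rfl fun j _ => Finset.sum_congr rfl fun k _ => ?_
    have e : Z j * W k * Y i = Y i * Z j * W k := by
      rw [hYZ i j, neg_mul, mul_assoc, mul_assoc (Z j), hYW i k, mul_neg, neg_neg]
    simp only [mul_assoc] at e ⊢
    rw [e]
  have e3 : quad ρ X W Y Z = ∑ l, ∑ i, ∑ j, ∑ k, ρ l k i j * X l * Y i * Z j * W k := by
    unfold quad
    rw [sum4_swap₂₃, sum4_swap₃₄]
    refine Finset.sum_congr rfl fun l _ => Finset.sum_congr rfl fun i _ =>
      Finset.sum_congr rfl fun j _ => Finset.sum_congr rfl fun k _ => ?_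
    have e : W k * Y i * Z j = Y i * Z j * W k := by
      rw [mul_assoc (Y i), hZW j k, mul_neg, ← mul_assoc, hYW i k, neg_mul, neg_neg]
    simp only [mul_assoc] at e ⊢
    rw [e]
  rw [e2, e3, quad]
  simp only [← Finset.sum_add_distrib, ← add_mul, hb, zero_mul, Finset.sum_const_zero]

include h1 h2 hp in
/-- For commuting `Y` and `Z`, the pair symmetry turns `⟨X, R(Y, Z) W⟩` into `⟨Y, R(X, W) Z⟩`. -/
theorem quad_exchange (hY : ∀ i, IsCentral (Y i)) (hZ : ∀ i, IsCentral (Z i)) :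
    quad ρ X Y Z W = quad ρ Y X W Z := by
  unfold quad
  rw [sum4_swap₁₂, sum4_swap₃₄]
  refine Finset.sum_congr rfl fun l _ => Finset.sum_congr rfl fun i _ =>
    Finset.sum_congr rfl fun j _ => Finset.sum_congr rfl fun k _ => ?_
  have e : ρ i l k j = ρ l i j k := by
    rw [hp, h2, h1, neg_neg]
  rw [e, mul_assoc _ (X i), ← hY l (X i), ← mul_assoc, mul_assoc _ (Z k), hZ k (W j), ← mul_assoc]

end Symmetries

end MultilinearAlgebra

/-! ### Fields in a chart, over an arbitrary parameter space -/

namespace Multiplet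

section Fields

variable {n : ℕ} {M : Type*} [TopologicalSpace M] [ChartedSpace (Eucl n) M] {L : ℕ}
  {P : Type*} [NormedAddCommGroup P] [NormedSpace ℝ P] (Φ : Multiplet n M L P) (c : M)

/-- The sections of `u^*TM` in a chart, over the parameter space `P`. -/
abbrev Sec (n L : ℕ) (P : Type*) : Type _ := P → Fin n → Grassmann L

/-- The body of `u` at `p` lies in the domain of the chart at `c`. -/
def InChart (p : P) : Prop := Φ.body p ∈ (extChartAt (𝓡 n) c).source

/-- The coordinates of the body of `u`. -/
def pos (p : P) : Eucl n := extChartAt (𝓡 n) c (Φ.body p)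

/-- The value `T(u)` of a function of the coordinates. -/
def cf (T : Eucl n → ℝ) (p : P) : Grassmann L :=
  chartEval (Φ.pull p).toLinearMap (Φ.body p) c T

/-- The derivative of the coordinates of `u` in the direction `v`. -/
def dc (v : P) : Sec n L P := fun p i => fderiv ℝ (Φ.cf c fun x => x i) p v

/-- The components of a family of derivations. -/
def comp (D : P → SmoothFun n M →ₗ[ℝ] Grassmann L) : Sec n L P :=
  fun p i => chartEval (D p) (Φ.body p) c fun x => x i

/-- The components of the section are smooth near `p`. -/
def SecSmooth (Y : Sec n L P) (p : P) : Prop := ∀ i, SmoothNear (fun q => Y q i) p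

theorem isPointOver (p : P) : IsPointOver (Φ.pull p) (Φ.body p) :=
  ⟨Φ.pull_even p, Φ.bodyMap_pull p⟩

variable {Φ c} {p : P} {S T : Eucl n → ℝ}

theorem InChart.target (hp : Φ.InChart c p) : Φ.pos c p ∈ (extChartAt (𝓡 n) c).target :=
  (extChartAt (𝓡 n) c).map_source hp

theorem InChart.eventually (hp : Φ.InChart c p) : ∀ᶠ q in 𝓝 p, Φ.InChart c q :=
  Φ.contMDiff_body.continuous.continuousAt.eventually
    ((isOpen_extChartAt_source c).mem_nhds hp)

variable [IsManifold (𝓡 n) ∞ M] [T2Space M]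

/-- One global function represents T around the bodies of all q near p. This is what allows
differentiation in the parameter to be exchanged with evaluation of a local function. -/
theorem exists_lift_near (hp : Φ.InChart c p) (hT : SmoothNear T (Φ.pos c p)) :
    ∃ f : SmoothFun n M, ∀ᶠ q in 𝓝 p, ∀ᶠ m' in 𝓝 (Φ.body q),
      f m' = T (extChartAt (𝓡 n) c m') := by
  obtain ⟨f, hf⟩ := exists_lift hp hT
  exact ⟨f, Φ.contMDiff_body.continuous.continuousAt.eventually
    (eventually_eventually_nhds.mpr hf)⟩

theorem smoothNear_cf (hp : Φ.InChart c p) (hT : SmoothNear T (Φ.pos c p)) :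
    SmoothNear (Φ.cf c T) p := by
  obtain ⟨f, hf⟩ := exists_lift_near hp hT
  exact (SmoothNear.of_contDiff (Φ.contDiff_pull f)).congr
    (hf.mono fun q hq => (chartEval_eq (Φ.isPointOver q).isLocalAt hq).symm)

theorem secSmooth_comp (hp : Φ.InChart c p) {D : P → SmoothFun n M →ₗ[ℝ] Grassmann L}
    (hD : ∀ q, IsDerivAlong (Φ.pull q) (D q)) (hs : ∀ f, ContDiff ℝ ∞ fun q => D q f) :
    SecSmooth (Φ.comp c D) p := by
  intro i
  obtain ⟨f, hf⟩ := exists_lift_near hp (smoothNear_coord i _)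
  exact (SmoothNear.of_contDiff (hs f)).congr
    (hf.mono fun q hq => (chartEval_eq ((hD q).isLocalAt (Φ.isPointOver q)) hq).symm)

/-- The derivative of `u` in the direction `v`, as a derivation along `u`. -/
def pullDeriv (Φ : Multiplet n M L P) (p v : P) : SmoothFun n M →ₗ[ℝ] Grassmann L where
  toFun f := fderiv ℝ (fun q => Φ.pull q f) p v
  map_add' f h := by
    have := fderiv_fun_add ((Φ.contDiff_pull f).differentiable (by simp) p)
      ((Φ.contDiff_pull h).differentiable (by simp) p)
    simp only [map_add]
    rw [this]
    rfl
  map_smul' r f := by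
    have := fderiv_fun_const_smul ((Φ.contDiff_pull f).differentiable (by simp) p) r
    simp only [map_smul]
    rw [this]
    rfl

theorem isDerivAlong_pullDeriv (Φ : Multiplet n M L P) (p v : P) :
    IsDerivAlong (Φ.pull p) (Φ.pullDeriv p v) := by
  intro f h
  change fderiv ℝ (fun q => Φ.pull q (f * h)) p v = Φ.pull p f * fderiv ℝ (fun q => Φ.pull q h) p v
    + Φ.pull p h * fderiv ℝ (fun q => Φ.pull q f) p v
  simp only [map_mul]
  rw [fderiv_gmul ((Φ.contDiff_pull f).differentiable (by simp) p)
    ((Φ.contDiff_pull h).differentiable (by simp) p), add_comm, even_comm (Φ.pull_even p h)]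

theorem chartEval_pullDeriv (hp : Φ.InChart c p) (hT : SmoothNear T (Φ.pos c p)) (v : P) :
    chartEval (Φ.pullDeriv p v) (Φ.body p) c T = fderiv ℝ (Φ.cf c T) p v := by
  obtain ⟨f, hf⟩ := exists_lift_near hp hT
  rw [chartEval_eq ((Φ.isDerivAlong_pullDeriv p v).isLocalAt (Φ.isPointOver p)) hf.self_of_nhds]
  have h : (fun q => Φ.pull q f) =ᶠ[𝓝 p] Φ.cf c T :=
    hf.mono fun q hq => (chartEval_eq (Φ.isPointOver q).isLocalAt hq).symm
  change fderiv ℝ (fun q => Φ.pull q f) p v = _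
  rw [h.fderiv_eq]

/-- Differentiating `u` in a direction gives a derivation along `u`, so the chain rule
`chartEval_deriv` applies to it. -/
theorem fderiv_cf (hp : Φ.InChart c p) (hT : SmoothNear T (Φ.pos c p)) (v : P) :
    fderiv ℝ (Φ.cf c T) p v = ∑ i, Φ.cf c (partialDeriv i T) p * Φ.dc c v p i := by
  rw [← chartEval_pullDeriv hp hT, chartEval_deriv hp (Φ.isPointOver p)
    (Φ.isDerivAlong_pullDeriv p v) hT]
  refine Finset.sum_congr rfl fun i _ => ?_
  rw [chartEval_pullDeriv hp (smoothNear_coord i _)]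
  rfl

theorem cf_congr (hp : Φ.InChart c p) (h : S =ᶠ[𝓝 (Φ.pos c p)] T) : Φ.cf c S p = Φ.cf c T p :=
  chartEval_congr _ hp h

theorem cf_add (hp : Φ.InChart c p) (hS : SmoothNear S (Φ.pos c p))
    (hT : SmoothNear T (Φ.pos c p)) :
    Φ.cf c (fun x => S x + T x) p = Φ.cf c S p + Φ.cf c T p :=
  chartEval_add hp (Φ.isPointOver p).isLocalAt hS hT

theorem cf_neg (hp : Φ.InChart c p) (hT : SmoothNear T (Φ.pos c p)) :
    Φ.cf c (fun x => - T x) p = - Φ.cf c T p := by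
  have := chartEval_smul hp (Φ.isPointOver p).isLocalAt (-1) hT
  simp only [neg_one_mul] at this
  exact this.trans (neg_one_smul ℝ _)

theorem cf_sub (hp : Φ.InChart c p) (hS : SmoothNear S (Φ.pos c p))
    (hT : SmoothNear T (Φ.pos c p)) :
    Φ.cf c (fun x => S x - T x) p = Φ.cf c S p - Φ.cf c T p := by
  simp only [sub_eq_add_neg]
  rw [cf_add hp hS hT.neg, cf_neg hp hT]

theorem cf_mul (hp : Φ.InChart c p) (hS : SmoothNear S (Φ.pos c p))
    (hT : SmoothNear T (Φ.pos c p)) :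
    Φ.cf c (fun x => S x * T x) p = Φ.cf c S p * Φ.cf c T p :=
  chartEval_mul hp (Φ.isPointOver p) hS hT

theorem cf_sum (hp : Φ.InChart c p) {ι : Type*} (s : Finset ι) {T : ι → Eucl n → ℝ}
    (hT : ∀ i, SmoothNear (T i) (Φ.pos c p)) :
    Φ.cf c (fun x => ∑ i ∈ s, T i x) p = ∑ i ∈ s, Φ.cf c (T i) p :=
  chartEval_sum hp (Φ.isPointOver p).isLocalAt s hT

theorem cf_even (hp : Φ.InChart c p) (hT : SmoothNear T (Φ.pos c p)) :
    Φ.cf c T p ∈ evenPart L := chartEval_even hp (Φ.isPointOver p) hT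

theorem cf_central (hp : Φ.InChart c p) (hT : SmoothNear T (Φ.pos c p)) :
    IsCentral (Φ.cf c T p) := even_comm (cf_even hp hT)

theorem dc_even (hp : Φ.InChart c p) (v : P) (i : Fin n) : Φ.dc c v p i ∈ evenPart L :=
  fderiv_mem _ (hp.eventually.mono fun _ hq => cf_even hq (smoothNear_coord i _))
    (smoothNear_cf hp (smoothNear_coord i _)).differentiableAt v

theorem dc_central (hp : Φ.InChart c p) (v : P) (i : Fin n) : IsCentral (Φ.dc c v p i) :=
  even_comm (dc_even hp v i)

theorem secSmooth_dc (hp : Φ.InChart c p) (v : P) : SecSmooth (Φ.dc c v) p :=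
  fun i => (smoothNear_cf hp (smoothNear_coord i _)).fderiv_apply v

theorem comp_mem {D : P → SmoothFun n M →ₗ[ℝ] Grassmann L} (hp : Φ.InChart c p)
    (hD : ∀ q, IsDerivAlong (Φ.pull q) (D q)) {S : Submodule ℝ (Grassmann L)}
    (hS : ∀ f, D p f ∈ S) (i : Fin n) : Φ.comp c D p i ∈ S := by
  obtain ⟨f, hf⟩ := exists_lift_near hp (smoothNear_coord i _)
  unfold comp
  rw [chartEval_eq ((hD p).isLocalAt (Φ.isPointOver p)) hf.self_of_nhds]
  exact hS f

variable (g : Metric n M)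

/-- The coefficients of the metric along `u`. -/
def metricCoeff (Φ : Multiplet n M L P) (c : M) (p : P) (i j : Fin n) : Grassmann L :=
  Φ.cf c (fun x => gram g c x i j) p

/-- The coefficients of the lowered curvature along `u`. -/
def curvCoeff (Φ : Multiplet n M L P) (c : M) (p : P) (l i j k : Fin n) : Grassmann L :=
  Φ.cf c (rlow g c l i j k) p

/-- The connection matrix of `u^*TM` in the direction `v`. -/
def conn (Φ : Multiplet n M L P) (c : M) (v p : P) (l j : Fin n) : Grassmann L :=
  ∑ i, Φ.cf c (christoffel g c l i j) p * Φ.dc c v p i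

/-- The covariant derivative of a section in the direction `v`. -/
def nab (Φ : Multiplet n M L P) (c : M) (v : P) (Y : Sec n L P) : Sec n L P := fun p l =>
  fderiv ℝ (fun q => Y q l) p v
    + ∑ i, ∑ j, Φ.cf c (christoffel g c l i j) p * Φ.dc c v p i * Y p j

/-- The curvature `R(X, Y) Z`. -/
def curvSec (Φ : Multiplet n M L P) (c : M) (X Y Z : Sec n L P) : Sec n L P := fun p l =>
  ∑ i, ∑ j, ∑ k, Φ.cf c (riemann g c l i j k) p * X p i * Y p j * Z p k

theorem nab_eq (Φ : Multiplet n M L P) (c : M) (v : P) (Y : Sec n L P) (p : P) (l : Fin n) :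
    Φ.nab g c v Y p l = fderiv ℝ (fun q => Y q l) p v + ∑ j, Φ.conn g c v p l j * Y p j := by
  simp only [nab, conn, Finset.sum_mul]
  rw [Finset.sum_comm]

theorem smoothNear_gram (hp : Φ.InChart c p) (i j : Fin n) :
    SmoothNear (fun x => gram g c x i j) (Φ.pos c p) := mSmooth_gram g hp.target i j

theorem smoothNear_conn (hp : Φ.InChart c p) (v : P) (l j : Fin n) :
    SmoothNear (fun q => Φ.conn g c v q l j) p :=
  SmoothNear.sum fun i _ => (smoothNear_cf hp
    (smoothNear_christoffel g hp.target l i j)).gmul (secSmooth_dc hp v i)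

theorem secSmooth_nab (hp : Φ.InChart c p) (v : P) {Y : Sec n L P} (hY : SecSmooth Y p) :
    SecSmooth (Φ.nab g c v Y) p := by
  intro l
  simp only [nab_eq]
  exact ((hY l).fderiv_apply v).add (SmoothNear.sum fun j _ => (smoothNear_conn g hp v l j).gmul (hY j))

theorem conn_central (hp : Φ.InChart c p) (v : P) (l j : Fin n) :
    IsCentral (Φ.conn g c v p l j) :=
  even_comm (Submodule.sum_mem _ fun i _ =>
    even_mul_even (cf_even hp (smoothNear_christoffel g hp.target l i j)) (dc_even hp v i))

theorem conn_even (hp : Φ.InChart c p) (v : P) (l j : Fin n) :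
    Φ.conn g c v p l j ∈ evenPart L :=
  Submodule.sum_mem _ fun i _ =>
    even_mul_even (cf_even hp (smoothNear_christoffel g hp.target l i j)) (dc_even hp v i)

theorem nab_odd (hp : Φ.InChart c p) (v : P) {Y : Sec n L P} (hY : SecSmooth Y p)
    (he : ∀ᶠ q in 𝓝 p, ∀ i, Y q i ∈ oddPart L) (l : Fin n) :
    Φ.nab g c v Y p l ∈ oddPart L := by
  rw [nab_eq]
  exact add_mem (fderiv_mem _ (he.mono fun q hq => hq l) (hY l).differentiableAt v)
    (Submodule.sum_mem _ fun j _ => even_mul_odd (conn_even g hp v l j) (he.self_of_nhds j))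

theorem metricCoeff_central (hp : Φ.InChart c p) (i j : Fin n) :
    IsCentral (Φ.metricCoeff g c p i j) := cf_central hp (smoothNear_gram g hp i j)

theorem metricCoeff_symm (Φ : Multiplet n M L P) (c : M) (p : P) (i j : Fin n) :
    Φ.metricCoeff g c p i j = Φ.metricCoeff g c p j i := by
  unfold metricCoeff
  simp only [gram_symm g i j]

/-- The classical metric compatibility evaluated along `u`: evaluation respects sums and products,
and the chain rule contracts the direction with the derivative of `u`. -/
theorem fderiv_metricCoeff (hp : Φ.InChart c p) (v : P) (i j : Fin n) :
    fderiv ℝ (fun q => Φ.metricCoeff g c q i j) p v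
      = ∑ l, (Φ.conn g c v p l i * Φ.metricCoeff g c p l j
        + Φ.metricCoeff g c p i l * Φ.conn g c v p l j) := by
  have hG := fun i j => smoothNear_gram g hp i j
  have hC := smoothNear_christoffel g hp.target
  have h1 : ∀ k, Φ.cf c (partialDeriv k fun x => gram g c x i j) p
      = ∑ l, (Φ.cf c (christoffel g c l k i) p * Φ.metricCoeff g c p l j
        + Φ.metricCoeff g c p i l * Φ.cf c (christoffel g c l k j) p) := by
    intro k
    have h2 : (partialDeriv k fun x => gram g c x i j) =ᶠ[𝓝 (Φ.pos c p)] fun x =>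
        ∑ l, (christoffel g c l k i x * gram g c x l j + gram g c x i l * christoffel g c l k j x) := by
      filter_upwards [(isOpen_extChartAt_target c).mem_nhds hp.target] with x hx
      have := congrFun (congrFun (mpd_gram g hx k) i) j
      simp only [Matrix.add_apply, Matrix.mul_apply, Matrix.transpose_apply] at this
      rw [Finset.sum_add_distrib]
      exact this
    rw [cf_congr hp h2, cf_sum hp _ fun l => ((hC l k i).mul (hG l j)).add ((hG i l).mul (hC l k j))]
    refine Finset.sum_congr rfl fun l _ => ?_
    rw [cf_add hp ((hC l k i).mul (hG l j)) ((hG i l).mul (hC l k j)), cf_mul hp (hC l k i) (hG l j),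
      cf_mul hp (hG i l) (hC l k j)]
    rfl
  refine (fderiv_cf hp (hG i j) v).trans ?_
  simp only [h1, conn, Finset.sum_mul, Finset.mul_sum, ← Finset.sum_add_distrib]
  rw [Finset.sum_comm]
  refine Finset.sum_congr rfl fun l _ => Finset.sum_congr rfl fun k _ => ?_
  rw [add_mul, mul_assoc, metricCoeff_central g hp l j, mul_assoc, mul_assoc]

/-- The pull-back of the Levi-Civita connection is metric. -/
theorem fderiv_inner (hp : Φ.InChart c p) (v : P) {X Y : Sec n L P} (hX : SecSmooth X p)
    (hY : SecSmooth Y p) :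
    fderiv ℝ (fun q => bilin (Φ.metricCoeff g c q) (X q) (Y q)) p v
      = bilin (Φ.metricCoeff g c p) (Φ.nab g c v X p) (Y p)
        + bilin (Φ.metricCoeff g c p) (X p) (Φ.nab g c v Y p) := by
  have hG : ∀ i j, SmoothNear (fun q => Φ.metricCoeff g c q i j) p := fun i j =>
    smoothNear_cf hp (smoothNear_gram g hp i j)
  have h1 : ∀ i j, fderiv ℝ (fun q => Φ.metricCoeff g c q i j * X q i * Y q j) p v
      = (fderiv ℝ (fun q => Φ.metricCoeff g c q i j) p v * X p i
        + Φ.metricCoeff g c p i j * fderiv ℝ (fun q => X q i) p v) * Y p j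
        + Φ.metricCoeff g c p i j * X p i * fderiv ℝ (fun q => Y q j) p v := by
    intro i j
    rw [fderiv_gmul ((hG i j).gmul (hX i)).differentiableAt (hY j).differentiableAt,
      fderiv_gmul (hG i j).differentiableAt (hX i).differentiableAt]
  have h2 : fderiv ℝ (fun q => bilin (Φ.metricCoeff g c q) (X q) (Y q)) p v
      = ∑ i, ∑ j, fderiv ℝ (fun q => Φ.metricCoeff g c q i j * X q i * Y q j) p v := by
    simp only [bilin]
    rw [fderiv_fun_sum fun i _ => (SmoothNear.sum fun j _ =>
      ((hG i j).gmul (hX i)).gmul (hY j)).differentiableAt]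
    rw [_root_.sum_apply]
    refine Finset.sum_congr rfl fun i _ => ?_
    rw [fderiv_fun_sum fun j _ => (((hG i j).gmul (hX i)).gmul (hY j)).differentiableAt,
      _root_.sum_apply]
  rw [h2]
  simp only [h1]
  have h3 := bilin_leibniz (G := Φ.metricCoeff g c p) (X := X p) (Y := Y p)
    (dX := fun i => fderiv ℝ (fun q => X q i) p v) (dY := fun i => fderiv ℝ (fun q => Y q i) p v)
    (conn_central g hp v) (fderiv_metricCoeff g hp v)
  rw [h3]
  congr 2 <;>
  · funext l
    rw [nab_eq]

end Fields

end Multiplet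

/-! ### Curvature along `u` -/

section LoweredCurvature

variable {n : ℕ} {M : Type*} [TopologicalSpace M] [ChartedSpace (Eucl n) M]
  [IsManifold (𝓡 n) ∞ M] (g : Metric n M) {c : M} {x : Eucl n}

theorem smoothNear_rlow (hx : x ∈ (extChartAt (𝓡 n) c).target) (l i j k : Fin n) :
    SmoothNear (rlow g c l i j k) x :=
  SmoothNear.sum fun m _ => (mSmooth_gram g hx l m).mul (smoothNear_riemann g hx m i j k)

/-- In the derivative of G R, the term G Γ R from the derivative of the metric cancels the term from
the raised index in ∇R = 0. What remains is one connection term for each of the four lowered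
indices. -/
theorem partialDeriv_rlow (hR : ParallelCurvature g) (hx : x ∈ (extChartAt (𝓡 n) c).target)
    (m l i j k : Fin n) : partialDeriv m (rlow g c l i j k) x
      = ∑ a, (christoffel g c a m l x * rlow g c a i j k x
        + christoffel g c a m i x * rlow g c l a j k x
        + christoffel g c a m j x * rlow g c l i a k x
        + christoffel g c a m k x * rlow g c l i j a x) := by
  have h1 : mpd m (fun y => gram g c y * rmat g c i j y) x
      = (cmat g c m x).transpose * (gram g c x * rmat g c i j x)
        + ∑ a, christoffel g c a m i x • (gram g c x * rmat g c a j x)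
        + ∑ a, christoffel g c a m j x • (gram g c x * rmat g c i a x)
        + gram g c x * rmat g c i j x * cmat g c m x := by
    rw [mpd_mul m (mSmooth_gram g hx) (mSmooth_rmat g hx i j), mpd_gram g hx, mpd_rmat g hR hx]
    simp only [Matrix.mul_add, Matrix.mul_sub, Matrix.add_mul, Matrix.mul_sum, Matrix.mul_smul,
      Matrix.mul_assoc]
    abel
  have h2 := congrFun (congrFun h1 l) k
  simp only [Matrix.add_apply, Matrix.sum_apply, Matrix.smul_apply, smul_eq_mul] at h2
  refine h2.trans ?_
  simp only [Finset.sum_add_distrib]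
  congr 1
  rw [Matrix.mul_apply]
  exact Finset.sum_congr rfl fun a _ => mul_comm _ _

end LoweredCurvature

namespace Multiplet

section Curvature

variable {n : ℕ} {M : Type*} [TopologicalSpace M] [ChartedSpace (Eucl n) M] {L : ℕ}
  {P : Type*} [NormedAddCommGroup P] [NormedSpace ℝ P] {Φ : Multiplet n M L P} {c : M}
  [IsManifold (𝓡 n) ∞ M] [T2Space M] {p : P} (g : Metric n M)

/-- The pull-back of the Levi-Civita connection is torsion-free. -/
theorem nab_dc_comm (hp : Φ.InChart c p) (v w : P) :
    Φ.nab g c v (Φ.dc c w) p = Φ.nab g c w (Φ.dc c v) p := by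
  funext l
  unfold nab
  congr 1
  · exact (smoothNear_cf hp (smoothNear_coord l _)).fderiv_comm _ _
  · rw [Finset.sum_comm]
    refine Finset.sum_congr rfl fun i _ => Finset.sum_congr rfl fun j _ => ?_
    rw [christoffel_symm, mul_assoc, dc_central hp v j, ← mul_assoc]

/-- The structure equation for the pulled-back connection form. The second derivatives of the
coordinates of `u` cancel, and evenness of the derivatives of `u` lets the remaining factors be
reordered without signs. -/
theorem curvature_conn (hp : Φ.InChart c p) (v w : P) (l j : Fin n) :
    fderiv ℝ (fun q => Φ.conn g c w q l j) p v - fderiv ℝ (fun q => Φ.conn g c v q l j) p w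
      + ∑ m, (Φ.conn g c v p l m * Φ.conn g c w p m j - Φ.conn g c w p l m * Φ.conn g c v p m j)
      = ∑ i, ∑ k, Φ.cf c (riemann g c l i k j) p * Φ.dc c v p i * Φ.dc c w p k := by
  have hC := smoothNear_christoffel g hp.target
  have hcf := fun k i j => smoothNear_cf hp (hC k i j)
  have hd : ∀ v w, fderiv ℝ (fun q => Φ.conn g c w q l j) p v
      = ∑ k, ((∑ i, Φ.cf c (partialDeriv i (christoffel g c l k j)) p * Φ.dc c v p i)
          * Φ.dc c w p k + Φ.cf c (christoffel g c l k j) p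
            * fderiv ℝ (fun q => Φ.dc c w q k) p v) := by
    intro v w
    unfold conn
    rw [fderiv_fun_sum fun k _ => ((hcf l k j).gmul (secSmooth_dc hp w k)).differentiableAt,
      _root_.sum_apply]
    refine Finset.sum_congr rfl fun k _ => ?_
    rw [fderiv_gmul (hcf l k j).differentiableAt (secSmooth_dc hp w k).differentiableAt,
      ← fderiv_cf hp (hC l k j)]
  have hsymm : ∀ k, fderiv ℝ (fun q => Φ.dc c w q k) p v = fderiv ℝ (fun q => Φ.dc c v q k) p w :=
    fun k => (smoothNear_cf hp (smoothNear_coord k _)).fderiv_comm _ _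
  have hR : ∀ i k, Φ.cf c (riemann g c l i k j) p
      = Φ.cf c (partialDeriv i (christoffel g c l k j)) p
        - Φ.cf c (partialDeriv k (christoffel g c l i j)) p
        + ∑ m, (Φ.cf c (christoffel g c l i m) p * Φ.cf c (christoffel g c m k j) p
          - Φ.cf c (christoffel g c l k m) p * Φ.cf c (christoffel g c m i j) p) := by
    intro i k
    have h1 := smoothNear_partialDeriv i (hC l k j)
    have h2 := smoothNear_partialDeriv k (hC l i j)
    have h3 : ∀ m, SmoothNear (fun x => christoffel g c l i m x * christoffel g c m k j x
        - christoffel g c l k m x * christoffel g c m i j x) (Φ.pos c p) := fun m =>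
      ((hC l i m).mul (hC m k j)).sub ((hC l k m).mul (hC m i j))
    unfold riemann
    rw [cf_add hp (h1.sub h2) (SmoothNear.sum fun m _ => h3 m), cf_sub hp h1 h2, cf_sum hp _ h3]
    congr 1
    refine Finset.sum_congr rfl fun m _ => ?_
    rw [cf_sub hp ((hC l i m).mul (hC m k j)) ((hC l k m).mul (hC m i j)),
      cf_mul hp (hC l i m) (hC m k j), cf_mul hp (hC l k m) (hC m i j)]
  have hprod : ∀ v w, ∑ m, Φ.conn g c v p l m * Φ.conn g c w p m j
      = ∑ i, ∑ k, (∑ m, Φ.cf c (christoffel g c l i m) p * Φ.cf c (christoffel g c m k j) p)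
        * Φ.dc c v p i * Φ.dc c w p k := by
    intro v w
    simp only [conn, Finset.sum_mul, Finset.mul_sum]
    have : ∀ f : Fin n → Fin n → Fin n → Grassmann L, ∑ m, ∑ k, ∑ i, f m k i
        = ∑ i, ∑ k, ∑ m, f m k i := fun f => by
      calc _ = ∑ m, ∑ i, ∑ k, f m k i := Finset.sum_congr rfl fun m _ => Finset.sum_comm
        _ = ∑ i, ∑ m, ∑ k, f m k i := Finset.sum_comm
        _ = _ := Finset.sum_congr rfl fun m _ => Finset.sum_comm
    rw [this]
    refine Finset.sum_congr rfl fun i _ => Finset.sum_congr rfl fun k _ =>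
      Finset.sum_congr rfl fun m _ => ?_
    rw [mul_assoc, ← mul_assoc (Φ.dc c v p i), dc_central hp v i]
    simp only [mul_assoc]
  have hsw : ∀ f : Fin n → Fin n → Grassmann L, ∑ i, ∑ k, f i k * Φ.dc c w p i * Φ.dc c v p k
      = ∑ i, ∑ k, f k i * Φ.dc c v p i * Φ.dc c w p k := fun f => by
    rw [Finset.sum_comm]
    refine Finset.sum_congr rfl fun i _ => Finset.sum_congr rfl fun k _ => ?_
    rw [mul_assoc, dc_central hp w k, ← mul_assoc]
  have hsw' : ∀ f : Fin n → Fin n → Grassmann L, ∑ k, ∑ i, f i k * Φ.dc c w p i * Φ.dc c v p k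
      = ∑ i, ∑ k, f k i * Φ.dc c v p i * Φ.dc c w p k := fun f => by
    rw [Finset.sum_comm, hsw]
  rw [Finset.sum_sub_distrib, hprod, hprod, hd, hd, hsw]
  simp only [Finset.sum_add_distrib, hsymm, hR, add_mul, sub_mul, Finset.sum_mul,
    Finset.sum_sub_distrib]
  rw [hsw' fun i k => Φ.cf c (partialDeriv i (christoffel g c l k j)) p]
  rw [Finset.sum_comm (f := fun k i => Φ.cf c (partialDeriv i (christoffel g c l k j)) p
    * Φ.dc c v p i * Φ.dc c w p k)]
  abel

/-- The curvature of the pull-back connection. -/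
theorem nab_nab_sub (hp : Φ.InChart c p) (v w : P) {Y : Sec n L P} (hY : SecSmooth Y p)
    (l : Fin n) : Φ.nab g c v (Φ.nab g c w Y) p l - Φ.nab g c w (Φ.nab g c v Y) p l
      = Φ.curvSec g c (Φ.dc c v) (Φ.dc c w) Y p l := by
  have hC := smoothNear_conn g hp
  have hd : ∀ v w, Φ.nab g c v (Φ.nab g c w Y) p l
      = fderiv ℝ (fun q => fderiv ℝ (fun q => Y q l) q w) p v
        + ∑ j, (fderiv ℝ (fun q => Φ.conn g c w q l j) p v * Y p j
          + Φ.conn g c w p l j * fderiv ℝ (fun q => Y q j) p v)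
        + ∑ m, Φ.conn g c v p l m * (fderiv ℝ (fun q => Y q m) p w
          + ∑ j, Φ.conn g c w p m j * Y p j) := by
    intro v w
    rw [nab_eq]
    simp only [nab_eq]
    congr 1
    rw [fderiv_fun_add ((hY l).fderiv_apply w).differentiableAt
      (SmoothNear.sum fun j _ => (hC w l j).gmul (hY j)).differentiableAt, _root_.add_apply]
    congr 1
    rw [fderiv_fun_sum fun j _ => ((hC w l j).gmul (hY j)).differentiableAt, _root_.sum_apply]
    refine Finset.sum_congr rfl fun j _ => ?_
    rw [fderiv_gmul (hC w l j).differentiableAt (hY j).differentiableAt]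
  have hcurv : Φ.curvSec g c (Φ.dc c v) (Φ.dc c w) Y p l
      = ∑ j, (∑ i, ∑ k, Φ.cf c (riemann g c l i k j) p * Φ.dc c v p i * Φ.dc c w p k) * Y p j := by
    simp only [curvSec, Finset.sum_mul]
    have : ∀ f : Fin n → Fin n → Fin n → Grassmann L, ∑ i, ∑ k, ∑ j, f i k j
        = ∑ j, ∑ i, ∑ k, f i k j := fun f => by
      calc _ = ∑ i, ∑ j, ∑ k, f i k j := Finset.sum_congr rfl fun m _ => Finset.sum_comm
        _ = _ := Finset.sum_comm
    exact this _
  rw [hcurv, hd v w, hd w v, (hY l).fderiv_comm w v]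
  simp only [← curvature_conn g hp, mul_add, Finset.mul_sum, add_mul, sub_mul, Finset.sum_mul,
    Finset.sum_add_distrib, Finset.sum_sub_distrib, ← mul_assoc]
  rw [Finset.sum_comm (f := fun m j => Φ.conn g c v p l m * Φ.conn g c w p m j * Y p j),
    Finset.sum_comm (f := fun m j => Φ.conn g c w p l m * Φ.conn g c v p m j * Y p j)]
  abel

theorem curvCoeff_central (hp : Φ.InChart c p) (l i j k : Fin n) :
    IsCentral (Φ.curvCoeff g c p l i j k) := cf_central hp (smoothNear_rlow g hp.target l i j k)

theorem curvCoeff_antisymm₁ (hp : Φ.InChart c p) (l i j k : Fin n) :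
    Φ.curvCoeff g c p l i j k = - Φ.curvCoeff g c p l j i k := by
  unfold curvCoeff
  rw [← cf_neg hp (smoothNear_rlow g hp.target l j i k)]
  exact congrArg (fun T => Φ.cf c T p) (funext fun _ => rlow_antisymm₁ g l i j k)

theorem eventually_target (hp : Φ.InChart c p) :
    ∀ᶠ x in 𝓝 (Φ.pos c p), x ∈ (extChartAt (𝓡 n) c).target :=
  (isOpen_extChartAt_target c).mem_nhds hp.target

theorem curvCoeff_antisymm₂ (hp : Φ.InChart c p) (l i j k : Fin n) :
    Φ.curvCoeff g c p l i j k = - Φ.curvCoeff g c p k i j l := by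
  unfold curvCoeff
  rw [← cf_neg hp (smoothNear_rlow g hp.target k i j l)]
  exact cf_congr hp ((eventually_target hp).mono fun _ hx => rlow_antisymm₂ g hx l i j k)

theorem curvCoeff_pair (hp : Φ.InChart c p) (l i j k : Fin n) :
    Φ.curvCoeff g c p l i j k = Φ.curvCoeff g c p j k l i :=
  cf_congr hp ((eventually_target hp).mono fun _ hx => rlow_pair g hx l i j k)

theorem curvCoeff_bianchi (hp : Φ.InChart c p) (l i j k : Fin n) :
    Φ.curvCoeff g c p l i j k + Φ.curvCoeff g c p l j k i + Φ.curvCoeff g c p l k i j = 0 := by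
  have hs := smoothNear_rlow g hp.target
  unfold curvCoeff
  rw [← cf_add hp (hs l i j k) (hs l j k i),
    ← cf_add hp ((hs l i j k).add (hs l j k i)) (hs l k i j)]
  simp only [rlow_bianchi]
  exact (chartEval_const (Φ.isPointOver p) 0).trans (map_zero _)

/-- The lowered curvature along `u` is parallel. -/
theorem fderiv_curvCoeff (hR : ParallelCurvature g) (hp : Φ.InChart c p) (v : P)
    (l i j k : Fin n) : fderiv ℝ (fun q => Φ.curvCoeff g c q l i j k) p v
      = ∑ a, (Φ.conn g c v p a l * Φ.curvCoeff g c p a i j k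
        + Φ.conn g c v p a i * Φ.curvCoeff g c p l a j k
        + Φ.conn g c v p a j * Φ.curvCoeff g c p l i a k
        + Φ.conn g c v p a k * Φ.curvCoeff g c p l i j a) := by
  have hs := smoothNear_rlow g hp.target
  have hC := smoothNear_christoffel g hp.target
  have h1 : ∀ m, Φ.cf c (partialDeriv m (rlow g c l i j k)) p
      = ∑ a, (Φ.cf c (christoffel g c a m l) p * Φ.curvCoeff g c p a i j k
        + Φ.cf c (christoffel g c a m i) p * Φ.curvCoeff g c p l a j k
        + Φ.cf c (christoffel g c a m j) p * Φ.curvCoeff g c p l i a k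
        + Φ.cf c (christoffel g c a m k) p * Φ.curvCoeff g c p l i j a) := by
    intro m
    rw [cf_congr hp ((eventually_target hp).mono fun _ hx => partialDeriv_rlow g hR hx m l i j k)]
    have e1 := fun a => (hC a m l).mul (hs a i j k)
    have e2 := fun a => (hC a m i).mul (hs l a j k)
    have e3 := fun a => (hC a m j).mul (hs l i a k)
    have e4 := fun a => (hC a m k).mul (hs l i j a)
    rw [cf_sum hp _ fun a => (((e1 a).add (e2 a)).add (e3 a)).add (e4 a)]
    refine Finset.sum_congr rfl fun a _ => ?_
    rw [cf_add hp (((e1 a).add (e2 a)).add (e3 a)) (e4 a), cf_add hp ((e1 a).add (e2 a)) (e3 a),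
      cf_add hp (e1 a) (e2 a), cf_mul hp (hC a m l) (hs a i j k),
      cf_mul hp (hC a m i) (hs l a j k), cf_mul hp (hC a m j) (hs l i a k),
      cf_mul hp (hC a m k) (hs l i j a)]
    rfl
  refine (fderiv_cf hp (hs l i j k) v).trans ?_
  simp only [h1, conn, Finset.sum_mul, ← Finset.sum_add_distrib]
  rw [Finset.sum_comm]
  refine Finset.sum_congr rfl fun a _ => Finset.sum_congr rfl fun m _ => ?_
  simp only [add_mul, mul_assoc]
  rw [curvCoeff_central g hp a i j k, curvCoeff_central g hp l a j k,
    curvCoeff_central g hp l i a k, curvCoeff_central g hp l i j a]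

/-- Here parallel curvature enters the variation: there is no extra term in which the curvature
tensor itself is differentiated. -/
theorem fderiv_quad (hR : ParallelCurvature g) (hp : Φ.InChart c p) (v : P)
    {X Y Z W : Sec n L P} (hX : SecSmooth X p) (hY : SecSmooth Y p) (hZ : SecSmooth Z p)
    (hW : SecSmooth W p) :
    fderiv ℝ (fun q => quad (Φ.curvCoeff g c q) (X q) (Y q) (Z q) (W q)) p v
      = quad (Φ.curvCoeff g c p) (Φ.nab g c v X p) (Y p) (Z p) (W p)
        + quad (Φ.curvCoeff g c p) (X p) (Φ.nab g c v Y p) (Z p) (W p)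
        + quad (Φ.curvCoeff g c p) (X p) (Y p) (Φ.nab g c v Z p) (W p)
        + quad (Φ.curvCoeff g c p) (X p) (Y p) (Z p) (Φ.nab g c v W p) := by
  have hG : ∀ l i j k, SmoothNear (fun q => Φ.curvCoeff g c q l i j k) p := fun l i j k =>
    smoothNear_cf hp (smoothNear_rlow g hp.target l i j k)
  have s1 := fun l i j k => (hG l i j k).gmul (hX l)
  have s2 := fun l i j k => (s1 l i j k).gmul (hY i)
  have s3 := fun l i j k => (s2 l i j k).gmul (hZ j)
  have s4 := fun l i j k => (s3 l i j k).gmul (hW k)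
  have h2 : fderiv ℝ (fun q => quad (Φ.curvCoeff g c q) (X q) (Y q) (Z q) (W q)) p v
      = ∑ l, ∑ i, ∑ j, ∑ k, fderiv ℝ (fun q =>
        Φ.curvCoeff g c q l i j k * X q l * Y q i * Z q j * W q k) p v := by
    simp only [quad]
    rw [fderiv_fun_sum fun l _ => (SmoothNear.sum fun i _ => SmoothNear.sum fun j _ =>
      SmoothNear.sum fun k _ => s4 l i j k).differentiableAt, _root_.sum_apply]
    refine Finset.sum_congr rfl fun l _ => ?_
    rw [fderiv_fun_sum fun i _ => (SmoothNear.sum fun j _ =>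
      SmoothNear.sum fun k _ => s4 l i j k).differentiableAt, _root_.sum_apply]
    refine Finset.sum_congr rfl fun i _ => ?_
    rw [fderiv_fun_sum fun j _ => (SmoothNear.sum fun k _ => s4 l i j k).differentiableAt,
      _root_.sum_apply]
    refine Finset.sum_congr rfl fun j _ => ?_
    rw [fderiv_fun_sum fun k _ => (s4 l i j k).differentiableAt, _root_.sum_apply]
  rw [h2]
  have h1 : ∀ l i j k, fderiv ℝ (fun q =>
        Φ.curvCoeff g c q l i j k * X q l * Y q i * Z q j * W q k) p v
      = (((fderiv ℝ (fun q => Φ.curvCoeff g c q l i j k) p v * X p l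
        + Φ.curvCoeff g c p l i j k * fderiv ℝ (fun q => X q l) p v) * Y p i
        + Φ.curvCoeff g c p l i j k * X p l * fderiv ℝ (fun q => Y q i) p v) * Z p j
        + Φ.curvCoeff g c p l i j k * X p l * Y p i * fderiv ℝ (fun q => Z q j) p v) * W p k
        + Φ.curvCoeff g c p l i j k * X p l * Y p i * Z p j * fderiv ℝ (fun q => W q k) p v := by
    intro l i j k
    rw [fderiv_gmul (s3 l i j k).differentiableAt (hW k).differentiableAt,
      fderiv_gmul (s2 l i j k).differentiableAt (hZ j).differentiableAt,
      fderiv_gmul (s1 l i j k).differentiableAt (hY i).differentiableAt,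
      fderiv_gmul (hG l i j k).differentiableAt (hX l).differentiableAt]
  simp only [h1]
  rw [quad_leibniz (conn_central g hp v) (fderiv_curvCoeff g hR hp v)]
  have e : ∀ X : Sec n L P, (fun i => fderiv ℝ (fun q => X q i) p v
      + ∑ k, Φ.conn g c v p i k * X p k) = Φ.nab g c v X p := fun X =>
    funext fun l => (nab_eq g Φ c v X p l).symm
  simp only [e]

/-- Lowering an index of the curvature. -/
theorem inner_curvSec (hp : Φ.InChart c p) (X Y Z W : Sec n L P) :
    bilin (Φ.metricCoeff g c p) (X p) (Φ.curvSec g c Y Z W p)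
      = quad (Φ.curvCoeff g c p) (X p) (Y p) (Z p) (W p) := by
  have hs := smoothNear_riemann g hp.target
  have h1 : ∀ l i j k, Φ.curvCoeff g c p l i j k
      = ∑ m, Φ.metricCoeff g c p l m * Φ.cf c (riemann g c m i j k) p := by
    intro l i j k
    unfold curvCoeff rlow
    rw [cf_sum hp _ fun m => (smoothNear_gram g hp l m).mul (hs m i j k)]
    exact Finset.sum_congr rfl fun m _ => cf_mul hp (smoothNear_gram g hp l m) (hs m i j k)
  simp only [bilin, curvSec, quad, h1, Finset.mul_sum, Finset.sum_mul]
  refine Finset.sum_congr rfl fun l _ => ?_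
  rw [Finset.sum_comm]
  refine Finset.sum_congr rfl fun i _ => ?_
  rw [Finset.sum_comm]
  refine Finset.sum_congr rfl fun j _ => ?_
  rw [Finset.sum_comm]
  refine Finset.sum_congr rfl fun k _ => Finset.sum_congr rfl fun m _ => ?_
  have hc := cf_central hp (hs m i j k)
  rw [mul_assoc (Φ.metricCoeff g c p l m) (Φ.cf c (riemann g c m i j k) p), hc (X p l)]
  simp only [mul_assoc]

end Curvature

end Multiplet

/-! ### Independence of the chart -/

section

variable {n : ℕ} {M : Type*} [TopologicalSpace M] [ChartedSpace (Eucl n) M]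
  [IsManifold (𝓡 n) ∞ M] (g : Metric n M) {c c' : M} {x : Eucl n}

/-- The tensor law is written with nested sums, one Jacobian at a time, so that the slot lemmas can
move the Jacobians to the arguments one after the other. -/
theorem rlow_transition (h : InOverlap c c' x) (l i j k : Fin n) :
    rlow g c l i j k x = ∑ a, jac c c' x a l * ∑ b, jac c c' x b i * ∑ d, jac c c' x d j *
      ∑ e, jac c c' x e k * rlow g c' a b d e (transition c c' x) := by
  have h1 : gram g c x * rmat g c i j x = ∑ b, ∑ d, (jac c c' x b i * jac c c' x d j) •
      ((jac c c' x).transpose * (gram g c' (transition c c' x)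
        * rmat g c' b d (transition c c' x)) * jac c c' x) := by
    rw [gram_transition_matrix g h, Matrix.mul_assoc _ (jac c c' x), rmat_transition g h]
    simp only [rmatPull, Matrix.sum_mul, Matrix.mul_sum, Matrix.smul_mul, Matrix.mul_smul,
      Matrix.mul_assoc]
  rw [rlow_eq, h1]
  simp only [Matrix.sum_apply, Matrix.smul_apply, smul_eq_mul]
  simp only [Matrix.mul_apply (M := (jac c c' x).transpose * _), Matrix.mul_apply
    (M := (jac c c' x).transpose), Matrix.transpose_apply, ← rlow_eq, Finset.sum_mul,
    Finset.mul_sum]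
  have e : ∀ f : Fin n → Fin n → Fin n → Fin n → ℝ, ∑ b, ∑ d, ∑ e, ∑ a, f b d e a
      = ∑ a, ∑ b, ∑ d, ∑ e, f b d e a := fun f => by
    rw [sum4_swap₃₄, sum4_swap₂₃, sum4_swap₁₂]
  rw [e]
  refine Finset.sum_congr rfl fun a _ => Finset.sum_congr rfl fun b _ =>
    Finset.sum_congr rfl fun d _ => Finset.sum_congr rfl fun e _ => by ring

end

namespace Multiplet

section ChartChange

variable {n : ℕ} {M : Type*} [TopologicalSpace M] [ChartedSpace (Eucl n) M] {L : ℕ}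
  {P : Type*} [NormedAddCommGroup P] [NormedSpace ℝ P] {Φ : Multiplet n M L P} {c c' : M}
  {p : P}

theorem inOverlap (hp : Φ.InChart c p) (hp' : Φ.InChart c' p) : InOverlap c c' (Φ.pos c p) := by
  refine ⟨hp.target, ?_⟩
  unfold pos
  rw [(extChartAt (𝓡 n) c).left_inv hp]
  exact hp'

theorem chartEval_transition (hp : Φ.InChart c p) (D : SmoothFun n M →ₗ[ℝ] Grassmann L)
    (T : Eucl n → ℝ) : chartEval D (Φ.body p) c' T
      = chartEval D (Φ.body p) c fun x => T (transition c c' x) := by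
  refine germEval_congr D ?_
  filter_upwards [(isOpen_extChartAt_source c).mem_nhds hp] with m hm
  unfold transition
  rw [(extChartAt (𝓡 n) c).left_inv hm]

theorem cf_transition (hp : Φ.InChart c p) (T : Eucl n → ℝ) :
    Φ.cf c' T p = Φ.cf c (fun x => T (transition c c' x)) p :=
  chartEval_transition hp _ T

/-- The Jacobian of the change of charts along `u`. -/
def jacCoeff (Φ : Multiplet n M L P) (c c' : M) (p : P) (a i : Fin n) : Grassmann L :=
  Φ.cf c (fun x => jac c c' x a i) p

/-- The sections `Y` and `Y'` are the expressions of one section of `u^*TM` in the charts at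
`c` and `c'`. -/
def Related (Φ : Multiplet n M L P) (c c' : M) (Y Y' : Sec n L P) (p : P) : Prop :=
  Y' p = fun a => ∑ i, Φ.jacCoeff c c' p a i * Y p i

variable [IsManifold (𝓡 n) ∞ M] [T2Space M]

/-- The chain rule for derivations applied to the components of the transition map. Even though `u`
has nilpotent parts, sections transform by the Jacobian evaluated along `u`. -/
theorem chartEval_deriv_transition (hp : Φ.InChart c p) (hp' : Φ.InChart c' p)
    {D : SmoothFun n M →ₗ[ℝ] Grassmann L} (hD : IsDerivAlong (Φ.pull p) D) (a : Fin n) :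
    chartEval D (Φ.body p) c' (fun x => x a)
      = ∑ i, Φ.jacCoeff c c' p a i * chartEval D (Φ.body p) c (fun x => x i) := by
  rw [chartEval_transition hp, chartEval_deriv hp (Φ.isPointOver p) hD
    (smoothNear_transition_apply (inOverlap hp hp') a)]
  rfl

theorem related_comp (hp : Φ.InChart c p) (hp' : Φ.InChart c' p)
    {D : P → SmoothFun n M →ₗ[ℝ] Grassmann L} (hD : ∀ q, IsDerivAlong (Φ.pull q) (D q)) :
    Φ.Related c c' (Φ.comp c D) (Φ.comp c' D) p :=
  funext fun a => chartEval_deriv_transition hp hp' (hD p) a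

theorem related_dc (hp : Φ.InChart c p) (hp' : Φ.InChart c' p) (v : P) :
    Φ.Related c c' (Φ.dc c v) (Φ.dc c' v) p := by
  funext a
  have h1 := chartEval_deriv_transition hp hp' (Φ.isDerivAlong_pullDeriv p v) a
  rw [chartEval_pullDeriv hp' (smoothNear_coord a _)] at h1
  simp only [chartEval_pullDeriv hp (smoothNear_coord _ _)] at h1
  exact h1

theorem smoothNear_jacCoeff (hp : Φ.InChart c p) (hp' : Φ.InChart c' p) (a i : Fin n) :
    SmoothNear (fun q => Φ.jacCoeff c c' q a i) p :=
  smoothNear_cf hp (smoothNear_jac (inOverlap hp hp') a i)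

theorem jacCoeff_central (hp : Φ.InChart c p) (hp' : Φ.InChart c' p) (a i : Fin n) :
    IsCentral (Φ.jacCoeff c c' p a i) := cf_central hp (smoothNear_jac (inOverlap hp hp') a i)

theorem Related.add {X X' Y Y' : Sec n L P} (hX : Φ.Related c c' X X' p)
    (hY : Φ.Related c c' Y Y' p) :
    Φ.Related c c' (fun q i => X q i + Y q i) (fun q i => X' q i + Y' q i) p := by
  funext a
  simp only [mul_add, Finset.sum_add_distrib]
  rw [← congrFun hX a, ← congrFun hY a]

theorem Related.neg {X X' : Sec n L P} (hX : Φ.Related c c' X X' p) :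
    Φ.Related c c' (fun q i => - X q i) (fun q i => - X' q i) p := by
  funext a
  simp only [mul_neg, Finset.sum_neg_distrib]
  rw [← congrFun hX a]

theorem Related.sub {X X' Y Y' : Sec n L P} (hX : Φ.Related c c' X X' p)
    (hY : Φ.Related c c' Y Y' p) :
    Φ.Related c c' (fun q i => X q i - Y q i) (fun q i => X' q i - Y' q i) p := by
  simpa only [sub_eq_add_neg] using hX.add hY.neg

variable (g : Metric n M)

theorem metricCoeff_transition (hp : Φ.InChart c p) (hp' : Φ.InChart c' p) (i j : Fin n) :
    Φ.metricCoeff g c p i j = ∑ a, ∑ b, Φ.jacCoeff c c' p a i * Φ.metricCoeff g c' p a b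
      * Φ.jacCoeff c c' p b j := by
  have ho := inOverlap hp hp'
  have hJ := smoothNear_jac ho
  have hG : ∀ a b, SmoothNear (fun x => gram g c' (transition c c' x) a b) (Φ.pos c p) :=
    (mSmooth_gram g (transition_mem ho)).comp_transition ho
  have h1 := fun a b => ((hJ a i).mul (hG a b)).mul (hJ b j)
  unfold metricCoeff
  rw [cf_congr hp (ho.eventually.mono fun x hx => gram_transition g hx i j),
    cf_sum hp _ fun a => SmoothNear.sum fun b _ => h1 a b]
  refine Finset.sum_congr rfl fun a _ => ?_
  rw [cf_sum hp _ fun b => h1 a b]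
  refine Finset.sum_congr rfl fun b _ => ?_
  rw [cf_mul hp ((hJ a i).mul (hG a b)) (hJ b j), cf_mul hp (hJ a i) (hG a b),
    cf_transition hp (c' := c') fun x => gram g c' x a b]
  rfl

theorem curvCoeff_transition (hp : Φ.InChart c p) (hp' : Φ.InChart c' p) (l i j k : Fin n) :
    Φ.curvCoeff g c p l i j k = ∑ a, Φ.jacCoeff c c' p a l * ∑ b, Φ.jacCoeff c c' p b i *
      ∑ d, Φ.jacCoeff c c' p d j * ∑ e, Φ.jacCoeff c c' p e k * Φ.curvCoeff g c' p a b d e := by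
  have ho := inOverlap hp hp'
  have hJ := smoothNear_jac ho
  have hρ : ∀ a b d e, SmoothNear (fun x => rlow g c' a b d e (transition c c' x)) (Φ.pos c p) :=
    fun a b d e => SmoothNear.comp (smoothNear_rlow g (transition_mem ho) a b d e)
      (smoothNear_transition ho)
  have s1 := fun a b d e => (hJ e k).mul (hρ a b d e)
  have s2 := fun a b d => (hJ d j).mul (SmoothNear.sum fun e (_ : e ∈ Finset.univ) => s1 a b d e)
  have s3 := fun a b => (hJ b i).mul (SmoothNear.sum fun d (_ : d ∈ Finset.univ) => s2 a b d)
  have s4 := fun a => (hJ a l).mul (SmoothNear.sum fun b (_ : b ∈ Finset.univ) => s3 a b)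
  unfold curvCoeff
  rw [cf_congr hp (ho.eventually.mono fun x hx => rlow_transition g hx l i j k), cf_sum hp _ s4]
  refine Finset.sum_congr rfl fun a _ => ?_
  rw [cf_mul hp (hJ a l) (SmoothNear.sum fun b _ => s3 a b), cf_sum hp _ (s3 a)]
  refine congrArg _ (Finset.sum_congr rfl fun b _ => ?_)
  rw [cf_mul hp (hJ b i) (SmoothNear.sum fun d _ => s2 a b d), cf_sum hp _ (s2 a b)]
  refine congrArg _ (Finset.sum_congr rfl fun d _ => ?_)
  rw [cf_mul hp (hJ d j) (SmoothNear.sum fun e _ => s1 a b d e), cf_sum hp _ (s1 a b d)]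
  refine congrArg _ (Finset.sum_congr rfl fun e _ => ?_)
  rw [cf_mul hp (hJ e k) (hρ a b d e), cf_transition hp (c' := c') (rlow g c' a b d e)]
  rfl

theorem inner_chart (hp : Φ.InChart c p) (hp' : Φ.InChart c' p) {X X' Y Y' : Sec n L P}
    (hX : Φ.Related c c' X X' p) (hY : Φ.Related c c' Y Y' p) :
    bilin (Φ.metricCoeff g c p) (X p) (Y p) = bilin (Φ.metricCoeff g c' p) (X' p) (Y' p) := by
  have h1 : Φ.metricCoeff g c p = fun i j => ∑ a, ∑ b, Φ.jacCoeff c c' p a i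
      * Φ.metricCoeff g c' p a b * Φ.jacCoeff c c' p b j := by
    funext i j
    exact metricCoeff_transition g hp hp' i j
  rw [h1, bilin_change (jacCoeff_central hp hp'), hX, hY]

theorem quad_chart (hp : Φ.InChart c p) (hp' : Φ.InChart c' p) {X X' Y Y' Z Z' W W' : Sec n L P}
    (hX : Φ.Related c c' X X' p) (hY : Φ.Related c c' Y Y' p) (hZ : Φ.Related c c' Z Z' p)
    (hW : Φ.Related c c' W W' p) :
    quad (Φ.curvCoeff g c p) (X p) (Y p) (Z p) (W p)
      = quad (Φ.curvCoeff g c' p) (X' p) (Y' p) (Z' p) (W' p) := by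
  have hJ := jacCoeff_central hp hp'
  have h1 : Φ.curvCoeff g c p = fun l i j k => ∑ a, Φ.jacCoeff c c' p a l *
      ∑ b, Φ.jacCoeff c c' p b i * ∑ d, Φ.jacCoeff c c' p d j *
      ∑ e, Φ.jacCoeff c c' p e k * Φ.curvCoeff g c' p a b d e := by
    funext l i j k
    exact curvCoeff_transition g hp hp' l i j k
  rw [h1, quad_slot₁ (ρ := fun a i j k => ∑ b, Φ.jacCoeff c c' p b i *
      ∑ d, Φ.jacCoeff c c' p d j * ∑ e, Φ.jacCoeff c c' p e k * Φ.curvCoeff g c' p a b d e)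
      _ _ _ _ hJ,
    quad_slot₂ (ρ := fun a b j k => ∑ d, Φ.jacCoeff c c' p d j *
      ∑ e, Φ.jacCoeff c c' p e k * Φ.curvCoeff g c' p a b d e) _ _ _ _ hJ,
    quad_slot₃ (ρ := fun a b d k => ∑ e, Φ.jacCoeff c c' p e k * Φ.curvCoeff g c' p a b d e)
      _ _ _ _ hJ, quad_slot₄ _ _ _ _ hJ, hX, hY, hZ, hW]

/-- The transformation law of the Christoffel symbols, evaluated along `u` and contracted with the
derivative of `u`. -/
theorem conn_transition (hp : Φ.InChart c p) (hp' : Φ.InChart c' p) (v : P) (a j : Fin n) :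
    ∑ k, Φ.jacCoeff c c' p a k * Φ.conn g c v p k j
      = fderiv ℝ (fun q => Φ.jacCoeff c c' q a j) p v
        + ∑ d, Φ.conn g c' v p a d * Φ.jacCoeff c c' p d j := by
  have ho := inOverlap hp hp'
  have hJ := smoothNear_jac ho
  have hC := smoothNear_christoffel g hp.target
  have hC' : ∀ b d, SmoothNear (fun x => christoffel g c' a b d (transition c c' x))
      (Φ.pos c p) := fun b d => SmoothNear.comp
    (smoothNear_christoffel g (transition_mem ho) a b d) (smoothNear_transition ho)
  have hs := fun i b d => ((hJ b i).mul (hC' b d)).mul (hJ d j)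
  have h1 : ∀ i, ∑ k, Φ.jacCoeff c c' p a k * Φ.cf c (christoffel g c k i j) p
      = Φ.cf c (partialDeriv i fun x => jac c c' x a j) p
        + ∑ d, ∑ b, Φ.jacCoeff c c' p b i * Φ.cf c' (christoffel g c' a b d) p
          * Φ.jacCoeff c c' p d j := by
    intro i
    have e1 : (fun x => ∑ k, jac c c' x a k * christoffel g c k i j x) =ᶠ[𝓝 (Φ.pos c p)]
        fun x => partialDeriv i (fun x => jac c c' x a j) x
          + ∑ d, ∑ b, jac c c' x b i * christoffel g c' a b d (transition c c' x)
            * jac c c' x d j := by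
      filter_upwards [ho.eventually] with x hx
      have := congrFun (congrFun (cmat_transition g hx i) a) j
      simp only [Matrix.add_apply, Matrix.mul_apply, cmatPull, Matrix.sum_apply,
        Matrix.smul_apply, smul_eq_mul, Finset.sum_mul] at this
      exact this.trans (congrArg _ Finset.sum_comm)
    have e2 := cf_congr hp e1
    rw [cf_sum hp _ fun k => (hJ a k).mul (hC k i j),
      cf_add hp (smoothNear_partialDeriv i (hJ a j))
        (SmoothNear.sum fun d _ => SmoothNear.sum fun b _ => hs i b d),
      cf_sum hp _ fun d => SmoothNear.sum fun b _ => hs i b d] at e2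
    refine Eq.trans (Finset.sum_congr rfl fun k _ => ?_) (e2.trans (congrArg _
      (Finset.sum_congr rfl fun d _ => ?_)))
    · exact (cf_mul hp (hJ a k) (hC k i j)).symm
    · rw [cf_sum hp _ fun b => hs i b d]
      refine Finset.sum_congr rfl fun b _ => ?_
      rw [cf_mul hp ((hJ b i).mul (hC' b d)) (hJ d j), cf_mul hp (hJ b i) (hC' b d),
        cf_transition hp (christoffel g c' a b d)]
      rfl
  have h2 : fderiv ℝ (fun q => Φ.jacCoeff c c' q a j) p v
      = ∑ i, Φ.cf c (partialDeriv i fun x => jac c c' x a j) p * Φ.dc c v p i :=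
    fderiv_cf hp (hJ a j) v
  have h3 : ∑ k, Φ.jacCoeff c c' p a k * Φ.conn g c v p k j
      = ∑ i, (∑ k, Φ.jacCoeff c c' p a k * Φ.cf c (christoffel g c k i j) p) * Φ.dc c v p i := by
    simp only [conn, Finset.mul_sum, Finset.sum_mul, mul_assoc]
    exact Finset.sum_comm
  rw [h3, h2]
  simp only [h1, add_mul, Finset.sum_add_distrib]
  congr 1
  simp only [conn, congrFun (related_dc hp hp' v), Finset.mul_sum, Finset.sum_mul]
  rw [Finset.sum_comm]
  refine Finset.sum_congr rfl fun d _ => ?_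
  rw [Finset.sum_comm]
  refine Finset.sum_congr rfl fun b _ => Finset.sum_congr rfl fun i _ => ?_
  rw [jacCoeff_central hp hp' b i, mul_assoc, mul_assoc, mul_assoc, mul_assoc,
    jacCoeff_central hp hp' d j]

/-- The derivative of the Jacobian in the product rule is exactly the inhomogeneous term of the
connection law, so covariant derivatives transform as sections. -/
theorem Related.nab (hp : Φ.InChart c p) (hp' : Φ.InChart c' p) (v : P) {Y Y' : Sec n L P}
    (hs : SecSmooth Y p) (hY : ∀ᶠ q in 𝓝 p, Φ.Related c c' Y Y' q) :
    Φ.Related c c' (Φ.nab g c v Y) (Φ.nab g c' v Y') p := by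
  funext a
  have hJ := smoothNear_jacCoeff hp hp'
  have h1 : (fun q => Y' q a) =ᶠ[𝓝 p] fun q => ∑ i, Φ.jacCoeff c c' q a i * Y q i :=
    hY.mono fun q hq => congrFun hq a
  have h2 : fderiv ℝ (fun q => Y' q a) p v
      = ∑ i, (fderiv ℝ (fun q => Φ.jacCoeff c c' q a i) p v * Y p i
        + Φ.jacCoeff c c' p a i * fderiv ℝ (fun q => Y q i) p v) := by
    rw [h1.fderiv_eq, fderiv_fun_sum fun i _ => ((hJ a i).gmul (hs i)).differentiableAt,
      _root_.sum_apply]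
    refine Finset.sum_congr rfl fun i _ => ?_
    rw [fderiv_gmul (hJ a i).differentiableAt (hs i).differentiableAt]
  rw [nab_eq, h2, hY.self_of_nhds]
  simp only [nab_eq, mul_add, Finset.sum_add_distrib]
  have h3 : ∑ i, Φ.jacCoeff c c' p a i * ∑ j, Φ.conn g c v p i j * Y p j
      = ∑ j, (∑ k, Φ.jacCoeff c c' p a k * Φ.conn g c v p k j) * Y p j := by
    simp only [Finset.mul_sum, Finset.sum_mul, mul_assoc]
    exact Finset.sum_comm
  have h4 : ∑ d, Φ.conn g c' v p a d * ∑ i, Φ.jacCoeff c c' p d i * Y p i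
      = ∑ j, (∑ d, Φ.conn g c' v p a d * Φ.jacCoeff c c' p d j) * Y p j := by
    simp only [Finset.mul_sum, Finset.sum_mul, mul_assoc]
    exact Finset.sum_comm
  rw [h3, h4]
  simp only [conn_transition g hp hp', add_mul, Finset.sum_add_distrib]
  abel

end ChartChange

end Multiplet

/-! ### The Lagrangian over an arbitrary parameter space -/

theorem antiComm_of_odd {ι : Type*} {L : ℕ} {X Y : ι → Grassmann L}
    (hX : ∀ i, X i ∈ oddPart L) (hY : ∀ i, Y i ∈ oddPart L) : AntiComm X Y :=
  fun i j => odd_anticomm (hX i) (hY j)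

theorem bilin_smul_right {ι : Type*} [Fintype ι] {L : ℕ} (G : ι → ι → Grassmann L)
    (X Y : ι → Grassmann L) (r : ℝ) :
    bilin G X (fun i => r • Y i) = r • bilin G X Y := by
  simp only [bilin, mul_smul_comm, Finset.smul_sum]

namespace Multiplet

section Lagrangian

variable {n : ℕ} {M : Type*} [TopologicalSpace M] [ChartedSpace (Eucl n) M] {L : ℕ}
  {P : Type*} [NormedAddCommGroup P] [NormedSpace ℝ P] (Φ : Multiplet n M L P) (c : M)

/-- The components of `ψ_{a+1}`, over the parameter space `P`. -/
def ψSec (a : Fin 2) : Sec n L P := Φ.comp c (Φ.ψ a)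

/-- The components of `F'`, over the parameter space `P`. -/
def FSec : Sec n L P := Φ.comp c Φ.F

variable [IsManifold (𝓡 n) ∞ M] (g : Metric n M)

/-- The inner product of two sections. -/
def pair (X Y : Sec n L P) (p : P) : Grassmann L := bilin (Φ.metricCoeff g c p) (X p) (Y p)

/-- The value of the lowered curvature `⟨X, R(Y, Z) W⟩` on four sections. -/
def quart (X Y Z W : Sec n L P) (p : P) : Grassmann L :=
  quad (Φ.curvCoeff g c p) (X p) (Y p) (Z p) (W p)

/-- The first component of the twisted Dirac operator for the directions `e 0`, `e 1`. -/
def diracFst (e : Fin 2 → P) : Sec n L P := fun p l =>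
  Φ.nab g c (e 1) (Φ.ψSec c 0) p l - Φ.nab g c (e 0) (Φ.ψSec c 1) p l

/-- The second component of the twisted Dirac operator for the directions `e 0`, `e 1`. -/
def diracSnd (e : Fin 2 → P) : Sec n L P := fun p l =>
  - Φ.nab g c (e 0) (Φ.ψSec c 0) p l - Φ.nab g c (e 1) (Φ.ψSec c 1) p l

/-- The Lagrangian in the chart at `c` for the directions `e 0`, `e 1`, with the quartic term in
the form `½⟨ψ₁, R(ψ₁, ψ₂) ψ₂⟩`. -/
def lagIn (e : Fin 2 → P) (p : P) : Grassmann L :=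
  - (1 / 2 : ℝ) • (Φ.pair c g (Φ.dc c (e 0)) (Φ.dc c (e 0)) p
      + Φ.pair c g (Φ.dc c (e 1)) (Φ.dc c (e 1)) p)
  + (1 / 2 : ℝ) • (Φ.pair c g (Φ.ψSec c 0) (Φ.diracSnd c g e) p
      - Φ.pair c g (Φ.ψSec c 1) (Φ.diracFst c g e) p)
  + (1 / 2 : ℝ) • Φ.quart c g (Φ.ψSec c 0) (Φ.ψSec c 0) (Φ.ψSec c 1) (Φ.ψSec c 1) p
  + (1 / 2 : ℝ) • Φ.pair c g (Φ.FSec c) (Φ.FSec c) p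

/-- The Lagrangian at each point in the preferred chart. -/
def lag (e : Fin 2 → P) (p : P) : Grassmann L := Φ.lagIn (Φ.body p) g e p

/-- The Euler-Lagrange expression of `u`. -/
def elU (e : Fin 2 → P) : Sec n L P := fun p l =>
  (Φ.nab g c (e 0) (Φ.dc c (e 0)) p l + Φ.nab g c (e 1) (Φ.dc c (e 1)) p l)
    - ((1 / 2 : ℝ) • (Φ.curvSec g c (Φ.ψSec c 0) (Φ.ψSec c 0) (Φ.dc c (e 0)) p l
        - Φ.curvSec g c (Φ.ψSec c 1) (Φ.ψSec c 1) (Φ.dc c (e 0)) p l)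
      + Φ.curvSec g c (Φ.ψSec c 0) (Φ.ψSec c 1) (Φ.dc c (e 1)) p l)

/-- The Euler-Lagrange expression of `ψ₁`. -/
def elFst (e : Fin 2 → P) : Sec n L P := fun p l =>
  Φ.diracSnd c g e p l + Φ.curvSec g c (Φ.ψSec c 0) (Φ.ψSec c 1) (Φ.ψSec c 1) p l

/-- The Euler-Lagrange expression of `ψ₂`, up to sign. -/
def elSnd (e : Fin 2 → P) : Sec n L P := fun p l =>
  Φ.diracFst c g e p l - Φ.curvSec g c (Φ.ψSec c 0) (Φ.ψSec c 1) (Φ.ψSec c 0) p l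

/-- The boundary term in the direction `e 0` of the first variation in the direction `τ`. -/
def fluxFst (e : Fin 2 → P) (τ p : P) : Grassmann L :=
  - Φ.pair c g (Φ.dc c τ) (Φ.dc c (e 0)) p
    + (1 / 2 : ℝ) • (Φ.pair c g (Φ.ψSec c 1) (Φ.nab g c τ (Φ.ψSec c 1)) p
      - Φ.pair c g (Φ.ψSec c 0) (Φ.nab g c τ (Φ.ψSec c 0)) p)

/-- The boundary term in the direction `e 1` of the first variation in the direction `τ`. -/
def fluxSnd (e : Fin 2 → P) (τ p : P) : Grassmann L :=
  - Φ.pair c g (Φ.dc c τ) (Φ.dc c (e 1)) p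
    - (1 / 2 : ℝ) • (Φ.pair c g (Φ.ψSec c 0) (Φ.nab g c τ (Φ.ψSec c 1)) p
      + Φ.pair c g (Φ.ψSec c 1) (Φ.nab g c τ (Φ.ψSec c 0)) p)

variable {Φ c} {p : P} [T2Space M]

theorem secSmooth_ψSec (hp : Φ.InChart c p) (a : Fin 2) : SecSmooth (Φ.ψSec c a) p :=
  secSmooth_comp hp (fun q => Φ.ψ_leibniz a q) (Φ.contDiff_ψ a)

theorem secSmooth_FSec (hp : Φ.InChart c p) : SecSmooth (Φ.FSec c) p :=
  secSmooth_comp hp Φ.F_leibniz Φ.contDiff_F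

theorem ψSec_odd (hp : Φ.InChart c p) (a : Fin 2) (i : Fin n) : Φ.ψSec c a p i ∈ oddPart L :=
  comp_mem hp (fun q => Φ.ψ_leibniz a q) (Φ.ψ_odd a p) i

theorem FSec_even (hp : Φ.InChart c p) (i : Fin n) : Φ.FSec c p i ∈ evenPart L :=
  comp_mem hp Φ.F_leibniz (Φ.F_even p) i

theorem nab_ψSec_odd (hp : Φ.InChart c p) (v : P) (a : Fin 2) (i : Fin n) :
    Φ.nab g c v (Φ.ψSec c a) p i ∈ oddPart L :=
  nab_odd g hp v (secSmooth_ψSec hp a) (hp.eventually.mono fun _ hq => ψSec_odd hq a) i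

theorem smoothNear_pair (hp : Φ.InChart c p) {X Y : Sec n L P} (hX : SecSmooth X p)
    (hY : SecSmooth Y p) : SmoothNear (Φ.pair c g X Y) p := by
  change SmoothNear (fun q => ∑ i, ∑ j, Φ.metricCoeff g c q i j * X q i * Y q j) p
  exact SmoothNear.sum fun i _ => SmoothNear.sum fun j _ =>
    ((smoothNear_cf hp (smoothNear_gram g hp i j)).gmul (hX i)).gmul (hY j)

theorem smoothNear_quart (hp : Φ.InChart c p) {X Y Z W : Sec n L P} (hX : SecSmooth X p)
    (hY : SecSmooth Y p) (hZ : SecSmooth Z p) (hW : SecSmooth W p) :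
    SmoothNear (Φ.quart c g X Y Z W) p := by
  change SmoothNear (fun q => ∑ l, ∑ i, ∑ j, ∑ k,
    Φ.curvCoeff g c q l i j k * X q l * Y q i * Z q j * W q k) p
  exact SmoothNear.sum fun l _ => SmoothNear.sum fun i _ => SmoothNear.sum fun j _ =>
    SmoothNear.sum fun k _ => ((((smoothNear_cf hp (smoothNear_rlow g hp.target l i j k)).gmul
      (hX l)).gmul (hY i)).gmul (hZ j)).gmul (hW k)

theorem secSmooth_curvSec (hp : Φ.InChart c p) {X Y Z : Sec n L P} (hX : SecSmooth X p)
    (hY : SecSmooth Y p) (hZ : SecSmooth Z p) : SecSmooth (Φ.curvSec g c X Y Z) p := fun l =>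
  SmoothNear.sum fun i _ => SmoothNear.sum fun j _ => SmoothNear.sum fun k _ =>
    (((smoothNear_cf hp (smoothNear_riemann g hp.target l i j k)).gmul (hX i)).gmul (hY j)).gmul
      (hZ k)

theorem secSmooth_diracFst (hp : Φ.InChart c p) (e : Fin 2 → P) :
    SecSmooth (Φ.diracFst c g e) p := fun l =>
  (secSmooth_nab g hp _ (secSmooth_ψSec hp 0) l).sub (secSmooth_nab g hp _ (secSmooth_ψSec hp 1) l)

theorem secSmooth_diracSnd (hp : Φ.InChart c p) (e : Fin 2 → P) :
    SecSmooth (Φ.diracSnd c g e) p := fun l =>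
  (secSmooth_nab g hp _ (secSmooth_ψSec hp 0) l).neg.sub
    (secSmooth_nab g hp _ (secSmooth_ψSec hp 1) l)

theorem secSmooth_elU (hp : Φ.InChart c p) (e : Fin 2 → P) : SecSmooth (Φ.elU c g e) p := fun l =>
  ((secSmooth_nab g hp _ (secSmooth_dc hp _) l).add (secSmooth_nab g hp _ (secSmooth_dc hp _) l)).sub
    ((((secSmooth_curvSec g hp (secSmooth_ψSec hp 0) (secSmooth_ψSec hp 0) (secSmooth_dc hp _) l).sub
      (secSmooth_curvSec g hp (secSmooth_ψSec hp 1) (secSmooth_ψSec hp 1) (secSmooth_dc hp _)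
        l)).const_smul _).add
      (secSmooth_curvSec g hp (secSmooth_ψSec hp 0) (secSmooth_ψSec hp 1) (secSmooth_dc hp _) l))

theorem secSmooth_elFst (hp : Φ.InChart c p) (e : Fin 2 → P) :
    SecSmooth (Φ.elFst c g e) p := fun l => (secSmooth_diracSnd g hp e l).add
  (secSmooth_curvSec g hp (secSmooth_ψSec hp 0) (secSmooth_ψSec hp 1) (secSmooth_ψSec hp 1) l)

theorem secSmooth_elSnd (hp : Φ.InChart c p) (e : Fin 2 → P) :
    SecSmooth (Φ.elSnd c g e) p := fun l => (secSmooth_diracFst g hp e l).sub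
  (secSmooth_curvSec g hp (secSmooth_ψSec hp 0) (secSmooth_ψSec hp 1) (secSmooth_ψSec hp 0) l)

theorem smoothNear_lagIn (hp : Φ.InChart c p) (e : Fin 2 → P) :
    SmoothNear (Φ.lagIn c g e) p :=
  (((((smoothNear_pair g hp (secSmooth_dc hp _) (secSmooth_dc hp _)).add
    (smoothNear_pair g hp (secSmooth_dc hp _) (secSmooth_dc hp _))).const_smul _).add
    (((smoothNear_pair g hp (secSmooth_ψSec hp 0) (secSmooth_diracSnd g hp e)).sub
    (smoothNear_pair g hp (secSmooth_ψSec hp 1) (secSmooth_diracFst g hp e))).const_smul _)).add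
    ((smoothNear_quart g hp (secSmooth_ψSec hp 0) (secSmooth_ψSec hp 0) (secSmooth_ψSec hp 1)
      (secSmooth_ψSec hp 1)).const_smul _)).add
    ((smoothNear_pair g hp (secSmooth_FSec hp) (secSmooth_FSec hp)).const_smul _)

theorem smoothNear_fluxFst (hp : Φ.InChart c p) (e : Fin 2 → P) (τ : P) :
    SmoothNear (Φ.fluxFst c g e τ) p :=
  (smoothNear_pair g hp (secSmooth_dc hp _) (secSmooth_dc hp _)).neg.add
    (((smoothNear_pair g hp (secSmooth_ψSec hp 1)
      (secSmooth_nab g hp _ (secSmooth_ψSec hp 1))).sub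
      (smoothNear_pair g hp (secSmooth_ψSec hp 0)
        (secSmooth_nab g hp _ (secSmooth_ψSec hp 0)))).const_smul _)

theorem smoothNear_fluxSnd (hp : Φ.InChart c p) (e : Fin 2 → P) (τ : P) :
    SmoothNear (Φ.fluxSnd c g e τ) p :=
  (smoothNear_pair g hp (secSmooth_dc hp _) (secSmooth_dc hp _)).neg.sub
    (((smoothNear_pair g hp (secSmooth_ψSec hp 0)
      (secSmooth_nab g hp _ (secSmooth_ψSec hp 1))).add
      (smoothNear_pair g hp (secSmooth_ψSec hp 1)
        (secSmooth_nab g hp _ (secSmooth_ψSec hp 0)))).const_smul _)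

variable {c' : M}

theorem related_ψSec (hp : Φ.InChart c p) (hp' : Φ.InChart c' p) (a : Fin 2) :
    Φ.Related c c' (Φ.ψSec c a) (Φ.ψSec c' a) p :=
  related_comp hp hp' fun q => Φ.ψ_leibniz a q

theorem related_FSec (hp : Φ.InChart c p) (hp' : Φ.InChart c' p) :
    Φ.Related c c' (Φ.FSec c) (Φ.FSec c') p :=
  related_comp hp hp' Φ.F_leibniz

theorem related_nab_ψSec (hp : Φ.InChart c p) (hp' : Φ.InChart c' p) (v : P) (a : Fin 2) :
    Φ.Related c c' (Φ.nab g c v (Φ.ψSec c a)) (Φ.nab g c' v (Φ.ψSec c' a)) p :=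
  Related.nab g hp hp' v (secSmooth_ψSec hp a)
    (by filter_upwards [hp.eventually, hp'.eventually] with q hq hq' using related_ψSec hq hq' a)

theorem pair_chart (hp : Φ.InChart c p) (hp' : Φ.InChart c' p) {X X' Y Y' : Sec n L P}
    (hX : Φ.Related c c' X X' p) (hY : Φ.Related c c' Y Y' p) :
    Φ.pair c g X Y p = Φ.pair c' g X' Y' p := inner_chart g hp hp' hX hY

/-- Every term is the metric or the lowered curvature evaluated on sections that transform by the
Jacobian. -/
theorem lagIn_chart (hp : Φ.InChart c p) (hp' : Φ.InChart c' p) (e : Fin 2 → P) :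
    Φ.lagIn c g e p = Φ.lagIn c' g e p := by
  have hψ := related_ψSec hp hp'
  have hn := related_nab_ψSec g hp hp'
  have h1 : Φ.Related c c' (Φ.diracFst c g e) (Φ.diracFst c' g e) p := (hn (e 1) 0).sub (hn (e 0) 1)
  have h2 : Φ.Related c c' (Φ.diracSnd c g e) (Φ.diracSnd c' g e) p :=
    (hn (e 0) 0).neg.sub (hn (e 1) 1)
  have hu := fun v => related_dc hp hp' v
  have hF := related_FSec hp hp'
  unfold lagIn
  rw [pair_chart g hp hp' (hu (e 0)) (hu (e 0)), pair_chart g hp hp' (hu (e 1)) (hu (e 1)),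
    pair_chart g hp hp' (hψ 0) h2, pair_chart g hp hp' (hψ 1) h1, pair_chart g hp hp' hF hF]
  unfold quart
  rw [quad_chart g hp hp' (hψ 0) (hψ 0) (hψ 1) (hψ 1)]

theorem fluxFst_chart (hp : Φ.InChart c p) (hp' : Φ.InChart c' p) (e : Fin 2 → P) (τ : P) :
    Φ.fluxFst c g e τ p = Φ.fluxFst c' g e τ p := by
  have hψ := related_ψSec hp hp'
  have hn := related_nab_ψSec g hp hp' τ
  have hu := fun v => related_dc hp hp' v
  unfold fluxFst
  rw [pair_chart g hp hp' (hu τ) (hu (e 0)), pair_chart g hp hp' (hψ 1) (hn 1),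
    pair_chart g hp hp' (hψ 0) (hn 0)]

theorem fluxSnd_chart (hp : Φ.InChart c p) (hp' : Φ.InChart c' p) (e : Fin 2 → P) (τ : P) :
    Φ.fluxSnd c g e τ p = Φ.fluxSnd c' g e τ p := by
  have hψ := related_ψSec hp hp'
  have hn := related_nab_ψSec g hp hp' τ
  have hu := fun v => related_dc hp hp' v
  unfold fluxSnd
  rw [pair_chart g hp hp' (hu τ) (hu (e 1)), pair_chart g hp hp' (hψ 0) (hn 1),
    pair_chart g hp hp' (hψ 1) (hn 0)]

theorem inChart_body (Φ : Multiplet n M L P) (p : P) : Φ.InChart (Φ.body p) p :=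
  mem_extChartAt_source (I := 𝓡 n) (Φ.body p)

theorem lag_eq (hp : Φ.InChart c p) (e : Fin 2 → P) : Φ.lag g e p = Φ.lagIn c g e p :=
  lagIn_chart g (Φ.inChart_body p) hp e

theorem lag_eventuallyEq (hp : Φ.InChart c p) (e : Fin 2 → P) :
    Φ.lag g e =ᶠ[𝓝 p] Φ.lagIn c g e := hp.eventually.mono fun _ hq => lag_eq g hq e

/-- The preferred chart may jump from point to point; near a given point chart independence replaces
it by one fixed chart. -/
theorem contDiff_lag (Φ : Multiplet n M L P) (e : Fin 2 → P) : ContDiff ℝ ∞ (Φ.lag g e) :=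
  contDiff_iff_contDiffAt.mpr fun p => (smoothNear_lagIn g (Φ.inChart_body p) e).contDiffAt
    |>.congr_of_eventuallyEq (lag_eventuallyEq g (Φ.inChart_body p) e)

end Lagrangian

end Multiplet

/-! ### The first variation -/

namespace Multiplet

section Variation

variable {n : ℕ} {M : Type*} [TopologicalSpace M] [ChartedSpace (Eucl n) M] {L : ℕ}
  {P : Type*} [NormedAddCommGroup P] [NormedSpace ℝ P] {Φ : Multiplet n M L P} {c : M}
  [IsManifold (𝓡 n) ∞ M] (g : Metric n M) {p : P} [T2Space M]

theorem fderiv_pair (hp : Φ.InChart c p) (v : P) {X Y : Sec n L P} (hX : SecSmooth X p)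
    (hY : SecSmooth Y p) :
    fderiv ℝ (Φ.pair c g X Y) p v = Φ.pair c g (Φ.nab g c v X) Y p
      + Φ.pair c g X (Φ.nab g c v Y) p := fderiv_inner g hp v hX hY

theorem fderiv_quart (hR : ParallelCurvature g) (hp : Φ.InChart c p) (v : P)
    {X Y Z W : Sec n L P} (hX : SecSmooth X p) (hY : SecSmooth Y p) (hZ : SecSmooth Z p)
    (hW : SecSmooth W p) :
    fderiv ℝ (Φ.quart c g X Y Z W) p v = Φ.quart c g (Φ.nab g c v X) Y Z W p
      + Φ.quart c g X (Φ.nab g c v Y) Z W p + Φ.quart c g X Y (Φ.nab g c v Z) W p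
      + Φ.quart c g X Y Z (Φ.nab g c v W) p := fderiv_quad g hR hp v hX hY hZ hW

theorem nab_sub (v : P) {X Y : Sec n L P} (hX : SecSmooth X p)
    (hY : SecSmooth Y p) (l : Fin n) : Φ.nab g c v (fun q i => X q i - Y q i) p l
      = Φ.nab g c v X p l - Φ.nab g c v Y p l := by
  simp only [nab_eq, mul_sub, Finset.sum_sub_distrib]
  rw [fderiv_fun_sub (hX l).differentiableAt (hY l).differentiableAt]
  simp only [_root_.sub_apply]
  abel

theorem nab_neg (v : P) (X : Sec n L P) (l : Fin n) :
    Φ.nab g c v (fun q i => - X q i) p l = - Φ.nab g c v X p l := by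
  simp only [nab_eq, mul_neg, Finset.sum_neg_distrib]
  rw [fderiv_fun_neg]
  simp only [_root_.neg_apply]
  abel

theorem pair_comm_of_even (hX : ∀ i, X p i ∈ evenPart L) (Y : Sec n L P) :
    Φ.pair c g X Y p = Φ.pair c g Y X p :=
  bilin_comm (metricCoeff_symm g Φ c p) fun i j => even_comm (hX i) (Y p j)

theorem pair_anticomm {X Y : Sec n L P} (hX : ∀ i, X p i ∈ oddPart L)
    (hY : ∀ i, Y p i ∈ oddPart L) : Φ.pair c g X Y p = - Φ.pair c g Y X p :=
  bilin_anticomm (metricCoeff_symm g Φ c p) (antiComm_of_odd hX hY)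

theorem pair_add (X Y Z : Sec n L P) :
    Φ.pair c g X (fun q i => Y q i + Z q i) p = Φ.pair c g X Y p + Φ.pair c g X Z p :=
  bilin_add_right _ _ _ _

theorem pair_sub (X Y Z : Sec n L P) :
    Φ.pair c g X (fun q i => Y q i - Z q i) p = Φ.pair c g X Y p - Φ.pair c g X Z p :=
  bilin_sub_right _ _ _ _

theorem pair_neg (X Y : Sec n L P) :
    Φ.pair c g X (fun q i => - Y q i) p = - Φ.pair c g X Y p :=
  bilin_neg_right _ _ _

theorem pair_smul (X Y : Sec n L P) (r : ℝ) :
    Φ.pair c g X (fun q i => r • Y q i) p = r • Φ.pair c g X Y p :=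
  bilin_smul_right _ _ _ _

theorem pair_curvSec (hp : Φ.InChart c p) (X Y Z W : Sec n L P) :
    Φ.pair c g X (Φ.curvSec g c Y Z W) p = Φ.quart c g X Y Z W p :=
  inner_curvSec g hp X Y Z W

section Odd

variable {X Y Z W : Sec n L P} (hX : ∀ i, X p i ∈ oddPart L) (hY : ∀ i, Y p i ∈ oddPart L)
  (hZ : ∀ i, Z p i ∈ oddPart L) (hW : ∀ i, W p i ∈ oddPart L)

include hY hZ in
theorem quart_swap_inner (hp : Φ.InChart c p) :
    Φ.quart c g X Y Z W p = Φ.quart c g X Z Y W p :=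
  quad_swap_inner (curvCoeff_antisymm₁ g hp) (antiComm_of_odd hY hZ)

include hX hY hZ hW in
theorem quart_swap_outer (hp : Φ.InChart c p) :
    Φ.quart c g X Y Z W p = Φ.quart c g W Y Z X p :=
  quad_swap_outer (curvCoeff_antisymm₂ g hp) (antiComm_of_odd hX hY) (antiComm_of_odd hX hZ)
    (antiComm_of_odd hX hW) (antiComm_of_odd hY hW) (antiComm_of_odd hZ hW)

include hX hY hZ hW in
theorem quart_swap_pair (hp : Φ.InChart c p) :
    Φ.quart c g X Y Z W p = Φ.quart c g Z W X Y p :=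
  quad_swap_pair (curvCoeff_pair g hp) (antiComm_of_odd hX hZ) (antiComm_of_odd hX hW)
    (antiComm_of_odd hY hZ) (antiComm_of_odd hY hW)

include hX hY hZ hW in
theorem quart_bianchi (hp : Φ.InChart c p) :
    Φ.quart c g X Y Z W p + Φ.quart c g X Z W Y p + Φ.quart c g X W Y Z p = 0 :=
  quad_bianchi (curvCoeff_bianchi g hp) (antiComm_of_odd hY hZ) (antiComm_of_odd hY hW)
    (antiComm_of_odd hZ hW)

end Odd

theorem quart_exchange (hp : Φ.InChart c p) {Y Z : Sec n L P} (X W : Sec n L P)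
    (hY : ∀ i, Y p i ∈ evenPart L) (hZ : ∀ i, Z p i ∈ evenPart L) :
    Φ.quart c g X Y Z W p = Φ.quart c g Y X W Z p :=
  quad_exchange (curvCoeff_antisymm₁ g hp) (curvCoeff_antisymm₂ g hp) (curvCoeff_pair g hp)
    (fun i => even_comm (hY i)) (fun i => even_comm (hZ i))

/-- Two expressions of the quartic term. -/
theorem eps_quart (hp : Φ.InChart c p) :
    ∑ a, ∑ b, ∑ d, ∑ e, (eps a b * eps d e)
        • Φ.quart c g (Φ.ψSec c a) (Φ.ψSec c b) (Φ.ψSec c d) (Φ.ψSec c e) p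
      = (6 : ℝ) • Φ.quart c g (Φ.ψSec c 0) (Φ.ψSec c 0) (Φ.ψSec c 1) (Φ.ψSec c 1) p := by
  have ho := fun a => ψSec_odd hp a
  have h1 := quart_bianchi g (ho 0) (ho 1) (ho 1) (ho 0) hp
  have h2 := quart_swap_inner g (ho 0) (ho 1) (X := Φ.ψSec c 0) (W := Φ.ψSec c 1) hp
  have h3 := quart_swap_pair g (ho 0) (ho 1) (ho 1) (ho 0) hp
  have h4 := quart_swap_inner g (ho 1) (ho 0) (X := Φ.ψSec c 1) (W := Φ.ψSec c 0) hp
  have h5 := quart_swap_pair g (ho 1) (ho 1) (ho 0) (ho 0) hp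
  simp only [Fin.sum_univ_two, eps, Matrix.of_apply, Matrix.cons_val', Matrix.cons_val_zero,
    Matrix.cons_val_one, Matrix.cons_val_fin_one]
  -- With Q = ⟨ψ₁, R(ψ₁, ψ₂) ψ₂⟩, the two terms of sign plus equal Q by swapping the inner factors
  -- and the pairs. The two of sign minus equal -2Q by the Bianchi identity. In total 6Q.
  linear_combination (norm := module) (-2 : ℝ) • h1 - (3 : ℝ) • h2 + h3 - h4 + h5

theorem pair_congr {X X' Y Y' : Sec n L P} (hX : X p = X' p) (hY : Y p = Y' p) :
    Φ.pair c g X Y p = Φ.pair c g X' Y' p := by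
  unfold pair
  rw [hX, hY]

theorem nab_nab (hp : Φ.InChart c p) (v w : P) {Y : Sec n L P} (hY : SecSmooth Y p) (l : Fin n) :
    Φ.nab g c v (Φ.nab g c w Y) p l
      = Φ.nab g c w (Φ.nab g c v Y) p l + Φ.curvSec g c (Φ.dc c v) (Φ.dc c w) Y p l := by
  rw [← nab_nab_sub g hp v w hY l]
  abel

/-- Torsion-freeness turns ∇_τ ∂_v u into ∇_v ∂_τ u, after which the derivative in the direction v
is split off as a divergence. -/
theorem fderiv_kinetic (hp : Φ.InChart c p) (v τ : P) :
    fderiv ℝ (Φ.pair c g (Φ.dc c v) (Φ.dc c v)) p τ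
      = (2 : ℝ) • (fderiv ℝ (Φ.pair c g (Φ.dc c τ) (Φ.dc c v)) p v
        - Φ.pair c g (Φ.dc c τ) (Φ.nab g c v (Φ.dc c v)) p) := by
  have hs := secSmooth_dc hp
  rw [fderiv_pair g hp _ (hs v) (hs v), fderiv_pair g hp _ (hs τ) (hs v),
    pair_comm_of_even g (dc_even hp v), pair_congr g (nab_dc_comm g hp τ v) rfl]
  module

/-- Integration by parts in divergence form; odd sections anticommute, so the usual minus sign turns
into a plus. This makes the Dirac term symmetric. -/
theorem fderiv_pair_nab (hp : Φ.InChart c p) (v : P) {X Y : Sec n L P} (hX : SecSmooth X p)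
    (hY : SecSmooth Y p) (hX' : ∀ i, Φ.nab g c v X p i ∈ oddPart L)
    (hY' : ∀ i, Y p i ∈ oddPart L) :
    Φ.pair c g X (Φ.nab g c v Y) p
      = fderiv ℝ (Φ.pair c g X Y) p v + Φ.pair c g Y (Φ.nab g c v X) p := by
  rw [fderiv_pair g hp v hX hY, pair_anticomm g hX' hY']
  abel

/-- The variation ∇_τ is commuted past the covariant derivatives of the Dirac operator, at the price
of the curvature of the pulled-back connection. -/
theorem nab_diracFst (hp : Φ.InChart c p) (e : Fin 2 → P) (τ : P) :
    Φ.nab g c τ (Φ.diracFst c g e) p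
      = (fun q l => (Φ.nab g c (e 1) (Φ.nab g c τ (Φ.ψSec c 0)) q l
          + Φ.curvSec g c (Φ.dc c τ) (Φ.dc c (e 1)) (Φ.ψSec c 0) q l)
        - (Φ.nab g c (e 0) (Φ.nab g c τ (Φ.ψSec c 1)) q l
          + Φ.curvSec g c (Φ.dc c τ) (Φ.dc c (e 0)) (Φ.ψSec c 1) q l)) p := by
  funext l
  dsimp only
  have hψ := secSmooth_ψSec hp
  rw [← nab_nab g hp _ _ (hψ 0), ← nab_nab g hp _ _ (hψ 1)]
  exact nab_sub g τ (secSmooth_nab g hp _ (hψ 0)) (secSmooth_nab g hp _ (hψ 1)) l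

theorem nab_diracSnd (hp : Φ.InChart c p) (e : Fin 2 → P) (τ : P) :
    Φ.nab g c τ (Φ.diracSnd c g e) p
      = (fun q l => - (Φ.nab g c (e 0) (Φ.nab g c τ (Φ.ψSec c 0)) q l
          + Φ.curvSec g c (Φ.dc c τ) (Φ.dc c (e 0)) (Φ.ψSec c 0) q l)
        - (Φ.nab g c (e 1) (Φ.nab g c τ (Φ.ψSec c 1)) q l
          + Φ.curvSec g c (Φ.dc c τ) (Φ.dc c (e 1)) (Φ.ψSec c 1) q l)) p := by
  funext l
  dsimp only
  have hψ := secSmooth_ψSec hp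
  rw [← nab_nab g hp _ _ (hψ 0), ← nab_nab g hp _ _ (hψ 1), ← nab_neg]
  exact nab_sub g τ (fun i => (secSmooth_nab g hp _ (hψ 0) i).neg)
    (secSmooth_nab g hp _ (hψ 1)) l

/-- The variation of the Dirac term. -/
theorem fderiv_dirac (hp : Φ.InChart c p) (e : Fin 2 → P) (τ : P) :
    fderiv ℝ (Φ.pair c g (Φ.ψSec c 0) (Φ.diracSnd c g e)) p τ
        - fderiv ℝ (Φ.pair c g (Φ.ψSec c 1) (Φ.diracFst c g e)) p τ
      = (2 : ℝ) • (Φ.pair c g (Φ.nab g c τ (Φ.ψSec c 0)) (Φ.diracSnd c g e) p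
          - Φ.pair c g (Φ.nab g c τ (Φ.ψSec c 1)) (Φ.diracFst c g e) p)
        + (fderiv ℝ (Φ.pair c g (Φ.ψSec c 1) (Φ.nab g c τ (Φ.ψSec c 1))) p (e 0)
          - fderiv ℝ (Φ.pair c g (Φ.ψSec c 0) (Φ.nab g c τ (Φ.ψSec c 0))) p (e 0))
        - (fderiv ℝ (Φ.pair c g (Φ.ψSec c 0) (Φ.nab g c τ (Φ.ψSec c 1))) p (e 1)
          + fderiv ℝ (Φ.pair c g (Φ.ψSec c 1) (Φ.nab g c τ (Φ.ψSec c 0))) p (e 1))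
        - (Φ.quart c g (Φ.dc c τ) (Φ.ψSec c 0) (Φ.ψSec c 0) (Φ.dc c (e 0)) p
          - Φ.quart c g (Φ.dc c τ) (Φ.ψSec c 1) (Φ.ψSec c 1) (Φ.dc c (e 0)) p)
        - (2 : ℝ) • Φ.quart c g (Φ.dc c τ) (Φ.ψSec c 0) (Φ.ψSec c 1) (Φ.dc c (e 1)) p := by
  have hψ := secSmooth_ψSec hp
  have ho := fun a => ψSec_odd hp a
  have hn := fun v => nab_ψSec_odd g hp v
  have hsn := fun v a => secSmooth_nab g hp v (hψ a)
  have hu := dc_even hp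
  have d1 := fderiv_pair g hp τ (hψ 0) (secSmooth_diracSnd g hp e)
  have d2 := fderiv_pair g hp τ (hψ 1) (secSmooth_diracFst g hp e)
  -- The curvature terms ⟨ψ, R(∂_τ u, ∂u) ψ⟩ have even middle arguments, so `quart_exchange` brings
  -- ∂_τ u to the front without a sign.
  have e1 : Φ.pair c g (Φ.ψSec c 0) (Φ.nab g c τ (Φ.diracSnd c g e)) p
      = - (Φ.pair c g (Φ.ψSec c 0) (Φ.nab g c (e 0) (Φ.nab g c τ (Φ.ψSec c 0))) p
          + Φ.quart c g (Φ.dc c τ) (Φ.ψSec c 0) (Φ.ψSec c 0) (Φ.dc c (e 0)) p)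
        - (Φ.pair c g (Φ.ψSec c 0) (Φ.nab g c (e 1) (Φ.nab g c τ (Φ.ψSec c 1))) p
          + Φ.quart c g (Φ.dc c τ) (Φ.ψSec c 0) (Φ.ψSec c 1) (Φ.dc c (e 1)) p) := by
    rw [pair_congr (Y' := fun q l => - (Φ.nab g c (e 0) (Φ.nab g c τ (Φ.ψSec c 0)) q l
          + Φ.curvSec g c (Φ.dc c τ) (Φ.dc c (e 0)) (Φ.ψSec c 0) q l)
        - (Φ.nab g c (e 1) (Φ.nab g c τ (Φ.ψSec c 1)) q l
          + Φ.curvSec g c (Φ.dc c τ) (Φ.dc c (e 1)) (Φ.ψSec c 1) q l))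
      g rfl (nab_diracSnd g hp e τ), pair_sub, pair_neg, pair_add, pair_add,
      pair_curvSec g hp, pair_curvSec g hp, quart_exchange g hp _ _ (hu τ) (hu (e 0)),
      quart_exchange g hp _ _ (hu τ) (hu (e 1))]
  have e2 : Φ.pair c g (Φ.ψSec c 1) (Φ.nab g c τ (Φ.diracFst c g e)) p
      = (Φ.pair c g (Φ.ψSec c 1) (Φ.nab g c (e 1) (Φ.nab g c τ (Φ.ψSec c 0))) p
          + Φ.quart c g (Φ.dc c τ) (Φ.ψSec c 0) (Φ.ψSec c 1) (Φ.dc c (e 1)) p)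
        - (Φ.pair c g (Φ.ψSec c 1) (Φ.nab g c (e 0) (Φ.nab g c τ (Φ.ψSec c 1))) p
          + Φ.quart c g (Φ.dc c τ) (Φ.ψSec c 1) (Φ.ψSec c 1) (Φ.dc c (e 0)) p) := by
    rw [pair_congr (Y' := fun q l => (Φ.nab g c (e 1) (Φ.nab g c τ (Φ.ψSec c 0)) q l
          + Φ.curvSec g c (Φ.dc c τ) (Φ.dc c (e 1)) (Φ.ψSec c 0) q l)
        - (Φ.nab g c (e 0) (Φ.nab g c τ (Φ.ψSec c 1)) q l
          + Φ.curvSec g c (Φ.dc c τ) (Φ.dc c (e 0)) (Φ.ψSec c 1) q l))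
      g rfl (nab_diracFst g hp e τ), pair_sub, pair_add, pair_add,
      pair_curvSec g hp, pair_curvSec g hp, quart_exchange g hp _ _ (hu τ) (hu (e 0)),
      quart_exchange g hp _ _ (hu τ) (hu (e 1)), quart_swap_inner g (ho 1) (ho 0) hp]
  -- Moving the outer derivative back to the other spinor reproduces the Dirac operator, whence the
  -- factor 2 in front of the pairings with it; the divergences are the spinor fluxes.
  have f := fun v a b => fderiv_pair_nab g hp v (hψ a) (hsn τ b) (hn v a) (hn τ b)
  have g1 : Φ.pair c g (Φ.nab g c τ (Φ.ψSec c 0)) (Φ.diracSnd c g e) p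
      = - Φ.pair c g (Φ.nab g c τ (Φ.ψSec c 0)) (Φ.nab g c (e 0) (Φ.ψSec c 0)) p
        - Φ.pair c g (Φ.nab g c τ (Φ.ψSec c 0)) (Φ.nab g c (e 1) (Φ.ψSec c 1)) p := by
    rw [← pair_neg, ← pair_sub]
    rfl
  have g2 : Φ.pair c g (Φ.nab g c τ (Φ.ψSec c 1)) (Φ.diracFst c g e) p
      = Φ.pair c g (Φ.nab g c τ (Φ.ψSec c 1)) (Φ.nab g c (e 1) (Φ.ψSec c 0)) p
        - Φ.pair c g (Φ.nab g c τ (Φ.ψSec c 1)) (Φ.nab g c (e 0) (Φ.ψSec c 1)) p := by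
    rw [← pair_sub]
    rfl
  rw [d1, d2, e1, e2, f (e 0) 0 0, f (e 1) 0 1, f (e 1) 1 0, f (e 0) 1 1, g1, g2]
  module

/-- The variation of the quartic term. -/
theorem fderiv_quart_ψSec (hR : ParallelCurvature g) (hp : Φ.InChart c p) (τ : P) :
    fderiv ℝ (Φ.quart c g (Φ.ψSec c 0) (Φ.ψSec c 0) (Φ.ψSec c 1) (Φ.ψSec c 1)) p τ
      = (2 : ℝ) • (Φ.quart c g (Φ.nab g c τ (Φ.ψSec c 0)) (Φ.ψSec c 0) (Φ.ψSec c 1) (Φ.ψSec c 1) p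
        + Φ.quart c g (Φ.nab g c τ (Φ.ψSec c 1)) (Φ.ψSec c 0) (Φ.ψSec c 1) (Φ.ψSec c 0) p) := by
  have hψ := secSmooth_ψSec hp
  have ho := fun a => ψSec_odd hp a
  have hn := nab_ψSec_odd g hp τ
  -- The four derivative terms agree in pairs: the curvature symmetries carry the differentiated
  -- argument to the first place, two terms for each spinor.
  have h1 : Φ.quart c g (Φ.ψSec c 0) (Φ.nab g c τ (Φ.ψSec c 0)) (Φ.ψSec c 1) (Φ.ψSec c 1) p
      = Φ.quart c g (Φ.nab g c τ (Φ.ψSec c 0)) (Φ.ψSec c 0) (Φ.ψSec c 1) (Φ.ψSec c 1) p := by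
    rw [quart_swap_outer g (ho 0) (hn 0) (ho 1) (ho 1) hp, quart_swap_inner g (hn 0) (ho 1) hp,
      quart_swap_pair g (ho 1) (ho 1) (hn 0) (ho 0) hp]
  have h2 : Φ.quart c g (Φ.ψSec c 0) (Φ.ψSec c 0) (Φ.nab g c τ (Φ.ψSec c 1)) (Φ.ψSec c 1) p
      = Φ.quart c g (Φ.nab g c τ (Φ.ψSec c 1)) (Φ.ψSec c 0) (Φ.ψSec c 1) (Φ.ψSec c 0) p := by
    rw [quart_swap_pair g (ho 0) (ho 0) (hn 1) (ho 1) hp, quart_swap_inner g (ho 1) (ho 0) hp]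
  have h3 : Φ.quart c g (Φ.ψSec c 0) (Φ.ψSec c 0) (Φ.ψSec c 1) (Φ.nab g c τ (Φ.ψSec c 1)) p
      = Φ.quart c g (Φ.nab g c τ (Φ.ψSec c 1)) (Φ.ψSec c 0) (Φ.ψSec c 1) (Φ.ψSec c 0) p :=
    quart_swap_outer g (ho 0) (ho 0) (ho 1) (hn 1) hp
  rw [fderiv_quart g hR hp τ (hψ 0) (hψ 0) (hψ 1) (hψ 1), h1, h2, h3]
  module

theorem fderiv_fluxFst (hp : Φ.InChart c p) (e : Fin 2 → P) (τ v : P) :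
    fderiv ℝ (Φ.fluxFst c g e τ) p v
      = - fderiv ℝ (Φ.pair c g (Φ.dc c τ) (Φ.dc c (e 0))) p v
        + (1 / 2 : ℝ) • (fderiv ℝ (Φ.pair c g (Φ.ψSec c 1) (Φ.nab g c τ (Φ.ψSec c 1))) p v
          - fderiv ℝ (Φ.pair c g (Φ.ψSec c 0) (Φ.nab g c τ (Φ.ψSec c 0))) p v) := by
  have hψ := secSmooth_ψSec hp
  have hs := secSmooth_dc hp
  have k := fun a b => (smoothNear_pair g hp (hψ a)
    (secSmooth_nab g hp τ (hψ b))).differentiableAt.hasFDerivAt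
  have k0 := (smoothNear_pair g hp (hs τ) (hs (e 0))).differentiableAt.hasFDerivAt
  exact congrArg (fun T => T v) (k0.neg.add (((k 1 1).sub (k 0 0)).const_smul (1 / 2 : ℝ))).fderiv

theorem fderiv_fluxSnd (hp : Φ.InChart c p) (e : Fin 2 → P) (τ v : P) :
    fderiv ℝ (Φ.fluxSnd c g e τ) p v
      = - fderiv ℝ (Φ.pair c g (Φ.dc c τ) (Φ.dc c (e 1))) p v
        - (1 / 2 : ℝ) • (fderiv ℝ (Φ.pair c g (Φ.ψSec c 0) (Φ.nab g c τ (Φ.ψSec c 1))) p v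
          + fderiv ℝ (Φ.pair c g (Φ.ψSec c 1) (Φ.nab g c τ (Φ.ψSec c 0))) p v) := by
  have hψ := secSmooth_ψSec hp
  have hs := secSmooth_dc hp
  have k := fun a b => (smoothNear_pair g hp (hψ a)
    (secSmooth_nab g hp τ (hψ b))).differentiableAt.hasFDerivAt
  have k0 := (smoothNear_pair g hp (hs τ) (hs (e 1))).differentiableAt.hasFDerivAt
  exact congrArg (fun T => T v) (k0.neg.sub (((k 0 1).add (k 1 0)).const_smul (1 / 2 : ℝ))).fderiv

theorem fderiv_lagIn_apply (hp : Φ.InChart c p) (e : Fin 2 → P) (τ : P) :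
    fderiv ℝ (Φ.lagIn c g e) p τ
      = - (1 / 2 : ℝ) • (fderiv ℝ (Φ.pair c g (Φ.dc c (e 0)) (Φ.dc c (e 0))) p τ
          + fderiv ℝ (Φ.pair c g (Φ.dc c (e 1)) (Φ.dc c (e 1))) p τ)
        + (1 / 2 : ℝ) • (fderiv ℝ (Φ.pair c g (Φ.ψSec c 0) (Φ.diracSnd c g e)) p τ
          - fderiv ℝ (Φ.pair c g (Φ.ψSec c 1) (Φ.diracFst c g e)) p τ)
        + (1 / 2 : ℝ)
          • fderiv ℝ (Φ.quart c g (Φ.ψSec c 0) (Φ.ψSec c 0) (Φ.ψSec c 1) (Φ.ψSec c 1)) p τ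
        + (1 / 2 : ℝ) • fderiv ℝ (Φ.pair c g (Φ.FSec c) (Φ.FSec c)) p τ := by
  have hψ := secSmooth_ψSec hp
  have hs := secSmooth_dc hp
  have k0 := fun v => (smoothNear_pair g hp (hs v) (hs v)).differentiableAt.hasFDerivAt
  have k1 := (smoothNear_pair g hp (hψ 0) (secSmooth_diracSnd g hp e)).differentiableAt.hasFDerivAt
  have k2 := (smoothNear_pair g hp (hψ 1) (secSmooth_diracFst g hp e)).differentiableAt.hasFDerivAt
  have k3 := (smoothNear_quart g hp (hψ 0) (hψ 0) (hψ 1) (hψ 1)).differentiableAt.hasFDerivAt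
  have k4 := (smoothNear_pair g hp (secSmooth_FSec hp)
    (secSmooth_FSec hp)).differentiableAt.hasFDerivAt
  exact congrArg (fun T => T τ) ((((((k0 (e 0)).add (k0 (e 1))).const_smul (-(1 / 2 : ℝ))).add
    ((k1.sub k2).const_smul (1 / 2 : ℝ))).add (k3.const_smul (1 / 2 : ℝ))).add
    (k4.const_smul (1 / 2 : ℝ))).fderiv

/-- The first variation of the Lagrangian. -/
theorem fderiv_lagIn (hR : ParallelCurvature g) (hp : Φ.InChart c p) (e : Fin 2 → P) (τ : P) :
    fderiv ℝ (Φ.lagIn c g e) p τ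
      = Φ.pair c g (Φ.dc c τ) (Φ.elU c g e) p
        + Φ.pair c g (Φ.nab g c τ (Φ.ψSec c 0)) (Φ.elFst c g e) p
        - Φ.pair c g (Φ.nab g c τ (Φ.ψSec c 1)) (Φ.elSnd c g e) p
        + Φ.pair c g (Φ.nab g c τ (Φ.FSec c)) (Φ.FSec c) p
        + (fderiv ℝ (Φ.fluxFst c g e τ) p (e 0) + fderiv ℝ (Φ.fluxSnd c g e τ) p (e 1)) := by
  have hF := secSmooth_FSec hp
  have eU : Φ.pair c g (Φ.dc c τ) (Φ.elU c g e) p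
      = (Φ.pair c g (Φ.dc c τ) (Φ.nab g c (e 0) (Φ.dc c (e 0))) p
          + Φ.pair c g (Φ.dc c τ) (Φ.nab g c (e 1) (Φ.dc c (e 1))) p)
        - ((1 / 2 : ℝ) • (Φ.quart c g (Φ.dc c τ) (Φ.ψSec c 0) (Φ.ψSec c 0) (Φ.dc c (e 0)) p
          - Φ.quart c g (Φ.dc c τ) (Φ.ψSec c 1) (Φ.ψSec c 1) (Φ.dc c (e 0)) p)
          + Φ.quart c g (Φ.dc c τ) (Φ.ψSec c 0) (Φ.ψSec c 1) (Φ.dc c (e 1)) p) := by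
    simp only [← pair_curvSec g hp]
    rw [← pair_sub, ← pair_smul, ← pair_add, ← pair_add, ← pair_sub]
    rfl
  have eA : Φ.pair c g (Φ.nab g c τ (Φ.ψSec c 0)) (Φ.elFst c g e) p
      = Φ.pair c g (Φ.nab g c τ (Φ.ψSec c 0)) (Φ.diracSnd c g e) p
        + Φ.quart c g (Φ.nab g c τ (Φ.ψSec c 0)) (Φ.ψSec c 0) (Φ.ψSec c 1) (Φ.ψSec c 1) p := by
    rw [← pair_curvSec g hp, ← pair_add]
    rfl
  have eB : Φ.pair c g (Φ.nab g c τ (Φ.ψSec c 1)) (Φ.elSnd c g e) p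
      = Φ.pair c g (Φ.nab g c τ (Φ.ψSec c 1)) (Φ.diracFst c g e) p
        - Φ.quart c g (Φ.nab g c τ (Φ.ψSec c 1)) (Φ.ψSec c 0) (Φ.ψSec c 1) (Φ.ψSec c 0) p := by
    rw [← pair_curvSec g hp, ← pair_sub]
    rfl
  rw [fderiv_lagIn_apply g hp, fderiv_kinetic g hp, fderiv_kinetic g hp, fderiv_dirac g hp,
    fderiv_quart_ψSec g hR hp, fderiv_pair g hp τ hF hF, pair_comm_of_even g (FSec_even hp),
    fderiv_fluxFst g hp, fderiv_fluxSnd g hp, eU, eA, eB]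
  module

end Variation

end Multiplet

/-! ### Integrals of Grassmann-valued functions -/

section Integrals

variable {G : Type*} [NormedAddCommGroup G] [NormedSpace ℝ G]

/-- The time derivative is bounded on the compact set [-1, 1] × K, so dominated convergence applies.
-/
theorem hasDerivAt_integral_of_contDiff {f : ℝ × (ℝ × ℝ) → G} (hf : ContDiff ℝ ∞ f)
    {K : Set (ℝ × ℝ)} (hK : IsCompact K) :
    HasDerivAt (fun t => ∫ p in K, f (t, p)) (∫ p in K, fderiv ℝ f (0, p) (1, 0)) 0 := by
  have hd : Continuous fun q => fderiv ℝ f q (1, 0) :=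
    ((hf.continuous_fderiv (by simp)).clm_apply continuous_const)
  obtain ⟨C, hC⟩ := ((isCompact_Icc (a := (-1 : ℝ)) (b := 1)).prod hK).exists_bound_of_continuousOn
    hd.continuousOn
  refine (hasDerivAt_integral_of_dominated_loc_of_deriv_le (μ := volume.restrict K)
    (bound := fun _ => C) (F := fun t p => f (t, p)) (F' := fun t p => fderiv ℝ f (t, p) (1, 0))
    (Icc_mem_nhds (a := (-1 : ℝ)) (b := 1) (by norm_num) (by norm_num)) ?_ ?_ ?_ ?_ ?_ ?_).2
  · exact Filter.Eventually.of_forall fun t =>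
      (hf.continuous.comp (by fun_prop : Continuous fun p : ℝ × ℝ => (t, p))).aestronglyMeasurable
  · exact ((hf.continuous.comp (by fun_prop : Continuous fun p : ℝ × ℝ =>
      ((0 : ℝ), p))).continuousOn).integrableOn_compact hK
  · exact (hd.comp (by fun_prop : Continuous fun p : ℝ × ℝ =>
      ((0 : ℝ), p))).aestronglyMeasurable
  · filter_upwards [ae_restrict_mem hK.measurableSet] with p hp t ht
    exact hC (t, p) ⟨ht, hp⟩
  · exact integrableOn_const hK.measure_lt_top.ne
  · refine Filter.Eventually.of_forall fun p t _ => ?_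
    have h1 : HasDerivAt (fun t : ℝ => (t, p)) ((1 : ℝ), (0 : ℝ × ℝ)) t :=
      (hasDerivAt_id t).prodMk (hasDerivAt_const t p)
    exact ((hf.differentiable (by simp) (t, p)).hasFDerivAt).comp_hasDerivAt t h1

/-- Integration by parts against the constant function 1. -/
theorem integral_fderiv_eq_zero {w : ℝ × ℝ → G} (hw : ContDiff ℝ ∞ w) (hc : HasCompactSupport w)
    (v : ℝ × ℝ) : ∫ p, fderiv ℝ w p v = 0 := by
  have hd : Continuous fun q => fderiv ℝ w q v :=
    ((hw.continuous_fderiv (by simp)).clm_apply continuous_const)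
  have hdc : HasCompactSupport fun q => fderiv ℝ w q v := hc.fderiv_apply ℝ v
  have h := integral_bilinear_hasLineDerivAt_right_eq_neg_left_of_integrable (μ := volume)
    (f := fun _ : ℝ × ℝ => (1 : ℝ)) (f' := fun _ => 0) (g := w) (g' := fun p => fderiv ℝ w p v)
    (v := v) (B := ContinuousLinearMap.lsmul ℝ ℝ) (by simp)
    (by simpa using hd.integrable_of_hasCompactSupport hdc)
    (by simpa using hw.continuous.integrable_of_hasCompactSupport hc)
    (fun x _ => by simpa using (hasFDerivAt_const (1 : ℝ) x).hasLineDerivAt v)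
    (fun x _ => (hw.differentiable (by simp) x).hasFDerivAt.hasLineDerivAt v)
  simpa using h

end Integrals

theorem fderiv_slice {P G : Type*} [NormedAddCommGroup P] [NormedSpace ℝ P]
    [NormedAddCommGroup G] [NormedSpace ℝ G] {f : ℝ × P → G} {t : ℝ} {p : P}
    (hf : DifferentiableAt ℝ f (t, p)) (v : P) :
    fderiv ℝ (fun q => f (t, q)) p v = fderiv ℝ f (t, p) (0, v) := by
  have h1 : HasFDerivAt (fun q : P => (t, q)) (ContinuousLinearMap.inr ℝ ℝ P) p :=
    hasFDerivAt_prodMk_right t p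
  have h2 := hf.hasFDerivAt.comp p h1
  exact congrArg (fun T => T v) h2.fderiv

theorem fderiv_time_eq_zero {P G : Type*} [NormedAddCommGroup P] [NormedSpace ℝ P]
    [NormedAddCommGroup G] [NormedSpace ℝ G] {f : ℝ × P → G} {p : P}
    (hf : DifferentiableAt ℝ f (0, p)) (hc : ∀ t, f (t, p) = f (0, p)) :
    fderiv ℝ f (0, p) (1, 0) = 0 := by
  have h1 : HasDerivAt (fun t : ℝ => (t, p)) ((1 : ℝ), (0 : P)) 0 :=
    (hasDerivAt_id (0 : ℝ)).prodMk (hasDerivAt_const 0 p)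
  have h2 := hf.hasFDerivAt.comp_hasDerivAt (0 : ℝ) h1
  have h3 : (f ∘ fun t : ℝ => (t, p)) = fun _ => f (0, p) := funext hc
  rw [h3] at h2
  exact h2.unique (hasDerivAt_const (0 : ℝ) _)

/-! ### Chart-independent form of the first variation -/

namespace Multiplet

section Global

variable {n : ℕ} {M : Type*} [TopologicalSpace M] [ChartedSpace (Eucl n) M] {L : ℕ}
  {P : Type*} [NormedAddCommGroup P] [NormedSpace ℝ P] (Φ : Multiplet n M L P) (c : M)
  [IsManifold (𝓡 n) ∞ M] (g : Metric n M)

/-- The boundary term `fluxFst`, at each point in the preferred chart. -/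
def gfluxFst (e : Fin 2 → P) (τ p : P) : Grassmann L := Φ.fluxFst (Φ.body p) g e τ p

/-- The boundary term `fluxSnd`, at each point in the preferred chart. -/
def gfluxSnd (e : Fin 2 → P) (τ p : P) : Grassmann L := Φ.fluxSnd (Φ.body p) g e τ p

/-- The pairing of the variation in the direction `τ` with the Euler-Lagrange expressions. -/
def varIn (e : Fin 2 → P) (τ p : P) : Grassmann L :=
  Φ.pair c g (Φ.dc c τ) (Φ.elU c g e) p
    + Φ.pair c g (Φ.nab g c τ (Φ.ψSec c 0)) (Φ.elFst c g e) p
    - Φ.pair c g (Φ.nab g c τ (Φ.ψSec c 1)) (Φ.elSnd c g e) p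
    + Φ.pair c g (Φ.nab g c τ (Φ.FSec c)) (Φ.FSec c) p

variable {Φ c} {p : P} [T2Space M]

theorem gfluxFst_eventuallyEq (hp : Φ.InChart c p) (e : Fin 2 → P) (τ : P) :
    Φ.gfluxFst g e τ =ᶠ[𝓝 p] Φ.fluxFst c g e τ :=
  hp.eventually.mono fun q hq => fluxFst_chart g (Φ.inChart_body q) hq e τ

theorem gfluxSnd_eventuallyEq (hp : Φ.InChart c p) (e : Fin 2 → P) (τ : P) :
    Φ.gfluxSnd g e τ =ᶠ[𝓝 p] Φ.fluxSnd c g e τ :=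
  hp.eventually.mono fun q hq => fluxSnd_chart g (Φ.inChart_body q) hq e τ

theorem contDiff_gfluxFst (Φ : Multiplet n M L P) (e : Fin 2 → P) (τ : P) :
    ContDiff ℝ ∞ (Φ.gfluxFst g e τ) :=
  contDiff_iff_contDiffAt.mpr fun p => (smoothNear_fluxFst g (Φ.inChart_body p) e τ).contDiffAt
    |>.congr_of_eventuallyEq (gfluxFst_eventuallyEq g (Φ.inChart_body p) e τ)

theorem contDiff_gfluxSnd (Φ : Multiplet n M L P) (e : Fin 2 → P) (τ : P) :
    ContDiff ℝ ∞ (Φ.gfluxSnd g e τ) :=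
  contDiff_iff_contDiffAt.mpr fun p => (smoothNear_fluxSnd g (Φ.inChart_body p) e τ).contDiffAt
    |>.congr_of_eventuallyEq (gfluxSnd_eventuallyEq g (Φ.inChart_body p) e τ)

/-- The Lagrangian and the fluxes agree near p with their expressions in any chart containing the
body of p. That the chart is arbitrary here is used later to see that `varIn` does not depend on it.
-/
theorem fderiv_lag (hR : ParallelCurvature g) (hp : Φ.InChart c p) (e : Fin 2 → P) (τ : P) :
    fderiv ℝ (Φ.lag g e) p τ = Φ.varIn c g e τ p
      + (fderiv ℝ (Φ.gfluxFst g e τ) p (e 0) + fderiv ℝ (Φ.gfluxSnd g e τ) p (e 1)) := by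
  rw [(lag_eventuallyEq g hp e).fderiv_eq, (gfluxFst_eventuallyEq g hp e τ).fderiv_eq,
    (gfluxSnd_eventuallyEq g hp e τ).fderiv_eq]
  exact fderiv_lagIn g hR hp e τ

end Global

/-! ### Families of multiplets -/

section Slice

variable {n : ℕ} {M : Type*} [TopologicalSpace M] [ChartedSpace (Eucl n) M] {L : ℕ}
  {P : Type*} [NormedAddCommGroup P] [NormedSpace ℝ P] {V : Multiplet n M L (ℝ × P)} {c : M}
  [IsManifold (𝓡 n) ∞ M] (g : Metric n M) [T2Space M] {t : ℝ} {p : P}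

/-- For a spatial direction the time is only a parameter. In the same way all fields of a slice, and
the Euler–Lagrange expressions built from them, are restrictions of those of the family. -/
theorem dc_slice (hp : V.InChart c (t, p)) (v : P) :
    (V.slice t).dc c v p = V.dc c (0, v) (t, p) :=
  funext fun i => fderiv_slice (smoothNear_cf hp (smoothNear_coord i _)).differentiableAt v

theorem nab_slice (hp : V.InChart c (t, p)) (v : P) {Y : Sec n L (ℝ × P)} {Y' : Sec n L P}
    (hY : SecSmooth Y (t, p)) (h : ∀ᶠ q in 𝓝 p, Y' q = Y (t, q)) :
    (V.slice t).nab g c v Y' p = V.nab g c (0, v) Y (t, p) := by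
  funext l
  have h1 : (fun q => Y' q l) =ᶠ[𝓝 p] fun q => Y (t, q) l := h.mono fun q hq => congrFun hq l
  unfold nab
  rw [h1.fderiv_eq, fderiv_slice (f := fun q => Y q l) (hY l).differentiableAt, h.self_of_nhds,
    dc_slice hp]
  rfl

theorem eventually_inChart_slice (hp : V.InChart c (t, p)) :
    ∀ᶠ q in 𝓝 p, V.InChart c (t, q) :=
  (by fun_prop : Continuous fun q : P => (t, q)).continuousAt.eventually hp.eventually

theorem nab_ψSec_slice (hp : V.InChart c (t, p)) (v : P) (a : Fin 2) :
    (V.slice t).nab g c v ((V.slice t).ψSec c a) p = V.nab g c (0, v) (V.ψSec c a) (t, p) :=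
  nab_slice g hp v (secSmooth_ψSec hp a) (Filter.Eventually.of_forall fun _ => rfl)

theorem nab_dc_slice (hp : V.InChart c (t, p)) (v w : P) :
    (V.slice t).nab g c v ((V.slice t).dc c w) p = V.nab g c (0, v) (V.dc c (0, w)) (t, p) :=
  nab_slice g hp v (secSmooth_dc hp _)
    ((eventually_inChart_slice hp).mono fun _ hq => dc_slice hq w)

/-- The directions of `P` as directions of `ℝ × P`. -/
def lift (e : Fin 2 → P) (k : Fin 2) : ℝ × P := (0, e k)

theorem diracFst_slice (hp : V.InChart c (t, p)) (e : Fin 2 → P) :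
    (V.slice t).diracFst c g e p = V.diracFst c g (lift e) (t, p) := by
  funext l
  unfold diracFst
  rw [nab_ψSec_slice g hp, nab_ψSec_slice g hp]
  rfl

theorem diracSnd_slice (hp : V.InChart c (t, p)) (e : Fin 2 → P) :
    (V.slice t).diracSnd c g e p = V.diracSnd c g (lift e) (t, p) := by
  funext l
  unfold diracSnd
  rw [nab_ψSec_slice g hp, nab_ψSec_slice g hp]
  rfl

theorem curvSec_slice {X Y Z : Sec n L P} {X' Y' Z' : Sec n L (ℝ × P)} (hX : X p = X' (t, p))
    (hY : Y p = Y' (t, p)) (hZ : Z p = Z' (t, p)) :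
    (V.slice t).curvSec g c X Y Z p = V.curvSec g c X' Y' Z' (t, p) := by
  unfold curvSec
  rw [hX, hY, hZ]
  rfl

theorem pair_slice {X Y : Sec n L P} {X' Y' : Sec n L (ℝ × P)} (hX : X p = X' (t, p))
    (hY : Y p = Y' (t, p)) : (V.slice t).pair c g X Y p = V.pair c g X' Y' (t, p) := by
  unfold pair
  rw [hX, hY]
  rfl

theorem elU_slice (hp : V.InChart c (t, p)) (e : Fin 2 → P) :
    (V.slice t).elU c g e p = V.elU c g (lift e) (t, p) := by
  funext l
  unfold elU
  rw [nab_dc_slice g hp, nab_dc_slice g hp,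
    curvSec_slice g (X' := V.ψSec c 0) (Y' := V.ψSec c 0) rfl rfl (dc_slice hp _),
    curvSec_slice g (X' := V.ψSec c 1) (Y' := V.ψSec c 1) rfl rfl (dc_slice hp _),
    curvSec_slice g (X' := V.ψSec c 0) (Y' := V.ψSec c 1) rfl rfl (dc_slice hp _)]
  rfl

theorem elFst_slice (hp : V.InChart c (t, p)) (e : Fin 2 → P) :
    (V.slice t).elFst c g e p = V.elFst c g (lift e) (t, p) := by
  funext l
  unfold elFst
  rw [diracSnd_slice g hp]
  rfl

theorem elSnd_slice (hp : V.InChart c (t, p)) (e : Fin 2 → P) :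
    (V.slice t).elSnd c g e p = V.elSnd c g (lift e) (t, p) := by
  funext l
  unfold elSnd
  rw [diracFst_slice g hp]
  rfl

theorem lagIn_slice (hp : V.InChart c (t, p)) (e : Fin 2 → P) :
    (V.slice t).lagIn c g e p = V.lagIn c g (lift e) (t, p) := by
  unfold lagIn
  rw [pair_slice g (dc_slice hp (e 0)) (dc_slice hp (e 0)),
    pair_slice g (dc_slice hp (e 1)) (dc_slice hp (e 1)),
    pair_slice g (X' := V.ψSec c 0) rfl (diracSnd_slice g hp e),
    pair_slice g (X' := V.ψSec c 1) rfl (diracFst_slice g hp e)]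
  rfl

theorem lag_slice (V : Multiplet n M L (ℝ × P)) (e : Fin 2 → P) (t : ℝ) (p : P) :
    (V.slice t).lag g e p = V.lag g (lift e) (t, p) :=
  lagIn_slice g (V.inChart_body (t, p)) e

theorem eq_of_agreeAt {Φ Ψ : Multiplet n M L P} (h : ∀ p, Φ.AgreeAt Ψ p) : Φ = Ψ := by
  have h1 : Φ.body = Ψ.body := funext fun p => (h p).1
  have h2 : Φ.pull = Ψ.pull := funext fun p => (h p).2.1
  have h3 : Φ.ψ = Ψ.ψ := funext fun a => funext fun p => (h p).2.2.1 a
  have h4 : Φ.F = Ψ.F := funext fun p => (h p).2.2.2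
  cases Φ
  cases Ψ
  cases h1
  cases h2
  cases h3
  cases h4
  rfl

/-- Where the family does not depend on time its time derivatives vanish. Since each term of the
fluxes contains such a derivative, the fluxes are supported in the compact set of the variation. -/
theorem dc_time_eq_zero (hp : V.InChart c (0, p))
    (h : ∀ t, (V.slice t).AgreeAt (V.slice 0) p) : V.dc c (1, 0) (0, p) = 0 := by
  funext i
  refine fderiv_time_eq_zero (smoothNear_cf hp (smoothNear_coord i _)).differentiableAt fun t => ?_
  have h1 : V.body (t, p) = V.body (0, p) := (h t).1
  have h2 : V.pull (t, p) = V.pull (0, p) := (h t).2.1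
  unfold cf
  rw [h1, h2]

theorem nab_time_eq_zero (hp : V.InChart c (0, p))
    (h : ∀ t, (V.slice t).AgreeAt (V.slice 0) p) (a : Fin 2) :
    V.nab g c (1, 0) (V.ψSec c a) (0, p) = 0 := by
  funext i
  have h0 : fderiv ℝ (fun q => V.ψSec c a q i) (0, p) (1, 0) = 0 := by
    refine fderiv_time_eq_zero (secSmooth_ψSec hp a i).differentiableAt fun t => ?_
    have h1 : V.body (t, p) = V.body (0, p) := (h t).1
    have h2 : V.ψ a (t, p) = V.ψ a (0, p) := (h t).2.2.1 a
    unfold ψSec comp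
    rw [h1, h2]
  unfold nab
  rw [h0, dc_time_eq_zero hp h]
  simp

theorem pair_eq_zero_left {Φ : Multiplet n M L P} {X : Sec n L P} (hX : X p = 0) (Y : Sec n L P) :
    Φ.pair c g X Y p = 0 := by
  unfold pair bilin
  simp [hX]

theorem pair_eq_zero_right {Φ : Multiplet n M L P} (X : Sec n L P) {Y : Sec n L P} (hY : Y p = 0) :
    Φ.pair c g X Y p = 0 := by
  unfold pair bilin
  simp [hY]

theorem gfluxFst_time_eq_zero (V : Multiplet n M L (ℝ × P))
    (h : ∀ t, (V.slice t).AgreeAt (V.slice 0) p) (e : Fin 2 → ℝ × P) :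
    V.gfluxFst g e (1, 0) (0, p) = 0 := by
  have hp := V.inChart_body (0, p)
  have hn := nab_time_eq_zero g hp h
  unfold gfluxFst fluxFst
  rw [pair_eq_zero_left g (dc_time_eq_zero hp h), pair_eq_zero_right g _ (hn 0),
    pair_eq_zero_right g _ (hn 1)]
  simp

theorem gfluxSnd_time_eq_zero (V : Multiplet n M L (ℝ × P))
    (h : ∀ t, (V.slice t).AgreeAt (V.slice 0) p) (e : Fin 2 → ℝ × P) :
    V.gfluxSnd g e (1, 0) (0, p) = 0 := by
  have hp := V.inChart_body (0, p)
  have hn := nab_time_eq_zero g hp h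
  unfold gfluxSnd fluxSnd
  rw [pair_eq_zero_left g (dc_time_eq_zero hp h), pair_eq_zero_right g _ (hn 0),
    pair_eq_zero_right g _ (hn 1)]
  simp

end Slice

/-! ### First variation of the action over a compact region -/

section Action

variable {n : ℕ} {M : Type*} [TopologicalSpace M] [ChartedSpace (Eucl n) M] {L : ℕ}
  [IsManifold (𝓡 n) ∞ M] (g : Metric n M) [T2Space M]

/-- The coordinate directions of `ℝ²`. -/
def stdDir : Fin 2 → ℝ × ℝ := ![(1, 0), (0, 1)]

/-- The curvature sum is six times the single term of `lagIn`, and 6/12 = 1/2; the other terms agree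
by definition. -/
theorem lagrangianInChart_eq {Φ : Multiplet n M L (ℝ × ℝ)} {c : M} {p : ℝ × ℝ}
    (hp : Φ.InChart c p) : Φ.lagrangianInChart c g p = Φ.lagIn c g stdDir p := by
  have h1 : ∀ X Y Z W : Sec n L (ℝ × ℝ), Φ.inner c g X (Φ.curv c g Y Z W) p
      = Φ.quart c g X Y Z W p := fun X Y Z W => pair_curvSec g hp X Y Z W
  unfold lagrangianInChart
  simp only [h1]
  change _ + _ + (1 / 12 : ℝ) • (∑ a, ∑ b, ∑ d, ∑ e, (eps a b * eps d e)
        • Φ.quart c g (Φ.ψSec c a) (Φ.ψSec c b) (Φ.ψSec c d) (Φ.ψSec c e) p) + _ = _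
  rw [eps_quart g hp, smul_smul, Fin.sum_univ_two,
    show (1 / 12 : ℝ) * 6 = 1 / 2 by norm_num]
  rfl

theorem lagrangian_eq (Φ : Multiplet n M L (ℝ × ℝ)) (p : ℝ × ℝ) :
    Φ.lagrangian g p = Φ.lag g stdDir p := lagrangianInChart_eq g (Φ.inChart_body p)

/-- The first variation of the action. -/
theorem hasDerivAt_action (hR : ParallelCurvature g) (V : Multiplet n M L (ℝ × (ℝ × ℝ)))
    {K : Set (ℝ × ℝ)} (hK : IsCompact K)
    (hV : ∀ t, ∀ p ∉ K, (V.slice t).AgreeAt (V.slice 0) p) :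
    HasDerivAt (fun t : ℝ => (V.slice t).action g K)
      (∫ p in K, V.varIn (V.body (0, p)) g (lift stdDir) (1, 0) (0, p)) 0 := by
  set w : Fin 2 → ℝ × ℝ → Grassmann L := ![fun p => V.gfluxFst g (lift stdDir) (1, 0) (0, p),
    fun p => V.gfluxSnd g (lift stdDir) (1, 0) (0, p)] with hw
  have hin : ContDiff ℝ ∞ fun p : ℝ × ℝ => ((0 : ℝ), p) := contDiff_const.prodMk contDiff_id
  have hws : ∀ k, ContDiff ℝ ∞ (w k) := by
    intro k
    fin_cases k
    · exact (contDiff_gfluxFst g V _ _).comp hin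
    · exact (contDiff_gfluxSnd g V _ _).comp hin
  have hw0 : ∀ k, ∀ p ∉ K, w k p = 0 := by
    intro k p hp
    fin_cases k
    · exact gfluxFst_time_eq_zero g V (fun t => hV t p hp) _
    · exact gfluxSnd_time_eq_zero g V (fun t => hV t p hp) _
  have hwc : ∀ k, HasCompactSupport (w k) := fun k => HasCompactSupport.intro hK (hw0 k)
  have hd0 : ∀ k, ∀ p ∉ K, fderiv ℝ (w k) p (stdDir k) = 0 := by
    intro k p hp
    have h1 : w k =ᶠ[𝓝 p] fun _ => 0 := by
      filter_upwards [hK.isClosed.isOpen_compl.mem_nhds hp] with q hq using hw0 k q hq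
    rw [h1.fderiv_eq]
    simp
  have hdc : ∀ k, Continuous fun p => fderiv ℝ (w k) p (stdDir k) := fun k =>
    ((hws k).continuous_fderiv (by simp)).clm_apply continuous_const
  -- The derivative of the flux vanishes outside K, so the integral over K is one over the whole
  -- plane. No regularity of the boundary of K is needed.
  have hint : ∀ k, ∫ p in K, fderiv ℝ (w k) p (stdDir k) = 0 := fun k => by
    rw [setIntegral_eq_integral_of_forall_compl_eq_zero (hd0 k)]
    exact integral_fderiv_eq_zero (hws k) (hwc k) _
  have hlag := contDiff_lag g V (lift stdDir)
  -- The variation density is a smooth time derivative minus a divergence. Although its chart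
  -- depends on p, it is therefore continuous and integrable over K.
  have key : ∀ p, V.varIn (V.body (0, p)) g (lift stdDir) (1, 0) (0, p)
      = fderiv ℝ (V.lag g (lift stdDir)) (0, p) (1, 0)
        - (fderiv ℝ (w 0) p (stdDir 0) + fderiv ℝ (w 1) p (stdDir 1)) := by
    intro p
    have h0 : fderiv ℝ (w 0) p (stdDir 0)
        = fderiv ℝ (V.gfluxFst g (lift stdDir) (1, 0)) (0, p) (lift stdDir 0) :=
      fderiv_slice ((contDiff_gfluxFst g V _ _).differentiable (by simp) _) _
    have h1 : fderiv ℝ (w 1) p (stdDir 1)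
        = fderiv ℝ (V.gfluxSnd g (lift stdDir) (1, 0)) (0, p) (lift stdDir 1) :=
      fderiv_slice ((contDiff_gfluxSnd g V _ _).differentiable (by simp) _) _
    rw [h0, h1, fderiv_lag g hR (V.inChart_body (0, p))]
    abel
  have hcl : Continuous fun p : ℝ × ℝ => fderiv ℝ (V.lag g (lift stdDir)) (0, p) (1, 0) :=
    ((hlag.continuous_fderiv (by simp)).comp hin.continuous).clm_apply continuous_const
  have hi : ∀ k, IntegrableOn (fun p => fderiv ℝ (w k) p (stdDir k)) K := fun k =>
    (hdc k).continuousOn.integrableOn_compact hK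
  have hval : ∫ p in K, V.varIn (V.body (0, p)) g (lift stdDir) (1, 0) (0, p)
      = ∫ p in K, fderiv ℝ (V.lag g (lift stdDir)) (0, p) (1, 0) := by
    have hi' : IntegrableOn (fun p => fderiv ℝ (w 0) p (stdDir 0) + fderiv ℝ (w 1) p (stdDir 1)) K :=
      (hi 0).add (hi 1)
    simp only [key]
    rw [integral_sub (hcl.continuousOn.integrableOn_compact hK) hi',
      integral_add (hi 0) (hi 1), hint, hint, add_zero, sub_zero]
  rw [hval]
  have h1 := hasDerivAt_integral_of_contDiff hlag hK
  have h2 : (fun t : ℝ => (V.slice t).action g K)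
      = fun t => ∫ p in K, V.lag g (lift stdDir) (t, p) := by
    funext t
    unfold action
    simp only [lagrangian_eq, lag_slice]
  rw [h2]
  exact h1

end Action

end Multiplet

/-! ### Extension of the odd parameters -/

theorem fderiv_inclusion {P : Type*} [NormedAddCommGroup P] [NormedSpace ℝ P] {L : ℕ} (L' : ℕ)
    {f : P → Grassmann L} {p : P} (hf : DifferentiableAt ℝ f p) (v : P) :
    fderiv ℝ (fun q => inclusion L L' (f q)) p v = inclusion L L' (fderiv ℝ f p v) :=
  congrArg (fun T => T v) ((LinearMap.toContinuousLinearMap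
    (inclusion L L').toLinearMap).hasFDerivAt.comp p hf.hasFDerivAt).fderiv

theorem inclusion_injective {L L' : ℕ} (h : L ≤ L') : Function.Injective (inclusion L L') := by
  refine ExteriorAlgebra.map_injective_field (LinearMap.ker_eq_bot.mpr fun v w hvw => ?_)
  funext i
  have h1 := congrFun hvw ⟨i, i.2.trans_le h⟩
  simpa [extendZero] using h1

/-- Existence and choice of the representative depend only on the function, not on the functional,
so both sides use the same one. -/
theorem germEval_inclusion {n : ℕ} {M : Type*} [TopologicalSpace M] [ChartedSpace (Eucl n) M]
    {L : ℕ} (L' : ℕ) (D : SmoothFun n M →ₗ[ℝ] Grassmann L) (m : M) (h : M → ℝ) :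
    germEval ((inclusion L L').toLinearMap ∘ₗ D) m h = inclusion L L' (germEval D m h) := by
  unfold germEval
  split_ifs
  · rfl
  · exact (map_zero _).symm

namespace Multiplet

section BaseChange

variable {n : ℕ} {M : Type*} [TopologicalSpace M] [ChartedSpace (Eucl n) M] {L : ℕ}
  {P : Type*} [NormedAddCommGroup P] [NormedSpace ℝ P] {Φ : Multiplet n M L P} {c : M} (L' : ℕ)

theorem cf_baseChange (T : Eucl n → ℝ) (p : P) :
    (Φ.baseChange L').cf c T p = inclusion L L' (Φ.cf c T p) :=
  germEval_inclusion L' (Φ.pull p).toLinearMap _ _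

theorem ψSec_baseChange (a : Fin 2) (p : P) (i : Fin n) :
    (Φ.baseChange L').ψSec c a p i = inclusion L L' (Φ.ψSec c a p i) :=
  germEval_inclusion L' (Φ.ψ a p) _ _

theorem FSec_baseChange (p : P) (i : Fin n) :
    (Φ.baseChange L').FSec c p i = inclusion L L' (Φ.FSec c p i) :=
  germEval_inclusion L' (Φ.F p) _ _

variable [IsManifold (𝓡 n) ∞ M] (g : Metric n M) [T2Space M] {p : P}

theorem dc_baseChange (hp : Φ.InChart c p) (v : P) (i : Fin n) :
    (Φ.baseChange L').dc c v p i = inclusion L L' (Φ.dc c v p i) := by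
  unfold dc
  rw [funext (cf_baseChange L' fun x => x i)]
  exact fderiv_inclusion L' (smoothNear_cf hp (smoothNear_coord i _)).differentiableAt v

theorem nab_baseChange (hp : Φ.InChart c p) (v : P) {Y : Sec n L P} {Y' : Sec n L' P}
    (hY : SecSmooth Y p) (h : ∀ᶠ q in 𝓝 p, ∀ i, Y' q i = inclusion L L' (Y q i)) (l : Fin n) :
    (Φ.baseChange L').nab g c v Y' p l = inclusion L L' (Φ.nab g c v Y p l) := by
  have h1 : (fun q => Y' q l) =ᶠ[𝓝 p] fun q => inclusion L L' (Y q l) := h.mono fun q hq => hq l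
  unfold nab
  rw [h1.fderiv_eq, fderiv_inclusion L' (hY l).differentiableAt]
  simp only [cf_baseChange, dc_baseChange L' hp, h.self_of_nhds, map_add, map_sum, map_mul]

theorem curvSec_baseChange {X Y Z : Sec n L P} {X' Y' Z' : Sec n L' P}
    (hX : ∀ i, X' p i = inclusion L L' (X p i)) (hY : ∀ i, Y' p i = inclusion L L' (Y p i))
    (hZ : ∀ i, Z' p i = inclusion L L' (Z p i)) (l : Fin n) :
    (Φ.baseChange L').curvSec g c X' Y' Z' p l = inclusion L L' (Φ.curvSec g c X Y Z p l) := by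
  unfold curvSec
  simp only [cf_baseChange, hX, hY, hZ, map_sum, map_mul]

theorem nab_ψSec_baseChange (hp : Φ.InChart c p) (v : P) (a : Fin 2) (l : Fin n) :
    (Φ.baseChange L').nab g c v ((Φ.baseChange L').ψSec c a) p l
      = inclusion L L' (Φ.nab g c v (Φ.ψSec c a) p l) :=
  nab_baseChange L' g hp v (secSmooth_ψSec hp a)
    (Filter.Eventually.of_forall fun q => ψSec_baseChange L' a q) l

theorem nab_dc_baseChange (hp : Φ.InChart c p) (v w : P) (l : Fin n) :
    (Φ.baseChange L').nab g c v ((Φ.baseChange L').dc c w) p l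
      = inclusion L L' (Φ.nab g c v (Φ.dc c w) p l) :=
  nab_baseChange L' g hp v (secSmooth_dc hp w)
    (hp.eventually.mono fun _ hq => dc_baseChange L' hq w) l

theorem elU_baseChange (hp : Φ.InChart c p) (e : Fin 2 → P) (l : Fin n) :
    (Φ.baseChange L').elU c g e p l = inclusion L L' (Φ.elU c g e p l) := by
  have hψ := fun a => ψSec_baseChange (Φ := Φ) (c := c) L' a p
  have hu := fun v => dc_baseChange L' hp v
  unfold elU
  simp only [nab_dc_baseChange L' g hp, curvSec_baseChange L' g (hψ 0) (hψ 0) (hu (e 0)),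
    curvSec_baseChange L' g (hψ 1) (hψ 1) (hu (e 0)),
    curvSec_baseChange L' g (hψ 0) (hψ 1) (hu (e 1)), map_add, map_sub, map_smul]

theorem elFst_baseChange (hp : Φ.InChart c p) (e : Fin 2 → P) (l : Fin n) :
    (Φ.baseChange L').elFst c g e p l = inclusion L L' (Φ.elFst c g e p l) := by
  have hψ := fun a => ψSec_baseChange (Φ := Φ) (c := c) L' a p
  unfold elFst diracSnd
  simp only [nab_ψSec_baseChange L' g hp, curvSec_baseChange L' g (hψ 0) (hψ 1) (hψ 1), map_add,
    map_sub, map_neg]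

theorem elSnd_baseChange (hp : Φ.InChart c p) (e : Fin 2 → P) (l : Fin n) :
    (Φ.baseChange L').elSnd c g e p l = inclusion L L' (Φ.elSnd c g e p l) := by
  have hψ := fun a => ψSec_baseChange (Φ := Φ) (c := c) L' a p
  unfold elSnd diracFst
  simp only [nab_ψSec_baseChange L' g hp, curvSec_baseChange L' g (hψ 0) (hψ 1) (hψ 0), map_sub]

end BaseChange

/-! ### The Euler-Lagrange equations imply criticality -/

section EulerLagrange

variable {n : ℕ} {M : Type*} [TopologicalSpace M] [ChartedSpace (Eucl n) M] {L : ℕ}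
  [IsManifold (𝓡 n) ∞ M] (g : Metric n M) [T2Space M]

/-- The Euler-Lagrange equations at `p` in the chart at `c`. -/
structure SolvesAt (Φ : Multiplet n M L (ℝ × ℝ)) (c : M) (p : ℝ × ℝ) : Prop where
  u : Φ.elU c g stdDir p = 0
  fst : Φ.elFst c g stdDir p = 0
  snd : Φ.elSnd c g stdDir p = 0
  F : Φ.F p = 0

/-- For the parameter space ℝ² and its coordinate directions, the expressions over a general
parameter space unfold to those of the Lagrangian; only terms are moved across the equations. -/
theorem solvesAt_iff (Φ : Multiplet n M L (ℝ × ℝ)) (c : M) (p : ℝ × ℝ) : Φ.SolvesAt g c p ↔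
    (∀ l, Φ.laplacian c g p l =
      (1 / 2 : ℝ) • (Φ.curv c g (Φ.ψComp c 0) (Φ.ψComp c 0) (Φ.du c 0) p l
          - Φ.curv c g (Φ.ψComp c 1) (Φ.ψComp c 1) (Φ.du c 0) p l)
        + Φ.curv c g (Φ.ψComp c 0) (Φ.ψComp c 1) (Φ.du c 1) p l) ∧
    (∀ l, Φ.dirac₁ c g p l = Φ.curv c g (Φ.ψComp c 0) (Φ.ψComp c 1) (Φ.ψComp c 0) p l) ∧
    (∀ l, Φ.dirac₂ c g p l = - Φ.curv c g (Φ.ψComp c 0) (Φ.ψComp c 1) (Φ.ψComp c 1) p l) ∧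
    Φ.F p = 0 := by
  constructor
  · rintro ⟨h1, h2, h3, h4⟩
    exact ⟨fun l => sub_eq_zero.mp (congrFun h1 l), fun l => sub_eq_zero.mp (congrFun h3 l),
      fun l => eq_neg_of_add_eq_zero_left (congrFun h2 l), h4⟩
  · rintro ⟨h1, h2, h3, h4⟩
    exact ⟨funext fun l => sub_eq_zero.mpr (h1 l),
      funext fun l => (congrArg (· + _) (h3 l)).trans (neg_add_cancel _),
      funext fun l => sub_eq_zero.mpr (h2 l), h4⟩

variable {Φ : Multiplet n M L (ℝ × ℝ)} {L' : ℕ} {V : Multiplet n M L' (ℝ × (ℝ × ℝ))}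

theorem slice_zero_eq (h0 : ∀ p, (V.slice 0).AgreeAt (Φ.baseChange L') p) :
    V.slice 0 = Φ.baseChange L' := eq_of_agreeAt h0

variable {c : M} {p : ℝ × ℝ} (h0 : V.slice 0 = Φ.baseChange L')

include h0

theorem inChart_family : V.InChart c (0, p) ↔ Φ.InChart c p :=
  iff_of_eq (congrArg (fun Ψ : Multiplet n M L' (ℝ × ℝ) => Ψ.InChart c p) h0)

theorem cf_family (T : Eucl n → ℝ) : V.cf c T (0, p) = inclusion L L' (Φ.cf c T p) :=
  (congrArg (fun Ψ : Multiplet n M L' (ℝ × ℝ) => Ψ.cf c T p) h0).trans (cf_baseChange L' T p)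

theorem elU_family (hp : Φ.InChart c p) (l : Fin n) :
    V.elU c g (lift stdDir) (0, p) l = inclusion L L' (Φ.elU c g stdDir p l) := by
  rw [← elU_slice g ((inChart_family h0).mpr hp), h0, elU_baseChange L' g hp]

theorem elFst_family (hp : Φ.InChart c p) (l : Fin n) :
    V.elFst c g (lift stdDir) (0, p) l = inclusion L L' (Φ.elFst c g stdDir p l) := by
  rw [← elFst_slice g ((inChart_family h0).mpr hp), h0, elFst_baseChange L' g hp]

theorem elSnd_family (hp : Φ.InChart c p) (l : Fin n) :
    V.elSnd c g (lift stdDir) (0, p) l = inclusion L L' (Φ.elSnd c g stdDir p l) := by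
  rw [← elSnd_slice g ((inChart_family h0).mpr hp), h0, elSnd_baseChange L' g hp]

theorem FSec_family (l : Fin n) : V.FSec c (0, p) l = inclusion L L' (Φ.FSec c p l) :=
  (congrArg (fun Ψ : Multiplet n M L' (ℝ × ℝ) => Ψ.FSec c p l) h0).trans
    (FSec_baseChange L' p l)

omit h0

theorem FSec_eq_zero (hF : Φ.F p = 0) : Φ.FSec c p = 0 := by
  funext i
  unfold FSec comp chartEval germEval
  rw [hF]
  split_ifs <;> rfl

/-- Each term of the variation density pairs the variation with an Euler–Lagrange expression or with
F'. These vanish for Φ, hence also after extending the odd parameters, whatever the family is. -/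
theorem isCritical_of_solves (hR : ParallelCurvature g)
    (h : ∀ p c, Φ.InChart c p → Φ.SolvesAt g c p) : Φ.IsCritical g := by
  intro L' _ K hK V h0 hV
  have h0' := slice_zero_eq h0
  have hd := hasDerivAt_action g hR V hK fun t p hp => h0' ▸ hV t p hp
  have hz : ∀ p, V.varIn (V.body (0, p)) g (lift stdDir) (1, 0) (0, p) = 0 := by
    intro p
    have hp : Φ.InChart (V.body (0, p)) p := (inChart_family h0').mp (V.inChart_body (0, p))
    obtain ⟨h1, h2, h3, h4⟩ := h p _ hp
    unfold varIn
    rw [pair_eq_zero_right g _ (funext fun l => (elU_family g h0' hp l).trans (by rw [h1]; simp)),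
      pair_eq_zero_right g _ (funext fun l => (elFst_family g h0' hp l).trans (by rw [h2]; simp)),
      pair_eq_zero_right g _ (funext fun l => (elSnd_family g h0' hp l).trans (by rw [h3]; simp)),
      pair_eq_zero_right g _ (funext fun l => (FSec_family h0' l).trans
        (by rw [FSec_eq_zero h4]; simp))]
    simp
  simpa only [hz, integral_zero] using hd

end EulerLagrange

end Multiplet

/-! ### Linear families of multiplets -/

theorem fderiv_time_eq {P G : Type*} [NormedAddCommGroup P] [NormedSpace ℝ P]
    [NormedAddCommGroup G] [NormedSpace ℝ G] {f : ℝ × P → G} {p : P} {a b : G}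
    (hf : DifferentiableAt ℝ f (0, p)) (hc : ∀ t, f (t, p) = a + t • b) :
    fderiv ℝ f (0, p) (1, 0) = b := by
  have h1 : HasDerivAt (fun t : ℝ => (t, p)) ((1 : ℝ), (0 : P)) 0 :=
    (hasDerivAt_id (0 : ℝ)).prodMk (hasDerivAt_const 0 p)
  have h2 := hf.hasFDerivAt.comp_hasDerivAt (0 : ℝ) h1
  have h3 : (f ∘ fun t : ℝ => (t, p)) = fun t => a + t • b := funext hc
  rw [h3] at h2
  have h4 : HasDerivAt (fun t : ℝ => a + t • b) ((1 : ℝ) • b) 0 :=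
    ((hasDerivAt_id (0 : ℝ)).smul_const b).const_add a
  rw [one_smul] at h4
  exact h2.unique h4

theorem germEval_add_smul {n : ℕ} {M : Type*} [TopologicalSpace M] [ChartedSpace (Eucl n) M]
    {L : ℕ} (T S : SmoothFun n M →ₗ[ℝ] Grassmann L) (t : ℝ) (m : M) (h : M → ℝ) :
    germEval (T + t • S) m h = germEval T m h + t • germEval S m h := by
  unfold germEval
  split_ifs
  · rfl
  · simp

/-- An infinitesimal variation of a multiplet which integrates to a family that is linear in
the time. -/
structure Variation {n : ℕ} {M : Type*} [TopologicalSpace M] [ChartedSpace (Eucl n) M] {L : ℕ}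
    {P : Type*} [NormedAddCommGroup P] [NormedSpace ℝ P] (Ψ : Multiplet n M L P) where
  A : P → SmoothFun n M →ₗ[ℝ] Grassmann L
  B : Fin 2 → P → SmoothFun n M →ₗ[ℝ] Grassmann L
  C : P → SmoothFun n M →ₗ[ℝ] Grassmann L
  A_even : ∀ p f, A p f ∈ evenPart L
  bodyMap_A : ∀ p f, bodyMap L (A p f) = 0
  A_leibniz : ∀ p, IsDerivAlong (Ψ.pull p) (A p)
  A_mul_A : ∀ p f h, A p f * A p h = 0
  B_odd : ∀ a p f, B a p f ∈ oddPart L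
  B_leibniz : ∀ a p f h, B a p (f * h) = Ψ.pull p f * B a p h + Ψ.pull p h * B a p f
    + (A p f * Ψ.ψ a p h + A p h * Ψ.ψ a p f)
  A_mul_B : ∀ a p f h, A p f * B a p h = 0
  C_even : ∀ p f, C p f ∈ evenPart L
  C_leibniz : ∀ p f h, C p (f * h) = Ψ.pull p f * C p h + Ψ.pull p h * C p f
    + (A p f * Ψ.F p h + A p h * Ψ.F p f)
  A_mul_C : ∀ p f h, A p f * C p h = 0
  contDiff_A : ∀ f, ContDiff ℝ ∞ fun p => A p f
  contDiff_B : ∀ a f, ContDiff ℝ ∞ fun p => B a p f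
  contDiff_C : ∀ f, ContDiff ℝ ∞ fun p => C p f

namespace Variation

section Family

variable {n : ℕ} {M : Type*} [TopologicalSpace M] [ChartedSpace (Eucl n) M] {L : ℕ}
  {P : Type*} [NormedAddCommGroup P] [NormedSpace ℝ P] {Ψ : Multiplet n M L P} (W : Variation Ψ)

theorem contDiff_line {f h : P → Grassmann L} (hf : ContDiff ℝ ∞ f) (hh : ContDiff ℝ ∞ h) :
    ContDiff ℝ ∞ fun q : ℝ × P => f q.2 + q.1 • h q.2 :=
  (hf.comp contDiff_snd).add (contDiff_fst.smul (hh.comp contDiff_snd))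

/-- The vanishing products remove the terms of order t². This is what makes a family linear in time
satisfy the Leibniz rules for every t and not only to first order. -/
theorem line_leibniz {a b a' b' x y x' y' : Grassmann L} (t : ℝ) (h1 : a' * y' = 0)
    (h2 : b' * x' = 0) : a * y + b * x + t • (a * y' + b * x' + (a' * y + b' * x))
      = (a + t • a') * (y + t • y') + (b + t • b') * (x + t • x') := by
  simp only [add_mul, mul_add, smul_mul_assoc, mul_smul_comm, h1, h2, smul_zero, smul_add]
  abel

/-- The members of the family. -/
def family : Multiplet n M L (ℝ × P) where
  body q := Ψ.body q.2
  pull q := AlgHom.ofLinearMap ((Ψ.pull q.2).toLinearMap + q.1 • W.A q.2)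
    (by
      have h1 : W.A q.2 1 = 0 := by
        have := W.A_leibniz q.2 1 1
        rw [mul_one, map_one (Ψ.pull q.2), one_mul] at this
        exact left_eq_add.mp this
      change Ψ.pull q.2 1 + q.1 • W.A q.2 1 = 1
      rw [h1, map_one, smul_zero, add_zero])
    (fun f h => by
      change Ψ.pull q.2 (f * h) + q.1 • W.A q.2 (f * h)
        = (Ψ.pull q.2 f + q.1 • W.A q.2 f) * (Ψ.pull q.2 h + q.1 • W.A q.2 h)
      rw [map_mul, W.A_leibniz q.2 f h, even_comm (Ψ.pull_even q.2 h)]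
      simp only [add_mul, mul_add, smul_mul_assoc, mul_smul_comm, W.A_mul_A, smul_zero, smul_add]
      abel)
  ψ a q := Ψ.ψ a q.2 + q.1 • W.B a q.2
  F q := Ψ.F q.2 + q.1 • W.C q.2
  pull_even q f := add_mem (Ψ.pull_even _ f) (Submodule.smul_mem _ _ (W.A_even _ f))
  bodyMap_pull q f := by
    change bodyMap L (Ψ.pull q.2 f + q.1 • W.A q.2 f) = _
    rw [map_add, map_smul, W.bodyMap_A, smul_zero, add_zero, Ψ.bodyMap_pull]
  ψ_odd a q f := add_mem (Ψ.ψ_odd a _ f) (Submodule.smul_mem _ _ (W.B_odd a _ f))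
  ψ_leibniz a q f h := by
    change Ψ.ψ a q.2 (f * h) + q.1 • W.B a q.2 (f * h)
      = (Ψ.pull q.2 f + q.1 • W.A q.2 f) * (Ψ.ψ a q.2 h + q.1 • W.B a q.2 h)
        + (Ψ.pull q.2 h + q.1 • W.A q.2 h) * (Ψ.ψ a q.2 f + q.1 • W.B a q.2 f)
    rw [Ψ.ψ_leibniz, W.B_leibniz, line_leibniz q.1 (W.A_mul_B a q.2 f h) (W.A_mul_B a q.2 h f)]
  F_even q f := add_mem (Ψ.F_even _ f) (Submodule.smul_mem _ _ (W.C_even _ f))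
  F_leibniz q f h := by
    change Ψ.F q.2 (f * h) + q.1 • W.C q.2 (f * h)
      = (Ψ.pull q.2 f + q.1 • W.A q.2 f) * (Ψ.F q.2 h + q.1 • W.C q.2 h)
        + (Ψ.pull q.2 h + q.1 • W.A q.2 h) * (Ψ.F q.2 f + q.1 • W.C q.2 f)
    rw [Ψ.F_leibniz, W.C_leibniz, line_leibniz q.1 (W.A_mul_C q.2 f h) (W.A_mul_C q.2 h f)]
  contMDiff_body := Ψ.contMDiff_body.comp (contDiff_snd (𝕜 := ℝ) (E := ℝ) (F := P)).contMDiff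
  contDiff_pull f := contDiff_line (Ψ.contDiff_pull f) (W.contDiff_A f)
  contDiff_ψ a f := contDiff_line (Ψ.contDiff_ψ a f) (W.contDiff_B a f)
  contDiff_F f := contDiff_line (Ψ.contDiff_F f) (W.contDiff_C f)

theorem agreeAt_family {t : ℝ} {p : P} (hA : t • W.A p = 0) (hB : ∀ a, t • W.B a p = 0)
    (hC : t • W.C p = 0) : (W.family.slice t).AgreeAt Ψ p := by
  refine ⟨rfl, ?_, fun a => ?_, ?_⟩
  · refine AlgHom.ext fun f => ?_
    change Ψ.pull p f + (t • W.A p) f = _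
    rw [hA, LinearMap.zero_apply, add_zero]
  · change Ψ.ψ a p + t • W.B a p = _
    rw [hB, add_zero]
  · change Ψ.F p + t • W.C p = _
    rw [hC, add_zero]

variable [IsManifold (𝓡 n) ∞ M] [T2Space M] {c : M} {p : P} (g : Metric n M)

theorem dc_family (hp : Ψ.InChart c p) : W.family.dc c (1, 0) (0, p) = Ψ.comp c W.A p := by
  funext i
  have hp' : W.family.InChart c (0, p) := hp
  exact fderiv_time_eq (a := Ψ.cf c (fun x => x i) p) (b := Ψ.comp c W.A p i)
    (Multiplet.smoothNear_cf hp' (smoothNear_coord i _)).differentiableAt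
    fun t => germEval_add_smul (Ψ.pull p).toLinearMap (W.A p) t _ _

/-- If `u` is not moved, the connection term in the time direction drops out and the covariant
derivative is the coefficient of t. -/
theorem nab_ψSec_family (hp : Ψ.InChart c p) (hA : Ψ.comp c W.A p = 0) (a : Fin 2) :
    W.family.nab g c (1, 0) (W.family.ψSec c a) (0, p) = Ψ.comp c (W.B a) p := by
  funext i
  have hp' : W.family.InChart c (0, p) := hp
  have h1 := fderiv_time_eq (a := Ψ.ψSec c a p i) (b := Ψ.comp c (W.B a) p i)
    (Multiplet.secSmooth_ψSec hp' a i).differentiableAt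
    fun t => germEval_add_smul (Ψ.ψ a p) (W.B a p) t _ _
  unfold Multiplet.nab
  rw [dc_family W hp, hA, h1]
  simp only [Pi.zero_apply, mul_zero, zero_mul, Finset.sum_const_zero, add_zero]

theorem nab_FSec_family (hp : Ψ.InChart c p) (hA : Ψ.comp c W.A p = 0) :
    W.family.nab g c (1, 0) (W.family.FSec c) (0, p) = Ψ.comp c W.C p := by
  funext i
  have hp' : W.family.InChart c (0, p) := hp
  have h1 := fderiv_time_eq (a := Ψ.FSec c p i) (b := Ψ.comp c W.C p i)
    (Multiplet.secSmooth_FSec hp' i).differentiableAt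
    fun t => germEval_add_smul (Ψ.F p) (W.C p) t _ _
  unfold Multiplet.nab
  rw [dc_family W hp, hA, h1]
  simp only [Pi.zero_apply, mul_zero, zero_mul, Finset.sum_const_zero, add_zero]

end Family

end Variation

/-! ### Coordinate derivatives along a map, cut off by a bump function -/

section BumpDeriv

variable {n : ℕ} {M : Type*} [TopologicalSpace M] [ChartedSpace (Eucl n) M] {L : ℕ}
  [IsManifold (𝓡 n) ∞ M] [T2Space M]

/-- A smooth function written in the chart at `c`. -/
def inCoord (c : M) (f : SmoothFun n M) (x : Eucl n) : ℝ := f ((extChartAt (𝓡 n) c).symm x)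

variable {c m : M} (hm : m ∈ (extChartAt (𝓡 n) c).source)
include hm

theorem smoothNear_inCoord (f : SmoothFun n M) : SmoothNear (inCoord c f) (extChartAt (𝓡 n) c m) := by
  have h1 : ContMDiffOn 𝓘(ℝ, Eucl n) 𝓘(ℝ, ℝ) ∞ (inCoord c f) (extChartAt (𝓡 n) c).target :=
    f.contMDiff.comp_contMDiffOn (contMDiffOn_extChartAt_symm c)
  exact SmoothNear.of_contDiffOn h1.contDiffOn (isOpen_extChartAt_target c)
    ((extChartAt (𝓡 n) c).map_source hm)

theorem chartEval_inCoord {T : SmoothFun n M →ₗ[ℝ] Grassmann L} (hT : IsLocalAt T m)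
    (f : SmoothFun n M) : chartEval T m c (inCoord c f) = T f := by
  refine chartEval_eq hT ?_
  filter_upwards [(isOpen_extChartAt_source c).mem_nhds hm] with m' hm'
  rw [inCoord, (extChartAt (𝓡 n) c).left_inv hm']

omit hm in
theorem partialDeriv_congr {S T : Eucl n → ℝ} {x : Eucl n} (h : S =ᶠ[𝓝 x] T) (j : Fin n) :
    partialDeriv j S =ᶠ[𝓝 x] partialDeriv j T :=
  h.eventuallyEq_nhds.mono fun y hy => by
    unfold partialDeriv
    rw [hy.fderiv_eq]

/-- The value of `T` on the coordinate derivatives of functions. -/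
def coordDeriv (T : SmoothFun n M →ₗ[ℝ] Grassmann L) (m c : M) (j : Fin n) (f : SmoothFun n M) :
    Grassmann L := chartEval T m c (partialDeriv j (inCoord c f))

theorem coordDeriv_add {T : SmoothFun n M →ₗ[ℝ] Grassmann L} (hT : IsLocalAt T m) (j : Fin n)
    (f h : SmoothFun n M) :
    coordDeriv T m c j (f + h) = coordDeriv T m c j f + coordDeriv T m c j h := by
  have hf := smoothNear_inCoord hm f
  have hh := smoothNear_inCoord hm h
  unfold coordDeriv
  rw [← chartEval_add hm hT (smoothNear_partialDeriv j hf) (smoothNear_partialDeriv j hh)]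
  refine chartEval_congr T hm ?_
  filter_upwards [hf.eventually, hh.eventually] with y h1 h2
  exact congrArg (fun A => A (EuclideanSpace.single j 1))
    (fderiv_add h1.differentiableAt h2.differentiableAt)

theorem coordDeriv_smul {T : SmoothFun n M →ₗ[ℝ] Grassmann L} (hT : IsLocalAt T m) (j : Fin n)
    (r : ℝ) (f : SmoothFun n M) :
    coordDeriv T m c j (r • f) = r • coordDeriv T m c j f := by
  have hf := smoothNear_inCoord hm f
  unfold coordDeriv
  rw [← chartEval_smul hm hT r (smoothNear_partialDeriv j hf)]
  refine chartEval_congr T hm ?_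
  filter_upwards [hf.eventually] with y h1
  exact congrArg (fun A => A (EuclideanSpace.single j 1)) (fderiv_const_smul h1.differentiableAt r)

omit hm in
theorem partialDeriv_inCoord_mul {x : Eucl n} (j : Fin n) {f h : SmoothFun n M}
    (hf : SmoothNear (inCoord c f) x) (hh : SmoothNear (inCoord c h) x) :
    partialDeriv j (inCoord c (f * h)) =ᶠ[𝓝 x] fun y =>
      inCoord c f y * partialDeriv j (inCoord c h) y
        + inCoord c h y * partialDeriv j (inCoord c f) y := by
  filter_upwards [hf.eventually, hh.eventually] with y h1 h2
  exact congrArg (fun A => A (EuclideanSpace.single j 1))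
    (fderiv_mul h1.differentiableAt h2.differentiableAt)

theorem coordDeriv_mul {A : SmoothFun n M →ₐ[ℝ] Grassmann L} (hA : IsPointOver A m) (j : Fin n)
    (f h : SmoothFun n M) : coordDeriv A.toLinearMap m c j (f * h)
      = A f * coordDeriv A.toLinearMap m c j h + A h * coordDeriv A.toLinearMap m c j f := by
  have hf := smoothNear_inCoord hm f
  have hh := smoothNear_inCoord hm h
  have hf' := smoothNear_partialDeriv j hf
  have hh' := smoothNear_partialDeriv j hh
  unfold coordDeriv
  rw [chartEval_congr _ hm (partialDeriv_inCoord_mul j hf hh),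
    chartEval_add hm hA.isLocalAt (hf.mul hh') (hh.mul hf'), chartEval_mul hm hA hf hh',
    chartEval_mul hm hA hh hf', chartEval_inCoord hm hA.isLocalAt, chartEval_inCoord hm hA.isLocalAt]
  rfl

/-- The second-order Leibniz rule for a derivation composed with a coordinate derivative. Its mixed
terms are those required of a variation of a section when `u` moves too. -/
theorem coordDeriv_deriv_mul {A : SmoothFun n M →ₐ[ℝ] Grassmann L} (hA : IsPointOver A m)
    {D : SmoothFun n M →ₗ[ℝ] Grassmann L} (hD : IsDerivAlong A D) (j : Fin n)
    (f h : SmoothFun n M) : coordDeriv D m c j (f * h)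
      = A f * coordDeriv D m c j h + A h * coordDeriv D m c j f
        + (coordDeriv A.toLinearMap m c j f * D h + coordDeriv A.toLinearMap m c j h * D f) := by
  have hf := smoothNear_inCoord hm f
  have hh := smoothNear_inCoord hm h
  have hf' := smoothNear_partialDeriv j hf
  have hh' := smoothNear_partialDeriv j hh
  have hl := hD.isLocalAt hA
  unfold coordDeriv
  rw [chartEval_congr _ hm (partialDeriv_inCoord_mul j hf hh),
    chartEval_add hm hl (hf.mul hh') (hh.mul hf'), chartEval_deriv_mul hm hA hD hf hh',
    chartEval_deriv_mul hm hA hD hh hf', chartEval_inCoord hm hl, chartEval_inCoord hm hl,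
    chartEval_inCoord hm hA.isLocalAt, chartEval_inCoord hm hA.isLocalAt]
  change A f * _ + _ + (A h * _ + _) = _
  abel

end BumpDeriv

/-! ### Test variations -/

section TestVariations

variable {n : ℕ} {M : Type*} [TopologicalSpace M] [ChartedSpace (Eucl n) M] {L : ℕ}
  [IsManifold (𝓡 n) ∞ M] [T2Space M]
  {P : Type*} [NormedAddCommGroup P] [NormedSpace ℝ P] {Ψ : Multiplet n M L P} {c : M}

theorem coordDeriv_mem {m : M} (hm : m ∈ (extChartAt (𝓡 n) c).source)
    {T : SmoothFun n M →ₗ[ℝ] Grassmann L} (hT : IsLocalAt T m) {S : Submodule ℝ (Grassmann L)}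
    (hS : ∀ f, T f ∈ S) (j : Fin n) (f : SmoothFun n M) : coordDeriv T m c j f ∈ S := by
  obtain ⟨h, hh⟩ := exists_lift hm (smoothNear_partialDeriv j (smoothNear_inCoord hm f))
  rw [coordDeriv, chartEval_eq hT hh]
  exact hS h

/-- The coordinate derivative along a family of maps, multiplied by a constant and cut off. -/
def bumpDeriv (j : Fin n) {χ : P → ℝ} (hχ : tsupport χ ⊆ {q | Ψ.InChart c q}) (k : Grassmann L)
    {T : P → SmoothFun n M →ₗ[ℝ] Grassmann L} (hT : ∀ q, IsLocalAt (T q) (Ψ.body q)) (q : P) :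
    SmoothFun n M →ₗ[ℝ] Grassmann L where
  toFun f := χ q • (k * coordDeriv (T q) (Ψ.body q) c j f)
  map_add' f h := by
    -- Where χ vanishes the body of q may lie outside the chart and the coordinate derivative may be
    -- a default value; the factor χ q makes this irrelevant.
    by_cases hq : χ q = 0
    · simp [hq]
    · rw [coordDeriv_add (hχ (subset_tsupport χ hq)) (hT q), mul_add, smul_add]
  map_smul' r f := by
    by_cases hq : χ q = 0
    · simp [hq]
    · rw [coordDeriv_smul (hχ (subset_tsupport χ hq)) (hT q), mul_smul_comm, smul_comm,
        RingHom.id_apply]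

variable (j : Fin n) {χ : P → ℝ} (hχ : tsupport χ ⊆ {q | Ψ.InChart c q}) (k : Grassmann L)
  {T : P → SmoothFun n M →ₗ[ℝ] Grassmann L} (hT : ∀ q, IsLocalAt (T q) (Ψ.body q))

theorem bumpDeriv_apply (q : P) (f : SmoothFun n M) :
    bumpDeriv j hχ k hT q f = χ q • (k * coordDeriv (T q) (Ψ.body q) c j f) := rfl

theorem bumpDeriv_eq_zero {q : P} (hq : χ q = 0) : bumpDeriv j hχ k hT q = 0 := by
  ext f
  rw [bumpDeriv_apply, hq, zero_smul, LinearMap.zero_apply]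

theorem bumpDeriv_mem {q : P} {f : SmoothFun n M} {S : Submodule ℝ (Grassmann L)}
    (hS : Ψ.InChart c q → k * coordDeriv (T q) (Ψ.body q) c j f ∈ S) :
    bumpDeriv j hχ k hT q f ∈ S := by
  by_cases hq : χ q = 0
  · rw [bumpDeriv_eq_zero j hχ k hT hq]
    exact S.zero_mem
  · exact S.smul_mem _ (hS (hχ (subset_tsupport χ hq)))

/-- On the support of χ the coordinate derivative has one global representative for all nearby
parameters; off the support the function is locally zero. -/
theorem contDiff_bumpDeriv (hχs : ContDiff ℝ ∞ χ) (hs : ∀ f, ContDiff ℝ ∞ fun q => T q f)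
    (f : SmoothFun n M) : ContDiff ℝ ∞ fun q => bumpDeriv j hχ k hT q f := by
  refine contDiff_iff_contDiffAt.mpr fun p => ?_
  by_cases hp : p ∈ tsupport χ
  · have hp' : Ψ.InChart c p := hχ hp
    obtain ⟨h, hh⟩ := Multiplet.exists_lift_near hp'
      (smoothNear_partialDeriv j (smoothNear_inCoord hp' f))
    have h1 : (fun q => bumpDeriv j hχ k hT q f) =ᶠ[𝓝 p] fun q => χ q • (k * T q h) := by
      filter_upwards [hh] with q hq
      rw [bumpDeriv_apply, coordDeriv, chartEval_eq (hT q) hq]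
    exact (hχs.contDiffAt.smul (contDiffAt_gmul contDiffAt_const
      (hs h).contDiffAt)).congr_of_eventuallyEq h1
  · have h1 : (fun q => bumpDeriv j hχ k hT q f) =ᶠ[𝓝 p] fun _ => 0 := by
      filter_upwards [(isClosed_tsupport χ).isOpen_compl.mem_nhds hp] with q hq
      rw [bumpDeriv_eq_zero j hχ k hT (image_eq_zero_of_notMem_tsupport hq), LinearMap.zero_apply]
    exact contDiffAt_const.congr_of_eventuallyEq h1

theorem pull_isLocalAt (Ψ : Multiplet n M L P) (q : P) :
    IsLocalAt (Ψ.pull q).toLinearMap (Ψ.body q) := (Ψ.isPointOver q).isLocalAt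

theorem ψ_isLocalAt (Ψ : Multiplet n M L P) (a : Fin 2) (q : P) :
    IsLocalAt (Ψ.ψ a q) (Ψ.body q) :=
  IsDerivAlong.isLocalAt (Ψ.isPointOver q) (Ψ.ψ_leibniz a q)

theorem F_isLocalAt (Ψ : Multiplet n M L P) (q : P) : IsLocalAt (Ψ.F q) (Ψ.body q) :=
  IsDerivAlong.isLocalAt (Ψ.isPointOver q) (Ψ.F_leibniz q)

theorem bumpDeriv_pull_leibniz (q : P) :
    IsDerivAlong (Ψ.pull q) (bumpDeriv j hχ k (pull_isLocalAt Ψ) q) := by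
  intro f h
  by_cases hq : χ q = 0
  · simp [bumpDeriv_eq_zero j hχ k _ hq]
  · have hm : Ψ.InChart c q := hχ (subset_tsupport χ hq)
    have e := fun f x => even_comm (Ψ.pull_even q f) (k * x)
    simp only [bumpDeriv_apply, coordDeriv_mul hm (Ψ.isPointOver q), mul_smul_comm]
    rw [e f, e h, mul_assoc, mul_assoc, ← even_comm (Ψ.pull_even q f),
      ← even_comm (Ψ.pull_even q h), mul_add, smul_add]

theorem bumpDeriv_deriv_leibniz (hD : ∀ q, IsDerivAlong (Ψ.pull q) (T q)) (q : P)
    (f h : SmoothFun n M) : bumpDeriv j hχ k hT q (f * h)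
      = Ψ.pull q f * bumpDeriv j hχ k hT q h + Ψ.pull q h * bumpDeriv j hχ k hT q f
        + (bumpDeriv j hχ k (pull_isLocalAt Ψ) q f * T q h
          + bumpDeriv j hχ k (pull_isLocalAt Ψ) q h * T q f) := by
  by_cases hq : χ q = 0
  · simp [bumpDeriv_eq_zero j hχ k _ hq]
  · have hm : Ψ.InChart c q := hχ (subset_tsupport χ hq)
    have e := fun f x => even_comm (Ψ.pull_even q f) (k * x)
    simp only [bumpDeriv_apply, coordDeriv_deriv_mul hm (Ψ.isPointOver q) (hD q), mul_smul_comm,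
      smul_mul_assoc]
    rw [e f, e h, mul_assoc, mul_assoc, ← even_comm (Ψ.pull_even q f),
      ← even_comm (Ψ.pull_even q h)]
    simp only [mul_add, smul_add, mul_assoc]

theorem coordDeriv_pull_even {q : P} (hq : Ψ.InChart c q) (f : SmoothFun n M) :
    coordDeriv (Ψ.pull q).toLinearMap (Ψ.body q) c j f ∈ evenPart L :=
  coordDeriv_mem hq (pull_isLocalAt Ψ q) (Ψ.pull_even q) j f

/-- The j-th derivative of the i-th coordinate is the Kronecker symbol, so the test variation points
in a single coordinate direction. -/
theorem comp_bumpDeriv {p : P} (hp : Ψ.InChart c p) :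
    Ψ.comp c (bumpDeriv j hχ k (pull_isLocalAt Ψ)) p
      = fun i => χ p • (k * if i = j then 1 else 0) := by
  funext i
  have hl : IsLocalAt (bumpDeriv j hχ k (pull_isLocalAt Ψ) p) (Ψ.body p) :=
    IsDerivAlong.isLocalAt (Ψ.isPointOver p) (bumpDeriv_pull_leibniz j hχ k p)
  obtain ⟨h, hh⟩ := exists_lift hp (smoothNear_coord i _)
  have h1 : inCoord c h =ᶠ[𝓝 (extChartAt (𝓡 n) c (Ψ.body p))] fun x => x i := by
    have h2 : ContinuousAt (extChartAt (𝓡 n) c).symm (extChartAt (𝓡 n) c (Ψ.body p)) :=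
      continuousAt_extChartAt_symm' hp
    have h3 : (extChartAt (𝓡 n) c).symm (extChartAt (𝓡 n) c (Ψ.body p)) = Ψ.body p :=
      (extChartAt (𝓡 n) c).left_inv hp
    rw [ContinuousAt, h3] at h2
    filter_upwards [h2.eventually hh, (isOpen_extChartAt_target c).mem_nhds
      ((extChartAt (𝓡 n) c).map_source hp)] with x hx hx'
    rw [inCoord, hx, (extChartAt (𝓡 n) c).right_inv hx']
  have h4 : partialDeriv j (inCoord c h) =ᶠ[𝓝 (extChartAt (𝓡 n) c (Ψ.body p))]
      fun _ => if i = j then 1 else 0 :=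
    (partialDeriv_congr h1 j).trans (Filter.Eventually.of_forall fun x => partialDeriv_coord j i x)
  change chartEval _ _ _ _ = _
  rw [chartEval_eq hl hh, bumpDeriv_apply, coordDeriv, chartEval_congr _ hp h4,
    chartEval_const (Ψ.isPointOver p)]
  split_ifs <;> simp

/-- A variation of the sections `ψ₁`, `ψ₂`, `F'` alone. -/
def sectionVar (hχs : ContDiff ℝ ∞ χ) (κ : Fin 2 → Grassmann L) (hκ : ∀ a, κ a ∈ oddPart L)
    (κF : Grassmann L) (hκF : κF ∈ evenPart L) : Variation Ψ where
  A _ := 0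
  B a := bumpDeriv j hχ (κ a) (pull_isLocalAt Ψ)
  C := bumpDeriv j hχ κF (pull_isLocalAt Ψ)
  A_even _ _ := Submodule.zero_mem _
  bodyMap_A _ _ := map_zero _
  A_leibniz _ _ _ := by simp
  A_mul_A _ _ _ := by simp
  B_odd a _ f := bumpDeriv_mem j hχ _ _ fun hq => odd_mul_even (hκ a) (coordDeriv_pull_even j hq f)
  B_leibniz a q f h := by
    rw [bumpDeriv_pull_leibniz j hχ (κ a) q f h]
    simp
  A_mul_B _ _ _ _ := by simp
  C_even _ f := bumpDeriv_mem j hχ _ _ fun hq => even_mul_even hκF (coordDeriv_pull_even j hq f)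
  C_leibniz q f h := by
    rw [bumpDeriv_pull_leibniz j hχ κF q f h]
    simp
  A_mul_C _ _ _ := by simp
  contDiff_A _ := contDiff_const
  contDiff_B _ f := contDiff_bumpDeriv j hχ _ _ hχs Ψ.contDiff_pull f
  contDiff_C f := contDiff_bumpDeriv j hχ _ _ hχs Ψ.contDiff_pull f

/-- An even k is central, so the two factors k meet and k² = 0. This provides the vanishing products
needed to vary `u` linearly in time. -/
theorem bumpDeriv_mul_bumpDeriv {T' : P → SmoothFun n M →ₗ[ℝ] Grassmann L}
    (hT' : ∀ q, IsLocalAt (T' q) (Ψ.body q)) (hk : k ∈ evenPart L) (hkk : k * k = 0) (q : P)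
    (f h : SmoothFun n M) : bumpDeriv j hχ k hT q f * bumpDeriv j hχ k hT' q h = 0 := by
  rw [bumpDeriv_apply, bumpDeriv_apply, smul_mul_smul_comm, mul_assoc,
    ← mul_assoc _ k, ← even_comm hk, ← mul_assoc, ← mul_assoc, hkk, zero_mul, zero_mul, smul_zero]

/-- A variation of `u`, moving `ψ₁`, `ψ₂`, `F'` along. -/
def mapVar (hχs : ContDiff ℝ ∞ χ) (hk : k ∈ evenPart L) (hkk : k * k = 0)
    (hkb : bodyMap L k = 0) : Variation Ψ where
  A := bumpDeriv j hχ k (pull_isLocalAt Ψ)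
  B a := bumpDeriv j hχ k (ψ_isLocalAt Ψ a)
  C := bumpDeriv j hχ k (F_isLocalAt Ψ)
  A_even _ f := bumpDeriv_mem j hχ _ _ fun hq => even_mul_even hk (coordDeriv_pull_even j hq f)
  bodyMap_A q f := by rw [bumpDeriv_apply, map_smul, map_mul, hkb, zero_mul, smul_zero]
  A_leibniz := bumpDeriv_pull_leibniz j hχ k
  A_mul_A := bumpDeriv_mul_bumpDeriv j hχ k _ _ hk hkk
  B_odd a q f := bumpDeriv_mem j hχ _ _ fun hq => even_mul_odd hk
    (coordDeriv_mem hq (ψ_isLocalAt Ψ a q) (Ψ.ψ_odd a q) j f)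
  B_leibniz a := bumpDeriv_deriv_leibniz j hχ k _ (Ψ.ψ_leibniz a)
  A_mul_B a := bumpDeriv_mul_bumpDeriv j hχ k _ _ hk hkk
  C_even q f := bumpDeriv_mem j hχ _ _ fun hq => even_mul_even hk
    (coordDeriv_mem hq (F_isLocalAt Ψ q) (Ψ.F_even q) j f)
  C_leibniz := bumpDeriv_deriv_leibniz j hχ k _ Ψ.F_leibniz
  A_mul_C := bumpDeriv_mul_bumpDeriv j hχ k _ _ hk hkk
  contDiff_A f := contDiff_bumpDeriv j hχ _ _ hχs Ψ.contDiff_pull f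
  contDiff_B a f := contDiff_bumpDeriv j hχ _ _ hχs (Ψ.contDiff_ψ a) f
  contDiff_C f := contDiff_bumpDeriv j hχ _ _ hχs Ψ.contDiff_F f

theorem sectionVar_eq_zero (hχs : ContDiff ℝ ∞ χ) (κ : Fin 2 → Grassmann L)
    (hκ : ∀ a, κ a ∈ oddPart L) (κF : Grassmann L) (hκF : κF ∈ evenPart L) {q : P}
    (hq : q ∉ tsupport χ) : (sectionVar j hχ hχs κ hκ κF hκF).A q = 0 ∧
      (∀ a, (sectionVar j hχ hχs κ hκ κF hκF).B a q = 0) ∧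
      (sectionVar j hχ hχs κ hκ κF hκF).C q = 0 :=
  ⟨rfl, fun a => bumpDeriv_eq_zero j hχ (κ a) (pull_isLocalAt Ψ)
    (image_eq_zero_of_notMem_tsupport hq),
    bumpDeriv_eq_zero j hχ κF (pull_isLocalAt Ψ) (image_eq_zero_of_notMem_tsupport hq)⟩

theorem mapVar_eq_zero (hχs : ContDiff ℝ ∞ χ) (hk : k ∈ evenPart L) (hkk : k * k = 0)
    (hkb : bodyMap L k = 0) {q : P} (hq : q ∉ tsupport χ) :
    (mapVar j hχ k hχs hk hkk hkb).A q = 0 ∧ (∀ a, (mapVar j hχ k hχs hk hkk hkb).B a q = 0) ∧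
      (mapVar j hχ k hχs hk hkk hkb).C q = 0 :=
  ⟨bumpDeriv_eq_zero j hχ k (pull_isLocalAt Ψ) (image_eq_zero_of_notMem_tsupport hq),
    fun a => bumpDeriv_eq_zero j hχ k (ψ_isLocalAt Ψ a) (image_eq_zero_of_notMem_tsupport hq),
    bumpDeriv_eq_zero j hχ k (F_isLocalAt Ψ) (image_eq_zero_of_notMem_tsupport hq)⟩

end TestVariations

/-! ### The fundamental lemma -/

/-- The fundamental lemma gives vanishing almost everywhere on U; continuity upgrades this to every
point. -/
theorem eq_zero_of_integral_smul {G : Type*} [NormedAddCommGroup G] [NormedSpace ℝ G]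
    [CompleteSpace G] {U : Set (ℝ × ℝ)} (hU : IsOpen U) {f : ℝ × ℝ → G} (hf : ContinuousOn f U)
    (h : ∀ χ : ℝ × ℝ → ℝ, ContDiff ℝ ∞ χ → HasCompactSupport χ → tsupport χ ⊆ U →
      ∫ p in tsupport χ, χ p • f p = 0) {p : ℝ × ℝ} (hp : p ∈ U) : f p = 0 := by
  have h1 : ∀ᵐ x ∂(volume : Measure (ℝ × ℝ)), x ∈ U → f x = 0 := by
    refine hU.ae_eq_zero_of_integral_contDiff_smul_eq_zero
      (hf.locallyIntegrableOn hU.measurableSet) fun χ h1 h2 h3 => ?_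
    rw [← h χ h1 h2 h3, setIntegral_eq_integral_of_forall_compl_eq_zero]
    intro x hx
    rw [image_eq_zero_of_notMem_tsupport hx, zero_smul]
  exact Measure.eqOn_open_of_ae_eq (g := fun _ => (0 : G))
    ((ae_restrict_iff' hU.measurableSet).mpr h1) hU hf continuousOn_const hp

/-! ### Two additional odd parameters -/

section OddParameters

variable (L : ℕ)

/-- The first additional direction. -/
def extraFst : Fin (L + 2) := ⟨L, by omega⟩

/-- The second additional direction. -/
def extraSnd : Fin (L + 2) := ⟨L + 1, by omega⟩

/-- The odd parameter of a direction. -/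
def oddParam {N : ℕ} (i : Fin N) : Grassmann N := ExteriorAlgebra.ι ℝ (Pi.single i 1)

theorem oddParam_mem {N : ℕ} (i : Fin N) : oddParam i ∈ oddPart N := ι_mem_odd _

theorem oddParam_mul_self {N : ℕ} (i : Fin N) : oddParam i * oddParam i = 0 :=
  ExteriorAlgebra.ι_sq_zero _

theorem bodyMap_oddParam {N : ℕ} (i : Fin N) : bodyMap N (oddParam i) = 0 := by
  simp [bodyMap, oddParam, ExteriorAlgebra.algebraMapInv]

variable {L}

/-- Contraction with the dual of the new generator removes the generator and kills the old algebra,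
so it recovers x. -/
theorem eq_zero_of_oddParam_mul {i : Fin (L + 2)} (hi : L ≤ i) {x : Grassmann L}
    (h : oddParam i * inclusion L (L + 2) x = 0) : x = 0 := by
  refine inclusion_injective (L' := L + 2) (by omega) ?_
  rw [map_zero]
  refine eq_zero_of_ι_mul (d := LinearMap.proj i) (by simp) (contractLeft_inclusion (fun v => ?_) x) h
  simp [extendZero, Nat.not_lt.mpr hi]

/-- The two new generators are removed successively: contraction with the dual of the first kills
both the second and the old algebra. -/
theorem eq_zero_of_oddParam_mul_mul {x : Grassmann L}
    (h : oddParam (extraFst L) * oddParam (extraSnd L) * inclusion L (L + 2) x = 0) : x = 0 := by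
  have hc : CliffordAlgebra.contractLeft (Q := 0) (LinearMap.proj (extraFst L))
      (inclusion L (L + 2) x) = 0 :=
    contractLeft_inclusion (fun v => by simp [extendZero, extraFst]) x
  rw [mul_assoc] at h
  refine eq_zero_of_oddParam_mul (i := extraSnd L) (by simp [extraSnd]) ?_
  refine eq_zero_of_ι_mul (d := LinearMap.proj (extraFst L)) (by simp) ?_ h
  refine (CliffordAlgebra.contractLeft_ι_mul _ _ _).trans ?_
  rw [hc]
  simp [extraFst, extraSnd]

theorem oddParam_mul_mul_self {N : ℕ} (i j : Fin N) :
    oddParam i * oddParam j * (oddParam i * oddParam j) = 0 := by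
  rw [even_comm (odd_mul_odd (oddParam_mem i) (oddParam_mem j)), mul_assoc, ← mul_assoc (oddParam j),
    odd_anticomm (oddParam_mem j) (oddParam_mem i), neg_mul, mul_assoc, oddParam_mul_self, mul_zero,
    neg_zero, mul_zero]

end OddParameters

/-! ### Critical points solve the Euler–Lagrange equations -/

namespace Multiplet

section Converse

variable {n : ℕ} {M : Type*} [TopologicalSpace M] [ChartedSpace (Eucl n) M] {L : ℕ}
  [IsManifold (𝓡 n) ∞ M] (g : Metric n M) [T2Space M]

/-- The components of a section with lowered index. -/
def lower {P : Type*} [NormedAddCommGroup P] [NormedSpace ℝ P] (Φ : Multiplet n M L P) (c : M)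
    (Y : Sec n L P) (j : Fin n) (p : P) : Grassmann L := ∑ b, Φ.metricCoeff g c p j b * Y p b

section

variable {P : Type*} [NormedAddCommGroup P] [NormedSpace ℝ P] {Φ : Multiplet n M L P} {c c' : M}
  {p : P}

/-- The Gram matrix remains invertible along `u`: evaluation is multiplicative, so the inverse
matrix evaluated along `u` is its inverse. -/
theorem eq_zero_of_lower (hp : Φ.InChart c p) {Y : Sec n L P} (h : ∀ j, Φ.lower g c Y j p = 0) :
    Y p = 0 := by
  have hG := smoothNear_gram g hp
  have hI : ∀ a j, SmoothNear (fun x => (gram g c x)⁻¹ a j) (Φ.pos c p) :=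
    (mSmooth_gram g hp.target).inv (det_gram_ne_zero g hp.target)
  have h1 : ∀ a b, ∑ j, Φ.cf c (fun x => (gram g c x)⁻¹ a j) p * Φ.metricCoeff g c p j b
      = if a = b then 1 else 0 := by
    intro a b
    have e : (fun x => ∑ j, (gram g c x)⁻¹ a j * gram g c x j b) =ᶠ[𝓝 (Φ.pos c p)]
        fun _ => if a = b then 1 else 0 := by
      filter_upwards [eventually_target hp] with x hx
      have h2 := congrFun (congrFun (Matrix.nonsing_inv_mul (gram g c x)
        (Ne.isUnit (det_gram_ne_zero g hx))) a) b
      rwa [Matrix.mul_apply, Matrix.one_apply] at h2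
    have e2 := cf_congr hp e
    rw [cf_sum hp _ fun j => (hI a j).mul (hG j b)] at e2
    have e3 : Φ.cf c (fun _ => if a = b then 1 else 0) p = if a = b then 1 else 0 := by
      refine (chartEval_const (Φ.isPointOver p) _).trans ?_
      split_ifs <;> simp
    rw [← e3, ← e2]
    exact Finset.sum_congr rfl fun j _ => (cf_mul hp (hI a j) (hG j b)).symm
  funext a
  have h2 : ∑ j, Φ.cf c (fun x => (gram g c x)⁻¹ a j) p * Φ.lower g c Y j p = Y p a := by
    simp only [lower, Finset.mul_sum, ← mul_assoc]
    rw [Finset.sum_comm]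
    simp only [← Finset.sum_mul, h1, ite_mul, one_mul, zero_mul, Finset.sum_ite_eq,
      Finset.mem_univ, if_true]
  rw [← h2]
  simp [h]

theorem smoothNear_lower (hp : Φ.InChart c p) {Y : Sec n L P} (hY : SecSmooth Y p) (j : Fin n) :
    SmoothNear (Φ.lower g c Y j) p :=
  SmoothNear.sum fun b _ => (smoothNear_cf hp (smoothNear_gram g hp j b)).gmul (hY b)

theorem pair_single (hp : Φ.InChart c p) {X Y : Sec n L P} {r : ℝ} {k : Grassmann L} {j : Fin n}
    (hX : X p = fun i => r • (k * if i = j then 1 else 0)) :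
    Φ.pair c g X Y p = r • (k * Φ.lower g c Y j p) := by
  have h1 : ∀ i b, Φ.metricCoeff g c p i b * (r • (k * if i = j then 1 else 0)) * Y p b
      = if i = j then r • (k * (Φ.metricCoeff g c p i b * Y p b)) else 0 := by
    intro i b
    split_ifs
    · rw [mul_one, mul_smul_comm, smul_mul_assoc, metricCoeff_central g hp i b k, mul_assoc]
    · simp
  unfold pair bilin lower
  rw [hX]
  simp only [h1, Finset.mul_sum, Finset.smul_sum]
  rw [Finset.sum_comm]
  simp only [Finset.sum_ite_eq', Finset.mem_univ, if_true]

/-- The variation density is the derivative of the Lagrangian minus a divergence, both independent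
of the chart. So the transformation of the Euler–Lagrange expressions need not be examined. -/
theorem varIn_chart (hR : ParallelCurvature g) (hp : Φ.InChart c p) (hp' : Φ.InChart c' p)
    (e : Fin 2 → P) (τ : P) : Φ.varIn c g e τ p = Φ.varIn c' g e τ p :=
  add_right_cancel ((fderiv_lag g hR hp e τ).symm.trans (fderiv_lag g hR hp' e τ))

/-- By the chain rule a derivation with zero components is zero as a functional on all functions. -/
theorem F_eq_zero (hp : Φ.InChart c p) (h : Φ.FSec c p = 0) : Φ.F p = 0 := by
  ext f
  rw [← chartEval_inCoord hp (F_isLocalAt Φ p) f, chartEval_deriv hp (Φ.isPointOver p)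
    (Φ.F_leibniz p) (smoothNear_inCoord hp f), LinearMap.zero_apply]
  exact Finset.sum_eq_zero fun i _ => (congrArg _ (congrFun h i)).trans (mul_zero _)

end

variable {Φ : Multiplet n M L (ℝ × ℝ)} {L' : ℕ} {c : M} {p : ℝ × ℝ}

/-- Criticality and the first variation formula give two values for one derivative. On the support
of the test variation one fixed chart can be used by chart independence. -/
theorem integral_varIn_eq_zero (hR : ParallelCurvature g) (hΦ : Φ.IsCritical g) (hL : L ≤ L')
    (W : Variation (Φ.baseChange L')) {K : Set (ℝ × ℝ)} (hK : IsCompact K)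
    (hW : ∀ p ∉ K, W.A p = 0 ∧ (∀ a, W.B a p = 0) ∧ W.C p = 0)
    (hc : ∀ p ∈ K, Φ.InChart c p) :
    ∫ p in K, W.family.varIn c g (lift stdDir) (1, 0) (0, p) = 0 := by
  have h0 : ∀ p, (W.family.slice 0).AgreeAt (Φ.baseChange L') p := fun p =>
    W.agreeAt_family (zero_smul _ _) (fun _ => zero_smul _ _) (zero_smul _ _)
  have hV : ∀ t, ∀ p ∉ K, (W.family.slice t).AgreeAt (Φ.baseChange L') p := fun t p hp =>
    W.agreeAt_family (by rw [(hW p hp).1, smul_zero])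
      (fun a => by rw [(hW p hp).2.1 a, smul_zero]) (by rw [(hW p hp).2.2, smul_zero])
  have h1 := hΦ L' hL K hK W.family h0 hV
  have h2 := hasDerivAt_action g hR W.family hK fun t p hp => by
    rw [slice_zero_eq h0]
    exact hV t p hp
  refine Eq.trans (setIntegral_congr_fun hK.measurableSet fun p hp => ?_) (h2.unique h1)
  have hp1 : W.family.InChart c (0, p) := hc p hp
  exact varIn_chart g hR hp1 (W.family.inChart_body (0, p)) _ _

theorem lower_family {V : Multiplet n M L' (ℝ × (ℝ × ℝ))} (h0 : V.slice 0 = Φ.baseChange L')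
    {Y : Sec n L' (ℝ × (ℝ × ℝ))} {Y' : Sec n L (ℝ × ℝ)}
    (hY : ∀ l, Y (0, p) l = inclusion L L' (Y' p l)) (j : Fin n) :
    V.lower g c Y j (0, p) = inclusion L L' (Φ.lower g c Y' j p) := by
  have hG : ∀ b, V.metricCoeff g c (0, p) j b = inclusion L L' (Φ.metricCoeff g c p j b) :=
    fun b => cf_family h0 _
  unfold lower
  simp only [hY, hG, map_sum, map_mul]

/-- The fundamental lemma is applied to each lowered component multiplied by k; then the injectivity
assumption removes k and nondegeneracy of the metric raises the index. -/
theorem eq_zero_of_integral_lower {Y : Sec n L (ℝ × ℝ)} {k : Grassmann L'}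
    (hk : ∀ x, k * inclusion L L' x = 0 → x = 0) (hY : ∀ p, Φ.InChart c p → SecSmooth Y p)
    (h : ∀ j, ∀ χ : ℝ × ℝ → ℝ, ContDiff ℝ ∞ χ → HasCompactSupport χ →
      tsupport χ ⊆ {q | Φ.InChart c q} →
      ∫ p in tsupport χ, χ p • (k * inclusion L L' (Φ.lower g c Y j p)) = 0)
    (hp : Φ.InChart c p) : Y p = 0 := by
  have : CompleteSpace (Grassmann L') := FiniteDimensional.complete ℝ _
  refine eq_zero_of_lower g hp fun j => hk _ ?_
  have hU : IsOpen {q | Φ.InChart c q} :=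
    (isOpen_extChartAt_source c).preimage Φ.contMDiff_body.continuous
  refine eq_zero_of_integral_smul (f := fun p => k * inclusion L L' (Φ.lower g c Y j p)) hU
    (fun q hq => ContinuousAt.continuousWithinAt ?_) (h j) hp
  have h1 := (smoothNear_lower g hq (hY q hq) j).contDiffAt
  exact (contDiffAt_gmul contDiffAt_const
    ((contDiff_inclusion L L').contDiffAt.comp q h1)).continuousAt

theorem family_slice_zero (W : Variation (Φ.baseChange L')) :
    W.family.slice 0 = Φ.baseChange L' := slice_zero_eq fun _ =>
  W.agreeAt_family (zero_smul _ _) (fun _ => zero_smul _ _) (zero_smul _ _)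

theorem varIn_sectionVar (hp : Φ.InChart c p) (j : Fin n) {χ : ℝ × ℝ → ℝ}
    (hχ : tsupport χ ⊆ {q | (Φ.baseChange L').InChart c q}) (hχs : ContDiff ℝ ∞ χ)
    (κ : Fin 2 → Grassmann L') (hκ : ∀ a, κ a ∈ oddPart L') (κF : Grassmann L')
    (hκF : κF ∈ evenPart L') :
    (sectionVar j hχ hχs κ hκ κF hκF).family.varIn c g (lift stdDir) (1, 0) (0, p)
      = χ p • (κ 0 * inclusion L L' (Φ.lower g c (Φ.elFst c g stdDir) j p))
        - χ p • (κ 1 * inclusion L L' (Φ.lower g c (Φ.elSnd c g stdDir) j p))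
        + χ p • (κF * inclusion L L' (Φ.lower g c (Φ.FSec c) j p)) := by
  set W := sectionVar j hχ hχs κ hκ κF hκF
  have h0 := family_slice_zero W
  have hp' : W.family.InChart c (0, p) := hp
  have hpb : (Φ.baseChange L').InChart c p := hp
  have hA : (Φ.baseChange L').comp c W.A p = 0 := by
    funext i
    change germEval 0 _ _ = 0
    unfold germEval
    split_ifs <;> rfl
  have hB : ∀ a, W.family.nab g c (1, 0) (W.family.ψSec c a) (0, p)
      = fun i => χ p • (κ a * if i = j then 1 else 0) := fun a =>
    (W.nab_ψSec_family g hpb hA a).trans (comp_bumpDeriv j hχ (κ a) hpb)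
  have hC : W.family.nab g c (1, 0) (W.family.FSec c) (0, p)
      = fun i => χ p • (κF * if i = j then 1 else 0) :=
    (W.nab_FSec_family g hpb hA).trans (comp_bumpDeriv j hχ κF hpb)
  unfold varIn
  rw [pair_eq_zero_left g ((W.dc_family hpb).trans hA), pair_single g hp' (hB 0),
    pair_single g hp' (hB 1), pair_single g hp' hC, lower_family g h0 (elFst_family g h0 hp),
    lower_family g h0 (elSnd_family g h0 hp), lower_family g h0 (FSec_family h0), zero_add]

/-- Moving `u` drags the sections along, and their covariant time derivatives are not computed. They
do not matter, since they are paired with expressions already known to vanish. -/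
theorem varIn_mapVar (hp : Φ.InChart c p) (j : Fin n) {χ : ℝ × ℝ → ℝ}
    (hχ : tsupport χ ⊆ {q | (Φ.baseChange L').InChart c q}) (hχs : ContDiff ℝ ∞ χ)
    (k : Grassmann L') (hk : k ∈ evenPart L') (hkk : k * k = 0) (hkb : bodyMap L' k = 0)
    (h1 : Φ.elFst c g stdDir p = 0) (h2 : Φ.elSnd c g stdDir p = 0) (h3 : Φ.FSec c p = 0) :
    (mapVar j hχ k hχs hk hkk hkb).family.varIn c g (lift stdDir) (1, 0) (0, p)
      = χ p • (k * inclusion L L' (Φ.lower g c (Φ.elU c g stdDir) j p)) := by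
  set W := mapVar j hχ k hχs hk hkk hkb
  have h0 := family_slice_zero W
  have hp' : W.family.InChart c (0, p) := hp
  have hpb : (Φ.baseChange L').InChart c p := hp
  unfold varIn
  rw [pair_eq_zero_right g _ (funext fun l => (elFst_family g h0 hp l).trans (by rw [h1]; simp)),
    pair_eq_zero_right g _ (funext fun l => (elSnd_family g h0 hp l).trans (by rw [h2]; simp)),
    pair_eq_zero_right g _ (funext fun l => (FSec_family h0 l).trans (by rw [h3]; simp)),
    pair_single g hp' ((W.dc_family hpb).trans (comp_bumpDeriv j hχ k hpb)),
    lower_family g h0 (elU_family g h0 hp)]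
  simp

theorem integral_sectionVar (hR : ParallelCurvature g) (hΦ : Φ.IsCritical g) (hL : L ≤ L')
    (j : Fin n) {χ : ℝ × ℝ → ℝ} (hχs : ContDiff ℝ ∞ χ) (hχc : HasCompactSupport χ)
    (hχ : tsupport χ ⊆ {q | Φ.InChart c q})
    (κ : Fin 2 → Grassmann L') (hκ : ∀ a, κ a ∈ oddPart L') (κF : Grassmann L')
    (hκF : κF ∈ evenPart L') :
    ∫ p in tsupport χ, (χ p • (κ 0 * inclusion L L' (Φ.lower g c (Φ.elFst c g stdDir) j p))
        - χ p • (κ 1 * inclusion L L' (Φ.lower g c (Φ.elSnd c g stdDir) j p))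
        + χ p • (κF * inclusion L L' (Φ.lower g c (Φ.FSec c) j p))) = 0 := by
  refine Eq.trans (setIntegral_congr_fun (IsCompact.measurableSet hχc) fun p hp => ?_)
    (integral_varIn_eq_zero g hR hΦ hL (sectionVar (Ψ := Φ.baseChange L') j hχ hχs κ hκ κF hκF)
      hχc (fun _ hp => sectionVar_eq_zero (Ψ := Φ.baseChange L') j hχ hχs κ hκ κF hκF hp) fun p hp => hχ hp)
  exact (varIn_sectionVar g (hχ hp) j hχ hχs κ hκ κF hκF).symm

theorem solvesAt_of_isCritical (hR : ParallelCurvature g) (hΦ : Φ.IsCritical g)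
    (hp : Φ.InChart c p) : Φ.SolvesAt g c p := by
  have hL : L ≤ L + 2 := by omega
  -- Odd fields need odd coefficients in their variation; a new generator is odd and annihilates no
  -- nonzero element of the old algebra.
  have hθ : ∀ x, oddParam (extraFst L) * inclusion L (L + 2) x = 0 → x = 0 :=
    fun x => eq_zero_of_oddParam_mul le_rfl
  have hodd := oddParam_mem (extraFst L)
  have h1 : ∀ p, Φ.InChart c p → Φ.elFst c g stdDir p = 0 := fun p hp =>
    eq_zero_of_integral_lower g hθ (fun q hq => secSmooth_elFst g hq stdDir)
      (fun j χ hs hc hχ => by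
        have := integral_sectionVar g hR hΦ hL j hs hc hχ ![oddParam (extraFst L), 0]
          (fun a => by fin_cases a <;> simp [hodd]) 0 (Submodule.zero_mem _)
        simpa using this) hp
  have h2 : ∀ p, Φ.InChart c p → Φ.elSnd c g stdDir p = 0 := fun p hp =>
    eq_zero_of_integral_lower g hθ (fun q hq => secSmooth_elSnd g hq stdDir)
      (fun j χ hs hc hχ => by
        have := integral_sectionVar g hR hΦ hL j hs hc hχ ![0, oddParam (extraFst L)]
          (fun a => by fin_cases a <;> simp [hodd]) 0 (Submodule.zero_mem _)
        simpa [integral_neg] using this) hp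
  -- F' is even, so its test variation can have the coefficient 1.
  have h3 : ∀ p, Φ.InChart c p → Φ.FSec c p = 0 := fun p hp =>
    eq_zero_of_integral_lower g (k := (1 : Grassmann (L + 2)))
      (fun x hx => inclusion_injective hL (by rwa [one_mul, ← map_zero (inclusion L (L + 2))] at hx))
      (fun q hq => secSmooth_FSec hq)
      (fun j χ hs hc hχ => by
        have := integral_sectionVar g hR hΦ hL j hs hc hχ 0 (fun a => Submodule.zero_mem _) 1
          (map_one (algebraMap ℝ (Grassmann (L + 2))) ▸ algebraMap_mem_even 1)
        simpa using this) hp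
  -- The coefficient is the product of both new generators: even, of body zero so that the body of
  -- `u` stays fixed, and of square zero. The equations already obtained remove the contributions of
  -- the other fields.
  have h4 : Φ.elU c g stdDir p = 0 :=
    eq_zero_of_integral_lower g (fun x => eq_zero_of_oddParam_mul_mul)
      (fun q hq => secSmooth_elU g hq stdDir)
      (fun j χ hs hc hχ => by
        have hk := odd_mul_odd hodd (oddParam_mem (extraSnd L))
        have hkk := oddParam_mul_mul_self (extraFst L) (extraSnd L)
        have hkb : bodyMap (L + 2) (oddParam (extraFst L) * oddParam (extraSnd L)) = 0 := by
          rw [map_mul, bodyMap_oddParam, zero_mul]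
        refine Eq.trans (setIntegral_congr_fun (IsCompact.measurableSet hc) fun p hp => ?_)
          (integral_varIn_eq_zero g hR hΦ hL
            (mapVar (Ψ := Φ.baseChange (L + 2)) j hχ _ hs hk hkk hkb) hc
            (fun _ hp => mapVar_eq_zero (Ψ := Φ.baseChange (L + 2)) j hχ _ hs hk hkk hkb hp) fun p hp => hχ hp)
        exact (varIn_mapVar g (hχ hp) j hχ hs _
          hk hkk hkb (h1 p (hχ hp)) (h2 p (hχ hp)) (h3 p (hχ hp))).symm) hp
  exact ⟨h4, h1 p hp, h2 p hp, F_eq_zero hp (h3 p hp)⟩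

end Converse

end Multiplet

end SuperSigma

end

theorem mainTheorem6 {n : ℕ} {M : Type*} [TopologicalSpace M] [T2Space M]
    [ChartedSpace (SuperSigma.Eucl n) M] [IsManifold (𝓡 n) ∞ M] (g : SuperSigma.Metric n M)
    (hR : SuperSigma.ParallelCurvature g) {L : ℕ} (Φ : SuperSigma.Multiplet n M L (ℝ × ℝ)) :
    Φ.IsCritical g ↔
      ∀ p : ℝ × ℝ, ∀ c : M, Φ.body p ∈ (extChartAt (𝓡 n) c).source →
        (∀ l, Φ.laplacian c g p l =
          (1 / 2 : ℝ) • (Φ.curv c g (Φ.ψComp c 0) (Φ.ψComp c 0) (Φ.du c 0) p l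
              - Φ.curv c g (Φ.ψComp c 1) (Φ.ψComp c 1) (Φ.du c 0) p l)
            + Φ.curv c g (Φ.ψComp c 0) (Φ.ψComp c 1) (Φ.du c 1) p l) ∧
        (∀ l, Φ.dirac₁ c g p l = Φ.curv c g (Φ.ψComp c 0) (Φ.ψComp c 1) (Φ.ψComp c 0) p l) ∧
        (∀ l, Φ.dirac₂ c g p l = - Φ.curv c g (Φ.ψComp c 0) (Φ.ψComp c 1) (Φ.ψComp c 1) p l) ∧
        Φ.F p = 0 := by
  constructor
  · intro hΦ p c hp
    exact (SuperSigma.Multiplet.solvesAt_iff g Φ c p).mp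
      (SuperSigma.Multiplet.solvesAt_of_isCritical g hR hΦ hp)
  · intro h
    exact SuperSigma.Multiplet.isCritical_of_solves g hR fun p c hp =>
      (SuperSigma.Multiplet.solvesAt_iff g Φ c p).mpr (h p c hp)
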